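/- Let $N\ge 1$, $0<q<p-1$, $p<2$, $K_1,K_2>0$, let $\Omega\subset\mathbb R^N$ be open, $T>0$, $\Omega_T=\Omega\times(0,T)$. Let $\mathbf A:\Omega_T\times\mathbb R\times\mathbb R^N\to\mathbb R^N$ be measurable in $(x,t)$ for all $(u,\xi)$, continuous in $(u,\xi)$ for a.e. $(x,t)$, with $\mathbf A(x,t,u,\xi)\cdot\xi\ge K_1|\xi|^p$ and $|\mathbf A(x,t,u,\xi)|\le K_2|\xi|^{p-1}$ for a.e. $(x,t)\in\Omega_T$ and all $(u,\xi)$. A local weak solution of $$\partial_t\big(|u|^{q-1}u\big)-\operatorname{div}\mathbf A(x,t,u,Du)=0\quad\text{in }\Omega_T \qquad (1)$$ is a function $u\in C_{loc}(0,T;L^{q+1}_{loc}(\Omega))\cap L^p_{loc}(0,T;W^{1,p}_{loc}(\Omega))$ such that $$\int_E|u|^{q-1}u\,\eta\,dx\Big|_{t_1}^{t_2}+\int_{t_1}^{t_2}\!\!\int_E\big\{-|u|^{q-1}u\,\eta_t+\mathbf A(x,\tau,u,Du)\cdot D\eta\big\}\,dx\,d\tau=0$$ for every compact $E\subset\Omega$,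 every $[t_1,t_2]\subset(0,T)$ and every non-negative $\eta\in W^{1,q+1}_{loc}(0,T;L^{q+1}(E))\cap L^p_{loc}(0,T;W^{1,p}_0(E))$. **Theorem 1.2.** For all $l\ge \frac{2p^2}{2-p}$ and $c>0$ there is a constant $\gamma>0$, depending only on $N,p,q,K_1,K_2,l,c$, with the following property. Let $u$ be a locally bounded local weak solution of (1), let $r>0$, $s<t$, $B_r(y)\times(s,t)\subset\Omega_T$, and let $\mu^-\le u\le\mu^+$ a.e. in $B_r(y)\times(s,t)$. Let $\delta,\sigma\in(0,1)$, and let $\zeta\in C^1_0(B_r(y))$ satisfy $0\le\zeta\le1$, $\zeta=1$ in $B_{(1-\sigma)r}(y)$ and $|D\zeta|\le\frac{c}{\sigma r}$. Put $$\mathcal I^\pm(\tau)=\frac1{|B_r(y)|}\int_{B_r(y)}\pm\big(|\mu^\pm|^{q-1}\mu^\pm-|u(x,\tau)|^{q-1}u(x,\tau)\big)\,\zeta(x)^l\,dx .$$ Then, for both choices of the sign, $$\sup_{\tau}\mathcal I^\pm(\tau)\le\frac1{1-\delta}\inf_{\tau}\mathcal I^\pm(\tau)+\frac{\gamma}{(1-\delta)\,\delta^{\gamma}\sigma^{\gamma}}\,\big[\max(\mu^+,-\mu^-)\big]^{\frac{(1-q)(p-1)}{2-p}}\Big(\frac{t-s}{r^p}\Big)^{\frac1{2-p}},$$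 where the supremum and the infimum (both finite) are taken over all $\tau\in[s,t]\cap(0,T)$, that is, over all $\tau\in[s,t]$ at which $u(\cdot,\tau)$ is defined. -/

import Mathlib

open MeasureTheory

namespace DNL

/-- The space `ℝ^N` with its Euclidean norm. -/
abbrev Space (N : ℕ) : Type := EuclideanSpace ℝ (Fin N)

/-- The signed power `|a|^(q-1) a`, which is `0` for `a = 0`. -/
noncomputable def spow (q a : ℝ) : ℝ := |a| ^ (q - 1) * a

/-- Conditions on the vector field `A : Ω_T × ℝ × ℝ^N → ℝ^N` with `Ω_T = Ω × (0, T)`: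
measurability in `(x, t)`, continuity in `(u, ξ)`, and the growth conditions
`A(x,t,u,ξ) · ξ ≥ K₁ |ξ|^p`, `|A(x,t,u,ξ)| ≤ K₂ |ξ|^(p-1)`. -/
structure IsAdmissibleField {N : ℕ} (p K₁ K₂ : ℝ) (Ω : Set (Space N)) (T : ℝ)
    (A : Space N → ℝ → ℝ → Space N → Space N) : Prop where
  measurable : ∀ (v : ℝ) (ξ : Space N),
    AEMeasurable (fun z : Space N × ℝ => A z.1 z.2 v ξ)
      (volume.restrict (Ω ×ˢ Set.Ioo 0 T))
  continuous : ∀ᵐ z : Space N × ℝ ∂(volume.restrict (Ω ×ˢ Set.Ioo 0 T)),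
    Continuous (fun w : ℝ × Space N => A z.1 z.2 w.1 w.2)
  coercive : ∀ᵐ z : Space N × ℝ ∂(volume.restrict (Ω ×ˢ Set.Ioo 0 T)),
    ∀ (v : ℝ) (ξ : Space N), K₁ * ‖ξ‖ ^ p ≤ inner ℝ (A z.1 z.2 v ξ) ξ
  growth : ∀ᵐ z : Space N × ℝ ∂(volume.restrict (Ω ×ˢ Set.Ioo 0 T)),
    ∀ (v : ℝ) (ξ : Space N), ‖A z.1 z.2 v ξ‖ ≤ K₂ * ‖ξ‖ ^ (p - 1)

/-- `g` is the weak (distributional) gradient of `f` in the open set `Ω`. -/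
def HasWeakGradient {N : ℕ} (Ω : Set (Space N)) (f : Space N → ℝ)
    (g : Space N → Space N) : Prop :=
  LocallyIntegrableOn f Ω ∧ LocallyIntegrableOn g Ω ∧
  ∀ φ : Space N → ℝ, ContDiff ℝ (⊤ : ℕ∞) φ → HasCompactSupport φ → tsupport φ ⊆ Ω →
    ∫ x in Ω, f x • gradient φ x = -∫ x in Ω, φ x • g x

/-- `u ∈ C_loc(0, T; L^m_loc(Ω))`. -/
def MemCLocLpLoc {N : ℕ} (m : ℝ) (Ω : Set (Space N)) (T : ℝ) (u : Space N → ℝ → ℝ) : Prop :=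
  ∀ K : Set (Space N), IsCompact K → K ⊆ Ω → ∀ τ ∈ Set.Ioo 0 T,
    MemLp (fun x => u x τ) (ENNReal.ofReal m) (volume.restrict K) ∧
    Filter.Tendsto
      (fun τ' => eLpNorm (fun x => u x τ' - u x τ) (ENNReal.ofReal m) (volume.restrict K))
      (nhds τ) (nhds 0)

/-- `u ∈ L^p_loc(0, T; W^{1,p}_loc(Ω))`, with spatial weak gradient `Du`. -/
structure MemLpLocSobolevLoc {N : ℕ} (p : ℝ) (Ω : Set (Space N)) (T : ℝ)
    (u : Space N → ℝ → ℝ) (Du : Space N → ℝ → Space N) : Prop where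
  measurable : AEStronglyMeasurable (fun z : Space N × ℝ => u z.1 z.2)
    (volume.restrict (Ω ×ˢ Set.Ioo 0 T))
  measurable_grad : AEStronglyMeasurable (fun z : Space N × ℝ => Du z.1 z.2)
    (volume.restrict (Ω ×ˢ Set.Ioo 0 T))
  weakGradient : ∀ᵐ τ : ℝ ∂(volume.restrict (Set.Ioo 0 T)),
    HasWeakGradient Ω (fun x => u x τ) (fun x => Du x τ)
  memLp : ∀ K : Set (Space N), IsCompact K → K ⊆ Ω → ∀ t₁ t₂ : ℝ, 0 < t₁ → t₁ < t₂ → t₂ < T →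
    MemLp (fun z : Space N × ℝ => u z.1 z.2) (ENNReal.ofReal p)
      (volume.restrict (K ×ˢ Set.Icc t₁ t₂)) ∧
    MemLp (fun z : Space N × ℝ => Du z.1 z.2) (ENNReal.ofReal p)
      (volume.restrict (K ×ˢ Set.Icc t₁ t₂))

/-- `f ∈ W^{1,p}_0(K)` with weak gradient `g`: the closure in `W^{1,p}` of the smooth functions
with compact support in the interior of `K`. -/
def MemSobolevZero {N : ℕ} (p : ℝ) (K : Set (Space N)) (f : Space N → ℝ)
    (g : Space N → Space N) : Prop :=
  MemLp f (ENNReal.ofReal p) (volume.restrict K) ∧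
  MemLp g (ENNReal.ofReal p) (volume.restrict K) ∧
  ∃ φ : ℕ → Space N → ℝ,
    (∀ n, ContDiff ℝ (⊤ : ℕ∞) (φ n) ∧ HasCompactSupport (φ n) ∧
      tsupport (φ n) ⊆ interior K) ∧
    Filter.Tendsto
      (fun n => eLpNorm (fun x => φ n x - f x) (ENNReal.ofReal p) (volume.restrict K))
      Filter.atTop (nhds 0) ∧
    Filter.Tendsto
      (fun n => eLpNorm (fun x => gradient (φ n) x - g x) (ENNReal.ofReal p) (volume.restrict K))
      Filter.atTop (nhds 0)

/-- Non-negative test functions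
`η ∈ W^{1,q+1}_loc(0, T; L^{q+1}(K)) ∩ L^p_loc(0, T; W^{1,p}_0(K))` (in their representative that is
absolutely continuous in time), with time derivative `ηt` and spatial weak gradient `Dη`. -/
structure IsTestFunction {N : ℕ} (p q : ℝ) (K : Set (Space N)) (T : ℝ)
    (η ηt : Space N → ℝ → ℝ) (Dη : Space N → ℝ → Space N) : Prop where
  nonneg : ∀ τ ∈ Set.Ioo 0 T, ∀ᵐ x ∂(volume.restrict K), 0 ≤ η x τ
  memLp_slice : ∀ τ ∈ Set.Ioo 0 T,
    MemLp (fun x => η x τ) (ENNReal.ofReal (q + 1)) (volume.restrict K)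
  memLp : ∀ t₁ t₂ : ℝ, 0 < t₁ → t₁ < t₂ → t₂ < T →
    MemLp (fun z : Space N × ℝ => η z.1 z.2) (ENNReal.ofReal (q + 1))
      (volume.restrict (K ×ˢ Set.Icc t₁ t₂)) ∧
    MemLp (fun z : Space N × ℝ => ηt z.1 z.2) (ENNReal.ofReal (q + 1))
      (volume.restrict (K ×ˢ Set.Icc t₁ t₂)) ∧
    MemLp (fun z : Space N × ℝ => η z.1 z.2) (ENNReal.ofReal p)
      (volume.restrict (K ×ˢ Set.Icc t₁ t₂)) ∧
    MemLp (fun z : Space N × ℝ => Dη z.1 z.2) (ENNReal.ofReal p)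
      (volume.restrict (K ×ˢ Set.Icc t₁ t₂))
  timeDeriv : ∀ t₁ t₂ : ℝ, 0 < t₁ → t₁ < t₂ → t₂ < T → ∀ᵐ x ∂(volume.restrict K),
    η x t₂ - η x t₁ = ∫ τ in t₁..t₂, ηt x τ
  sobolevZero : ∀ᵐ τ : ℝ ∂(volume.restrict (Set.Ioo 0 T)),
    MemSobolevZero p K (fun x => η x τ) (fun x => Dη x τ)

/-- The left-hand side of the weak formulation:
`∫_K |u|^(q-1) u η dx |_{t₁}^{t₂}
  + ∫_{t₁}^{t₂} ∫_K (-|u|^(q-1) u η_t + A(x,τ,u,Du) · Dη) dx dτ`. -/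
noncomputable def weakForm {N : ℕ} (q : ℝ) (A : Space N → ℝ → ℝ → Space N → Space N)
    (u : Space N → ℝ → ℝ) (Du : Space N → ℝ → Space N) (K : Set (Space N)) (t₁ t₂ : ℝ)
    (η ηt : Space N → ℝ → ℝ) (Dη : Space N → ℝ → Space N) : ℝ :=
  (∫ x in K, spow q (u x t₂) * η x t₂) - (∫ x in K, spow q (u x t₁) * η x t₁) +
  ∫ z in K ×ˢ Set.Icc t₁ t₂,
    (-(spow q (u z.1 z.2) * ηt z.1 z.2) +
      inner ℝ (A z.1 z.2 (u z.1 z.2) (Du z.1 z.2)) (Dη z.1 z.2))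

/-- `u`, with spatial weak gradient `Du`, is a local weak sub-solution of
`∂_t (|u|^(q-1) u) - div A(x, t, u, Du) = 0` in `Ω_T`. -/
def IsLocalWeakSubsolution {N : ℕ} (p q : ℝ) (Ω : Set (Space N)) (T : ℝ)
    (A : Space N → ℝ → ℝ → Space N → Space N)
    (u : Space N → ℝ → ℝ) (Du : Space N → ℝ → Space N) : Prop :=
  MemCLocLpLoc (q + 1) Ω T u ∧ MemLpLocSobolevLoc p Ω T u Du ∧
  ∀ K : Set (Space N), IsCompact K → K ⊆ Ω → ∀ t₁ t₂ : ℝ, 0 < t₁ → t₁ < t₂ → t₂ < T →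
  ∀ (η ηt : Space N → ℝ → ℝ) (Dη : Space N → ℝ → Space N), IsTestFunction p q K T η ηt Dη →
    weakForm q A u Du K t₁ t₂ η ηt Dη ≤ 0

/-- `u`, with spatial weak gradient `Du`, is a local weak super-solution of
`∂_t (|u|^(q-1) u) - div A(x, t, u, Du) = 0` in `Ω_T`. -/
def IsLocalWeakSupersolution {N : ℕ} (p q : ℝ) (Ω : Set (Space N)) (T : ℝ)
    (A : Space N → ℝ → ℝ → Space N → Space N)
    (u : Space N → ℝ → ℝ) (Du : Space N → ℝ → Space N) : Prop :=
  MemCLocLpLoc (q + 1) Ω T u ∧ MemLpLocSobolevLoc p Ω T u Du ∧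
  ∀ K : Set (Space N), IsCompact K → K ⊆ Ω → ∀ t₁ t₂ : ℝ, 0 < t₁ → t₁ < t₂ → t₂ < T →
  ∀ (η ηt : Space N → ℝ → ℝ) (Dη : Space N → ℝ → Space N), IsTestFunction p q K T η ηt Dη →
    0 ≤ weakForm q A u Du K t₁ t₂ η ηt Dη

/-- A local weak solution is both a local weak sub-solution and a local weak super-solution
(the weak gradient being unique up to null sets, one `Du` serves both). -/
def IsLocalWeakSolution {N : ℕ} (p q : ℝ) (Ω : Set (Space N)) (T : ℝ)
    (A : Space N → ℝ → ℝ → Space N → Space N) (u : Space N → ℝ → ℝ) : Prop :=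
  ∃ Du : Space N → ℝ → Space N,
    IsLocalWeakSubsolution p q Ω T A u Du ∧ IsLocalWeakSupersolution p q Ω T A u Du

/-- `u ∈ L^∞_loc(Ω_T)`. -/
def IsLocallyBounded {N : ℕ} (Ω : Set (Space N)) (T : ℝ) (u : Space N → ℝ → ℝ) : Prop :=
  ∀ C : Set (Space N × ℝ), IsCompact C → C ⊆ Ω ×ˢ Set.Ioo 0 T →
    ∃ M : ℝ, ∀ᵐ z ∂(volume.restrict C), |u z.1 z.2| ≤ M

/-- The cutoff `ζ ∈ C^1_0(B_r(y))`, `0 ≤ ζ ≤ 1`, `ζ = 1` in `B_{(1-σ)r}(y)`,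
`|Dζ| ≤ c / (σ r)`. -/
structure IsCutoff {N : ℕ} (c σ r : ℝ) (y : Space N) (ζ : Space N → ℝ) : Prop where
  contDiff : ContDiff ℝ 1 ζ
  hasCompactSupport : HasCompactSupport ζ
  tsupport_subset : tsupport ζ ⊆ Metric.ball y r
  eq_one : ∀ x ∈ Metric.ball y (r * (1 - σ)), ζ x = 1
  nonneg : ∀ x, 0 ≤ ζ x
  le_one : ∀ x, ζ x ≤ 1
  gradient_le : ∀ x, ‖gradient ζ x‖ ≤ c / (σ * r)

/-- The average of `(|μ⁺|^(q-1) μ⁺ - |u|^(q-1) u) ζ^l` over `B_r(y) × {τ}`. -/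
noncomputable def meanPlus {N : ℕ} (q l μp : ℝ) (u : Space N → ℝ → ℝ) (ζ : Space N → ℝ)
    (y : Space N) (r τ : ℝ) : ℝ :=
  ⨍ x in Metric.ball y r, (spow q μp - spow q (u x τ)) * ζ x ^ l

/-- The average of `-(|μ⁻|^(q-1) μ⁻ - |u|^(q-1) u) ζ^l` over `B_r(y) × {τ}`. -/
noncomputable def meanMinus {N : ℕ} (q l μm : ℝ) (u : Space N → ℝ → ℝ) (ζ : Space N → ℝ)
    (y : Space N) (r τ : ℝ) : ℝ :=
  ⨍ x in Metric.ball y r, -(spow q μm - spow q (u x τ)) * ζ x ^ l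

/-- `sup_{τ ∈ J} I(τ) ≤ (1-δ)⁻¹ inf_{τ ∈ J} I(τ) + R`, the supremum and the infimum being finite. -/
def SupLeInf (δ R : ℝ) (J : Set ℝ) (I : ℝ → ℝ) : Prop :=
  BddAbove (I '' J) ∧ BddBelow (I '' J) ∧
    sSup (I '' J) ≤ 1 / (1 - δ) * sInf (I '' J) + R

end DNL

/-! Write β(a) = |a|^(q-1) a, h = μ⁺ - u, and consider the mass ∫ (β(μ⁺) - β(u)) ζ^l. Testing the
equation with ζ^l shows that the mass changes between two times by at most b D, where b = K₂ l c /
(σ r) and D = ∫∫ |Du|^(p-1) ζ^(l-1). If b D ≤ δ (S + k |B|), with S the supremum of the mass and |B|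
the volume of the ball, then sup - inf is at most δ times the supremum plus an error, and the
supremum is absorbed (`abs_mass_sub_le`, `supLeInf_of_oscillation`).

To bound D, test with f(h) ζ^l, where f(h) = ν^(-κ) - (h+ν)^(-κ) and κ = (2-p)/p. Since f is
increasing and bounded by ν^(-κ), the time term costs at most ν^(-κ) S, and E = ∫∫ κ (h+ν)^(-κ-1)
|Du|^p ζ^l satisfies K₁ E ≤ ν^(-κ) (S + b D). Young's inequality bounds D by λ E plus a multiple of
λ^(1-p) ∫∫ (h+ν)^θ ζ^(l-p), with θ = 2(p-1)/p = 1 - κ < 1. The lower bound on l lets ζ^(l-p) be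
replaced by (ζ^l)^θ, so the last integrand is at most ν^(θ-1) (h ζ^l + 2ν). Finally h ≤ (M^(1-q)/q)
(β(μ⁺) - β(u)), because q < 1 and |u| ≤ M = max(μ⁺, -μ⁻). This is `exists_energy_bounds`. In
`flux_le_of_energy` the parameters are balanced: λ is proportional to ν^κ, ν = M^(1-q) k, and
k^(2-p) is a multiple of (δσ)^(-p) M^((1-q)(p-1)) (t-s)/r^p. This k is the error term of the
theorem.

The function f(h) ζ^l need not have a time derivative, so it is not directly admissible. For almost
every τ its slice at time τ, which lies in W^{1,p}_0 by `memSobolevZero_comp_mul`, is frozen and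
used as a stationary test function on [τ-ε, τ]. The primitive G of f, taken in the variable β(μ⁺) -
β(u), is convex, so the resulting increment is at least that of ∫ G ζ^l. Integrating in τ telescopes
these increments; dividing by ε and letting ε tend to 0, by continuity of translations in
L^(p/(p-1)), gives the energy inequality (`neg_le_setIntegral_inner_of_slices`,
`neg_le_integral_flux_inner`).

The other sign is the same estimate for -u, which solves an equation of the same type with the same
constants. -/

namespace DNL
-- Translations and mollification in L^p
open Filter Topology
open scoped ENNReal Convolution

/-- Translations are continuous in `L^p`. -/
theorem tendsto_eLpNorm_translate {G E : Type*} [NormedAddCommGroup G] [MeasurableSpace G]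
    [BorelSpace G] [NormedAddCommGroup E] (μ : Measure G) [IsLocallyFiniteMeasure μ]
    [μ.InnerRegularCompactLTTop] [μ.IsAddRightInvariant] [MeasurableAdd G]
    {p : ℝ≥0∞} (hp1 : 1 ≤ p) (hp : p ≠ ∞)
    {g : G → E} (hg : MemLp g p μ) :
    Tendsto (fun y => eLpNorm (fun x => g (x - y) - g x) p μ) (𝓝 0) (𝓝 0) := by
  have : Fact (1 ≤ p) := ⟨hp1⟩
  let T : G → C(G, G) := fun y => ⟨fun x => x - y, by fun_prop⟩
  have hT : Continuous T := by
    refine (ContinuousMap.curry ⟨fun z : G × G => z.2 - z.1, by fun_prop⟩).continuous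
  have hmp : ∀ y, MeasurePreserving (T y) μ μ := fun y => by
    simpa [T, sub_eq_add_neg] using measurePreserving_add_right μ (-y)
  have h := Continuous.compMeasurePreservingLp (μ := μ) (ν := μ) (E := E) (p := p)
    (f := fun _ : G => hg.toLp g) continuous_const hT hmp hp
  have h0 := (h.tendsto 0)
  rw [tendsto_iff_edist_tendsto_0] at h0
  refine h0.congr fun y => ?_
  rw [Lp.edist_def]
  refine eLpNorm_congr_ae ?_
  have e1 := Lp.coeFn_compMeasurePreserving (hg.toLp g) (hmp y)
  have e2 := Lp.coeFn_compMeasurePreserving (hg.toLp g) (hmp 0)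
  have e3 := (hmp y).quasiMeasurePreserving.ae_eq_comp (MemLp.coeFn_toLp hg)
  have e4 := (hmp 0).quasiMeasurePreserving.ae_eq_comp (MemLp.coeFn_toLp hg)
  filter_upwards [e1, e2, e3, e4] with x a1 a2 a3 a4
  simp only [Pi.sub_apply, a1, a2, Function.comp] at *
  rw [a3, a4]
  simp [T]

/-- Mollifications converge in `L^p`. -/
theorem tendsto_eLpNorm_mollify {G E : Type*} [NormedAddCommGroup G] [NormedSpace ℝ G]
    [FiniteDimensional ℝ G] [MeasurableSpace G]
    [BorelSpace G] [NormedAddCommGroup E] [NormedSpace ℝ E] [CompleteSpace E]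
    (μ : Measure G) [μ.IsAddHaarMeasure]
    {p : ℝ} (hp1 : 1 ≤ p) {g : G → E} (hg : MemLp g (ENNReal.ofReal p) μ)
    {φ : ℕ → ContDiffBump (0 : G)} (hφ : Tendsto (fun n => (φ n).rOut) atTop (𝓝 0)) :
    Tendsto (fun n => eLpNorm
      (fun x => ((φ n).normed μ ⋆[ContinuousLinearMap.lsmul ℝ ℝ, μ] g) x - g x)
      (ENNReal.ofReal p) μ) atTop (𝓝 0) := by
  have hp0 : 0 < p := by linarith
  have hpp : (1 : ℝ≥0∞) ≤ ENNReal.ofReal p := by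
    rw [← ENNReal.ofReal_one]; exact ENNReal.ofReal_le_ofReal hp1
  have hq0 : ENNReal.ofReal p ≠ 0 := (zero_lt_one.trans_le hpp).ne'
  have htr := tendsto_eLpNorm_translate μ hpp ENNReal.ofReal_ne_top hg
  have hgl : LocallyIntegrable g μ := hg.locallyIntegrable hpp
  rw [ENNReal.tendsto_nhds_zero] at htr ⊢
  intro ε hε
  obtain ⟨d, hd, hball⟩ := Metric.eventually_nhds_iff.1 (htr ε hε)
  filter_upwards [(tendsto_order.1 hφ).2 d hd] with n hn
  set ρ : G → ℝ := (φ n).normed μ with hρ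
  have hρc : Continuous ρ := (φ n).continuous_normed
  have hρ0 : ∀ y, 0 ≤ ρ y := (φ n).nonneg_normed
  have hρm : Measurable fun y => ENNReal.ofReal (ρ y) := hρc.measurable.ennreal_ofReal
  have hρ1 : ∫⁻ y, ENNReal.ofReal (ρ y) ∂μ = 1 := by
    rw [← ofReal_integral_eq_lintegral_ofReal (φ n).integrable_normed (ae_of_all _ hρ0),
      (φ n).integral_normed, ENNReal.ofReal_one]
  -- The bump is the density of a probability measure, so the p-th power of the mollification error
  -- is bounded by Jensen's inequality.
  let m : Measure G := μ.withDensity fun y => ENNReal.ofReal (ρ y)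
  have : IsProbabilityMeasure m := ⟨by simp [m, hρ1]⟩
  -- A strongly measurable representative makes the double integrand measurable, as Tonelli's
  -- theorem needs.
  obtain ⟨g', hg'm, hgg'⟩ := hg.1
  have hexp : (ENNReal.ofReal p).toReal = p := ENNReal.toReal_ofReal hp0.le
  -- pointwise Jensen
  have key : ∀ᵐ x ∂μ, ‖(ρ ⋆[ContinuousLinearMap.lsmul ℝ ℝ, μ] g) x - g x‖ₑ ^ p
      ≤ ∫⁻ y, ENNReal.ofReal (ρ y) * ‖g' (x - y) - g' x‖ₑ ^ p ∂μ := by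
    filter_upwards [hgg'] with x hx
    have hc : ConvolutionExistsAt ρ g x (ContinuousLinearMap.lsmul ℝ ℝ) μ :=
      HasCompactSupport.convolutionExists_left _ (φ n).hasCompactSupport_normed hρc hgl x
    have e1 : (ρ ⋆[ContinuousLinearMap.lsmul ℝ ℝ, μ] g) x - g x
        = ∫ y, ρ y • (g (x - y) - g x) ∂μ := by
      simp_rw [smul_sub]
      have e2 : ∫ y, ρ y • g x ∂μ = g x := by
        rw [integral_smul_const, (φ n).integral_normed, one_smul]
      have e3 : Integrable (fun y => ρ y • g (x - y)) μ := hc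
      rw [integral_sub e3 ((φ n).integrable_normed.smul_const _), e2]
      rfl
    have hq : ∀ᵐ y ∂μ, g (x - y) = g' (x - y) :=
      (quasiMeasurePreserving_sub_left μ x).ae_eq_comp hgg'
    have hstr : StronglyMeasurable (fun y => g' (x - y) - g' x) :=
      (hg'm.comp_measurable (measurable_id.const_sub x)).sub stronglyMeasurable_const
    have hmeas : AEStronglyMeasurable (fun y => g' (x - y) - g' x) m := hstr.aestronglyMeasurable
    calc ‖(ρ ⋆[ContinuousLinearMap.lsmul ℝ ℝ, μ] g) x - g x‖ₑ ^ p
        ≤ (∫⁻ y, ‖g' (x - y) - g' x‖ₑ ∂m) ^ p := by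
          gcongr
          rw [e1]
          refine (enorm_integral_le_lintegral_enorm _).trans ?_
          rw [lintegral_withDensity_eq_lintegral_mul _ hρm hstr.enorm]
          refine lintegral_mono_ae ?_
          filter_upwards [hq] with y hy
          rw [hy, hx, enorm_smul, Real.enorm_of_nonneg (hρ0 y)]
          rfl
      _ ≤ ∫⁻ y, ‖g' (x - y) - g' x‖ₑ ^ p ∂m := by
          have := eLpNorm_le_eLpNorm_of_exponent_le hpp hmeas
          rw [eLpNorm_one_eq_lintegral_enorm,
            eLpNorm_eq_lintegral_rpow_enorm_toReal hq0 ENNReal.ofReal_ne_top, hexp] at this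
          calc _ ≤ ((∫⁻ y, ‖g' (x - y) - g' x‖ₑ ^ p ∂m) ^ (1 / p)) ^ p := by gcongr
            _ = _ := by rw [← ENNReal.rpow_mul, one_div, inv_mul_cancel₀ hp0.ne', ENNReal.rpow_one]
      _ = _ := by
          rw [lintegral_withDensity_eq_lintegral_mul _ hρm]
          · rfl
          · exact hstr.enorm.pow_const _
  rw [eLpNorm_eq_lintegral_rpow_enorm_toReal hq0 ENNReal.ofReal_ne_top, hexp]
  -- Only shifts in the support of the bump matter, and these are shorter than the `d` given by
  -- continuity of translations.
  have hbd : ∀ y, ρ y ≠ 0 → ∫⁻ x, ‖g' (x - y) - g' x‖ₑ ^ p ∂μ ≤ ε ^ p := by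
    intro y hy
    have hyb : y ∈ Metric.ball (0 : G) (φ n).rOut := by
      rw [← (φ n).support_normed_eq (μ := μ)]; exact hy
    have h1 := hball (y := y) (lt_trans (by simpa using hyb) hn)
    have h2 : eLpNorm (fun x => g (x - y) - g x) (ENNReal.ofReal p) μ
        = eLpNorm (fun x => g' (x - y) - g' x) (ENNReal.ofReal p) μ := by
      refine eLpNorm_congr_ae ?_
      have hq : ∀ᵐ x ∂μ, g (x - y) = g' (x - y) := by
        have := (measurePreserving_add_right μ (-y)).quasiMeasurePreserving.ae_eq_comp hgg'
        simpa [Function.comp_def, sub_eq_add_neg, EventuallyEq] using this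
      filter_upwards [hq, hgg'] with x a b
      rw [a, b]
    rw [h2, eLpNorm_eq_lintegral_rpow_enorm_toReal hq0 ENNReal.ofReal_ne_top, hexp] at h1
    calc _ = ((∫⁻ x, ‖g' (x - y) - g' x‖ₑ ^ p ∂μ) ^ (1 / p)) ^ p := by
          rw [← ENNReal.rpow_mul, one_div, inv_mul_cancel₀ hp0.ne', ENNReal.rpow_one]
      _ ≤ _ := by gcongr
  have hjm : Measurable fun z : G × G =>
      ENNReal.ofReal (ρ z.2) * ‖g' (z.1 - z.2) - g' z.1‖ₑ ^ p := by
    refine (hρm.comp measurable_snd).mul (Measurable.pow_const ?_ _)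
    exact ((hg'm.comp_measurable (measurable_fst.sub measurable_snd)).sub
      (hg'm.comp_measurable measurable_fst)).enorm
  calc (∫⁻ x, ‖(ρ ⋆[ContinuousLinearMap.lsmul ℝ ℝ, μ] g) x - g x‖ₑ ^ p ∂μ) ^ (1 / p)
      ≤ (∫⁻ x, ∫⁻ y, ENNReal.ofReal (ρ y) * ‖g' (x - y) - g' x‖ₑ ^ p ∂μ ∂μ) ^ (1 / p) := by
        exact ENNReal.rpow_le_rpow (lintegral_mono_ae key) (by positivity)
    _ = (∫⁻ y, ∫⁻ x, ENNReal.ofReal (ρ y) * ‖g' (x - y) - g' x‖ₑ ^ p ∂μ ∂μ) ^ (1 / p) := by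
        rw [lintegral_lintegral_swap hjm.aemeasurable]
    _ ≤ (∫⁻ y, ENNReal.ofReal (ρ y) * ε ^ p ∂μ) ^ (1 / p) := by
        gcongr with y
        rw [lintegral_const_mul' _ _ ENNReal.ofReal_ne_top]
        by_cases hy : ρ y = 0
        · simp [hy]
        · gcongr
          exact hbd y hy
    _ = ε := by
        rw [lintegral_mul_const _ hρm, hρ1, one_mul, ← ENNReal.rpow_mul, one_div,
          mul_inv_cancel₀ hp0.ne', ENNReal.rpow_one]

end DNL

/-! ### Mollification and weak gradients -/

namespace DNL
open Filter Topology
open scoped ENNReal Convolution Gradient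

/-- Dominated convergence in `L^p`. -/
theorem tendsto_eLpNorm_of_dominated {α E : Type*} [MeasurableSpace α] [NormedAddCommGroup E]
    {μ : Measure α} {p : ℝ} (hp : 0 < p) {f : ℕ → α → E} {g : α → ℝ}
    (hf : ∀ n, AEStronglyMeasurable (f n) μ) (hg : MemLp g (ENNReal.ofReal p) μ)
    (hfg : ∀ n, ∀ᵐ x ∂μ, ‖f n x‖ ≤ g x)
    (hlim : ∀ᵐ x ∂μ, Tendsto (fun n => f n x) atTop (𝓝 0)) :
    Tendsto (fun n => eLpNorm (f n) (ENNReal.ofReal p) μ) atTop (𝓝 0) := by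
  have hq0 : ENNReal.ofReal p ≠ 0 := by simpa using hp
  have hexp : (ENNReal.ofReal p).toReal = p := ENNReal.toReal_ofReal hp.le
  have h : Tendsto (fun n => ∫⁻ x, ‖f n x‖ₑ ^ p ∂μ) atTop (𝓝 (∫⁻ _, 0 ∂μ)) := by
    refine tendsto_lintegral_of_dominated_convergence' (fun x => ‖g x‖ₑ ^ p)
      (fun n => (hf n).enorm.pow_const _) (fun n => ?_) ?_ ?_
    · filter_upwards [hfg n] with x hx
      gcongr
      rw [enorm_le_iff_norm_le]
      exact hx.trans (Real.le_norm_self _)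
    · have := hg.2
      rw [eLpNorm_eq_lintegral_rpow_enorm_toReal hq0 ENNReal.ofReal_ne_top, hexp] at this
      exact ((ENNReal.rpow_lt_top_iff_of_pos (by positivity)).1 this).ne
    · filter_upwards [hlim] with x hx
      have h1 : Tendsto (fun n => ‖f n x‖ₑ) atTop (𝓝 0) := by
        simpa using hx.enorm
      have := h1.ennrpow_const p
      rwa [ENNReal.zero_rpow_of_pos hp] at this
  rw [lintegral_zero] at h
  have := h.ennrpow_const (1 / p)
  rw [ENNReal.zero_rpow_of_pos (by positivity)] at this
  refine this.congr fun n => ?_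
  rw [eLpNorm_eq_lintegral_rpow_enorm_toReal hq0 ENNReal.ofReal_ne_top, hexp]

section Convolution

variable {G E : Type*} [NormedAddCommGroup G] [NormedSpace ℝ G] [FiniteDimensional ℝ G]
  [MeasurableSpace G] [BorelSpace G] [NormedAddCommGroup E] [NormedSpace ℝ E] [CompleteSpace E]
  (μ : Measure G) [μ.IsAddHaarMeasure] (φ : ContDiffBump (0 : G))

omit [CompleteSpace E] in
theorem norm_mollify_le {f : G → E} {C : ℝ} (hC : ∀ᵐ x ∂μ, ‖f x‖ ≤ C) (x : G) :
    ‖(φ.normed μ ⋆[ContinuousLinearMap.lsmul ℝ ℝ, μ] f) x‖ ≤ C := by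
  have h1 : ∀ᵐ y ∂μ, ‖f (x - y)‖ ≤ C :=
    (quasiMeasurePreserving_sub_left μ x).ae hC
  have h2 : ‖(φ.normed μ ⋆[ContinuousLinearMap.lsmul ℝ ℝ, μ] f) x‖
      ≤ ∫ y, φ.normed μ y * C ∂μ := by
    refine norm_integral_le_of_norm_le (φ.integrable_normed.mul_const _) ?_
    filter_upwards [h1] with y hy
    simp only [ContinuousLinearMap.lsmul_apply, norm_smul, Real.norm_of_nonneg (φ.nonneg_normed y)]
    exact mul_le_mul_of_nonneg_left hy (φ.nonneg_normed y)
  rwa [integral_mul_const, φ.integral_normed, one_mul] at h2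

theorem mollify_nonneg {f : G → ℝ} (hf : ∀ᵐ x ∂μ, 0 ≤ f x) (x : G) :
    0 ≤ (φ.normed μ ⋆[ContinuousLinearMap.lsmul ℝ ℝ, μ] f) x := by
  have h1 : ∀ᵐ y ∂μ, 0 ≤ f (x - y) := (quasiMeasurePreserving_sub_left μ x).ae hf
  refine integral_nonneg_of_ae ?_
  filter_upwards [h1] with y hy
  exact mul_nonneg (φ.nonneg_normed y) hy

/-- The gradient of the mollification of a `C¹` function with compact support. -/
theorem hasGradientAt_mollify_right {N : ℕ} (φ : ContDiffBump (0 : Space N)) {Z : Space N → ℝ}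
    (hZ : ContDiff ℝ 1 Z) (hc : HasCompactSupport Z) (x : Space N) :
    HasGradientAt (φ.normed volume ⋆[ContinuousLinearMap.lsmul ℝ ℝ, volume] Z)
      ((φ.normed volume ⋆[ContinuousLinearMap.lsmul ℝ ℝ, volume] (∇ Z)) x) x := by
  have hl : LocallyIntegrable (φ.normed (volume : Measure (Space N))) :=
    φ.integrable_normed.locallyIntegrable
  have h := hc.hasFDerivAt_convolution_right (ContinuousLinearMap.lsmul ℝ ℝ) hl hZ x
  rw [hasGradientAt_iff_hasFDerivAt]
  refine h.congr_fderiv (ContinuousLinearMap.ext fun e => Eq.symm ?_)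
  have hd : Continuous (fderiv ℝ Z) := hZ.continuous_fderiv one_ne_zero
  rw [convolution_precompR_apply _ hl (hc.fderiv ℝ) hd]
  have hg : Continuous (∇ Z) := (InnerProductSpace.toDual ℝ (Space N)).symm.continuous.comp hd
  have hi : Integrable (fun y => φ.normed volume y • ∇ Z (x - y)) := by
    refine Continuous.integrable_of_hasCompactSupport ?_ ?_
    · exact φ.continuous_normed.smul (hg.comp (continuous_const.sub continuous_id))
    · exact φ.hasCompactSupport_normed.smul_right
  rw [InnerProductSpace.toDual_apply_apply, convolution_def, convolution_def]
  simp only [ContinuousLinearMap.lsmul_apply]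
  rw [real_inner_comm, ← integral_inner hi]
  refine integral_congr_ae (ae_of_all _ fun y => ?_)
  simp only [inner_smul_right, smul_eq_mul]
  rw [real_inner_comm, inner_gradient_left]

end Convolution

/-- The gradient of the mollification of a Sobolev function. -/
theorem hasGradientAt_mollify_of_hasWeakGradient {N : ℕ} {Ω K : Set (Space N)}
    (hΩ : MeasurableSet Ω) (hKm : MeasurableSet K) (hKΩ : K ⊆ Ω)
    {v : Space N → ℝ} {g : Space N → Space N} (hv : HasWeakGradient Ω v g)
    (hvK : IntegrableOn v K) (hgK : IntegrableOn g K)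
    (φ : ContDiffBump (0 : Space N)) {x : Space N}
    (hx : Metric.closedBall x φ.rOut ⊆ K) :
    HasGradientAt (φ.normed volume ⋆[ContinuousLinearMap.lsmul ℝ ℝ, volume] (K.indicator v))
      ((φ.normed volume ⋆[ContinuousLinearMap.lsmul ℝ ℝ, volume] (K.indicator g)) x) x := by
  set ρ : Space N → ℝ := φ.normed volume with hρ
  have hρs : ContDiff ℝ (⊤ : ℕ∞) ρ := φ.contDiff_normed
  have hρc : HasCompactSupport ρ := φ.hasCompactSupport_normed
  have hvi : Integrable (K.indicator v) := hvK.integrable_indicator hKm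
  have hgi : Integrable (K.indicator g) := hgK.integrable_indicator hKm
  have h := hρc.hasFDerivAt_convolution_left (ContinuousLinearMap.lsmul ℝ ℝ)
    (hρs.of_le (by exact_mod_cast le_top)) hvi.locallyIntegrable x
  -- The reflected kernel is supported in `K`, hence admissible in the definition of the weak
  -- gradient; that identity moves the derivative from the kernel to `v`.
  set ψ : Space N → ℝ := fun y => ρ (x - y) with hψ
  have hψs : ContDiff ℝ (⊤ : ℕ∞) ψ := hρs.comp (contDiff_const.sub contDiff_id)
  have hψK : tsupport ψ ⊆ K := by
    refine (closure_minimal ?_ Metric.isClosed_closedBall).trans hx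
    intro y hy
    have : x - y ∈ Function.support ρ := hy
    rw [hρ, φ.support_normed_eq] at this
    simp only [Metric.mem_ball, dist_zero_right] at this
    rw [Metric.mem_closedBall, dist_eq_norm']
    exact this.le
  have hψc : HasCompactSupport ψ := hρc.comp_homeomorph (Homeomorph.subLeft x)
  have hψg : ∀ y, fderiv ℝ ψ y = -fderiv ℝ ρ (x - y) := by
    intro y
    have h1 : HasFDerivAt ρ (fderiv ℝ ρ (x - y)) (x - y) :=
      (hρs.differentiable (by simp) _).hasFDerivAt
    have h2 : HasFDerivAt (fun y : Space N => x - y) (-ContinuousLinearMap.id ℝ _) y :=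
      (hasFDerivAt_id y).const_sub x
    have := (h1.comp y h2).fderiv
    rw [hψ]
    change fderiv ℝ (ρ ∘ fun y => x - y) y = _
    rw [this]; ext; simp
  have hweak := hv.2.2 ψ hψs hψc (hψK.trans hKΩ)
  have hout : ∀ y, y ∉ K → ψ y = 0 := fun y hy => image_eq_zero_of_notMem_tsupport fun h => hy (hψK h)
  have hout' : ∀ y, y ∉ K → ∇ ψ y = 0 := fun y hy => by
    have : fderiv ℝ ψ y = 0 :=
      image_eq_zero_of_notMem_tsupport fun h => hy (hψK (tsupport_fderiv_subset ℝ h))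
    simp [gradient, this]
  rw [setIntegral_eq_of_subset_of_forall_sdiff_eq_zero hΩ hKΩ
      fun y hy => by rw [hout' y hy.2, smul_zero],
    setIntegral_eq_of_subset_of_forall_sdiff_eq_zero hΩ hKΩ
      fun y hy => by rw [hout y hy.2, zero_smul]] at hweak
  have hval : (ρ ⋆[ContinuousLinearMap.lsmul ℝ ℝ, volume] (K.indicator g)) x
      = -∫ y in K, v y • ∇ ψ y := by
    rw [hweak, neg_neg, convolution_eq_swap, ← integral_indicator hKm]
    refine integral_congr_ae (ae_of_all _ fun y => ?_)
    by_cases hy : y ∈ K <;> simp [hy, hψ]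
  have hd : Continuous (fderiv ℝ ρ) := hρs.continuous_fderiv (by simp)
  have hdψ : Continuous (fderiv ℝ ψ) := hψs.continuous_fderiv (by simp)
  have hgψ : Continuous (∇ ψ) := (InnerProductSpace.toDual ℝ (Space N)).symm.continuous.comp hdψ
  have hgc : HasCompactSupport (∇ ψ) := (hψc.fderiv ℝ).comp_left (by simp)
  have hi : IntegrableOn (fun y => v y • ∇ ψ y) K := by
    obtain ⟨C, hC⟩ := hgψ.bounded_above_of_compact_support hgc
    exact hvK.smul_bdd C hgψ.aestronglyMeasurable (ae_of_all _ hC)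
  rw [hasGradientAt_iff_hasFDerivAt]
  refine h.congr_fderiv (ContinuousLinearMap.ext fun e => ?_)
  have hex := (hρc.fderiv ℝ).convolutionExists_left
    ((ContinuousLinearMap.lsmul ℝ ℝ : ℝ →L[ℝ] ℝ →L[ℝ] ℝ).precompL (Space N)) hd
    hvi.locallyIntegrable x
  rw [hval, convolution_def, ContinuousLinearMap.integral_apply hex,
    InnerProductSpace.toDual_apply_apply, real_inner_comm, inner_neg_right, ← integral_inner hi,
    ← integral_sub_left_eq_self _ volume x, ← integral_neg, ← integral_indicator hKm]
  refine integral_congr_ae (ae_of_all _ fun y => ?_)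
  by_cases hy : y ∈ K
  · simp only [hy, sub_sub_cancel, Set.indicator_of_mem, ContinuousLinearMap.precompL_apply,
      ContinuousLinearMap.lsmul_apply, inner_smul_right, smul_eq_mul]
    rw [real_inner_comm, inner_gradient_left, hψg]
    simp [mul_comm]
  · simp [hy]

/-- Integration by parts against the constant 1. It says that constants have weak gradient zero,
which is what passing from u to m - u requires. -/
theorem integral_gradient_eq_zero {N : ℕ} {φ : Space N → ℝ} (hφ : ContDiff ℝ (⊤ : ℕ∞) φ)
    (hc : HasCompactSupport φ) : ∫ x, ∇ φ x = 0 := by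
  have hd : Continuous (fderiv ℝ φ) := hφ.continuous_fderiv (by simp)
  have hg : Continuous (∇ φ) := (InnerProductSpace.toDual ℝ (Space N)).symm.continuous.comp hd
  have hgc : HasCompactSupport (∇ φ) := (hc.fderiv ℝ).comp_left (by simp)
  refine ext_inner_left ℝ fun e => ?_
  rw [← integral_inner (hg.integrable_of_hasCompactSupport hgc), inner_zero_right]
  have := integral_bilinear_hasFDerivAt_right_eq_neg_left_of_integrable (μ := (volume : Measure (Space N)))
    (f := fun _ => (1 : ℝ)) (f' := fun _ => 0) (g := φ) (g' := fderiv ℝ φ) (v := e)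
    (B := ContinuousLinearMap.mul ℝ ℝ) (by simp) ?_ ?_ (fun x _ => hasFDerivAt_const _ _)
    (fun x _ => (hφ.differentiable (by simp) x).hasFDerivAt)
  · simp at this
    rw [← this]
    refine integral_congr_ae (ae_of_all _ fun y => ?_)
    simp only
    rw [real_inner_comm, inner_gradient_left]
  · simp only [ContinuousLinearMap.mul_apply', one_mul]
    refine Continuous.integrable_of_hasCompactSupport (by fun_prop) ?_
    exact (hc.fderiv ℝ).comp_left (g := fun L : Space N →L[ℝ] ℝ => L e) (by simp)
  · simpa using hφ.continuous.integrable_of_hasCompactSupport hc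

theorem HasWeakGradient.const_sub {N : ℕ} {Ω : Set (Space N)} (hΩ : IsOpen Ω) {u : Space N → ℝ}
    {g : Space N → Space N} (h : HasWeakGradient Ω u g) (c : ℝ) :
    HasWeakGradient Ω (fun x => c - u x) (fun x => -g x) := by
  refine ⟨(locallyIntegrable_const c).locallyIntegrableOn _ |>.sub h.1, h.2.1.neg, ?_⟩
  intro φ hφ hc hs
  have hd : Continuous (fderiv ℝ φ) := hφ.continuous_fderiv (by simp)
  have hg : Continuous (∇ φ) := (InnerProductSpace.toDual ℝ (Space N)).symm.continuous.comp hd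
  have hgc : HasCompactSupport (∇ φ) := (hc.fderiv ℝ).comp_left (by simp)
  have hgs : tsupport (∇ φ) ⊆ tsupport φ := by
    refine (closure_mono ?_).trans (tsupport_fderiv_subset ℝ)
    intro x hx h0
    exact hx (by simp [gradient, h0])
  have hi : IntegrableOn (fun x => u x • ∇ φ x) Ω := by
    have hK := h.1.integrableOn_compact_subset (hgs.trans hs) hgc
    have : IntegrableOn (fun x => u x • ∇ φ x) (tsupport (∇ φ)) :=
      hK.smul_continuousOn hg.continuousOn hgc
    exact this.of_forall_sdiff_eq_zero hΩ.measurableSet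
      fun x hx => by simp [image_eq_zero_of_notMem_tsupport hx.2]
  have h0 : ∫ x in Ω, ∇ φ x = 0 := by
    rw [setIntegral_eq_integral_of_forall_compl_eq_zero, integral_gradient_eq_zero hφ hc]
    intro x hx
    exact image_eq_zero_of_notMem_tsupport fun h' => hx (hs (hgs h'))
  have := h.2.2 φ hφ hc hs
  simp only [sub_smul, smul_neg]
  rw [integral_sub _ hi, integral_smul, h0, this, integral_neg]
  · simp
  · exact ((hg.integrable_of_hasCompactSupport hgc).smul c).integrableOn

end DNL

/-! ### Composed and cut-off Sobolev functions in W^{1,p}_0 -/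

namespace DNL
open Filter Topology
open scoped ENNReal Convolution Gradient

/-- The bounded ratio of outer to inner radius serves the almost everywhere convergence of
mollifications of functions that are merely locally integrable. -/
theorem exists_contDiffBump_seq (G : Type*) [NormedAddCommGroup G] [NormedSpace ℝ G]
    [FiniteDimensional ℝ G] {d : ℝ} (hd : 0 < d) :
    ∃ φ : ℕ → ContDiffBump (0 : G), (∀ n, (φ n).rOut ≤ d) ∧ (∀ n, (φ n).rOut ≤ 2 * (φ n).rIn) ∧
      Tendsto (fun n => (φ n).rOut) atTop (𝓝 0) := by
  refine ⟨fun n => ⟨d / (n + 1) / 2, d / (n + 1), by positivity, half_lt_self (by positivity)⟩,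
    fun n => ?_, fun n => ?_, ?_⟩
  · exact div_le_self hd.le (by linarith [n.cast_nonneg (α := ℝ)])
  · simp only; linarith
  · simpa [Function.comp_def] using
      (tendsto_const_div_atTop_nhds_zero_nat d).comp (tendsto_add_atTop_nat 1)

theorem continuous_gradient {N : ℕ} {Z : Space N → ℝ} (hZ : ContDiff ℝ 1 Z) :
    Continuous (∇ Z) :=
  (InnerProductSpace.toDual ℝ (Space N)).symm.continuous.comp (hZ.continuous_fderiv one_ne_zero)

theorem hasCompactSupport_gradient {N : ℕ} {Z : Space N → ℝ} (hZ : HasCompactSupport Z) :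
    HasCompactSupport (∇ Z) :=
  (hZ.fderiv ℝ).comp_left (g := (InnerProductSpace.toDual ℝ (Space N)).symm) (by simp)

theorem gradient_comp_mul {N : ℕ} {F : ℝ → ℝ} {v Z : Space N → ℝ} {gv gZ x : Space N}
    (hF : DifferentiableAt ℝ F (v x)) (hv : HasGradientAt v gv x) (hZ : HasGradientAt Z gZ x) :
    HasGradientAt (fun x => F (v x) * Z x)
      ((deriv F (v x) * Z x) • gv + F (v x) • gZ) x := by
  rw [hasGradientAt_iff_hasFDerivAt] at *
  have h1 := hF.hasDerivAt.comp_hasFDerivAt x hv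
  refine (h1.mul hZ).congr_fderiv (ContinuousLinearMap.ext fun e => ?_)
  simp
  ring

/-- A smooth function of a bounded Sobolev function, times a `C¹` cutoff, belongs to
`W^{1,p}_0`. -/
theorem memSobolevZero_comp_mul {N : ℕ} {p : ℝ} (hp : 1 ≤ p) {Ω : Set (Space N)} (hΩ : IsOpen Ω)
    {v : Space N → ℝ} {g : Space N → Space N} (hv : HasWeakGradient Ω v g)
    {y : Space N} {r₁ r₂ b : ℝ} (hr₁ : 0 < r₁) (hr : r₁ < r₂) (hK : Metric.closedBall y r₂ ⊆ Ω)
    (hg : MemLp g (ENNReal.ofReal p) (volume.restrict (Metric.closedBall y r₂)))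
    (hvb : ∀ᵐ x ∂(volume.restrict (Metric.closedBall y r₂)), 0 ≤ v x ∧ v x ≤ b)
    {F : ℝ → ℝ} (hF : ∀ a, 0 ≤ a → ContDiffAt ℝ (⊤ : ℕ∞) F a)
    {Z : Space N → ℝ} (hZ : ContDiff ℝ 1 Z) (hZs : tsupport Z ⊆ Metric.closedBall y r₁) :
    MemSobolevZero p (Metric.closedBall y r₂) (fun x => F (v x) * Z x)
      (fun x => (deriv F (v x) * Z x) • g x + F (v x) • ∇ Z x) := by
  set K := Metric.closedBall y r₂ with hKdef
  have hp0 : 0 < p := by linarith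
  have hpp : (1 : ℝ≥0∞) ≤ ENNReal.ofReal p := by
    rw [← ENNReal.ofReal_one]; exact ENNReal.ofReal_le_ofReal hp
  have hKc : IsCompact K := isCompact_closedBall _ _
  have hKm : MeasurableSet K := hKc.measurableSet
  have : IsFiniteMeasure (volume.restrict K) := ⟨by simpa using hKc.measure_lt_top⟩
  have hvi : IntegrableOn v K := hv.1.integrableOn_compact_subset hK hKc
  have hgi : IntegrableOn g K := hv.2.1.integrableOn_compact_subset hK hKc
  have hZc : HasCompactSupport Z :=
    (isCompact_closedBall _ _).of_isClosed_subset (isClosed_tsupport _) hZs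
  have hgZ : Continuous (∇ Z) := continuous_gradient hZ
  have hgZc : HasCompactSupport (∇ Z) := hasCompactSupport_gradient hZc
  obtain ⟨CZ, hCZ⟩ := hZ.continuous.bounded_above_of_compact_support hZc
  obtain ⟨CG, hCG⟩ := hgZ.bounded_above_of_compact_support hgZc
  -- The extension of `v` by zero also takes the value 0, so the interval of values must contain it.
  set b' := max b 0
  have hF'c : ∀ a, 0 ≤ a → ContinuousAt (deriv F) a := fun a ha =>
    ((hF a ha).continuousAt_fderiv (by simp)).clm_apply continuousAt_const
  obtain ⟨CF, hCF⟩ := isCompact_Icc.exists_bound_of_continuousOn (s := Set.Icc 0 b') (f := F)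
    fun a ha => (hF a ha.1).continuousAt.continuousWithinAt
  obtain ⟨CF', hCF'⟩ := isCompact_Icc.exists_bound_of_continuousOn (s := Set.Icc 0 b')
    (f := deriv F) fun a ha => (hF'c a ha.1).continuousWithinAt
  -- Half of the gap: mollifying at scale at most `d` keeps the cutoff inside radius `r₁ + d`, and
  -- from there a ball of radius `d` still lies in `K`, where `v` has its weak gradient.
  set d := (r₂ - r₁) / 2 with hd
  have hd0 : 0 < d := by simp only [hd]; linarith
  obtain ⟨φ, hφd, hφ2, hφ0⟩ := exists_contDiffBump_seq (Space N) hd0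
  set H : Space N → ℝ := K.indicator v with hH
  set W : Space N → Space N := K.indicator g with hW
  have hHi : Integrable H := hvi.integrable_indicator hKm
  have hWi : Integrable W := hgi.integrable_indicator hKm
  have hWp : MemLp W (ENNReal.ofReal p) volume := (memLp_indicator_iff_restrict hKm).2 hg
  have hH0 : ∀ᵐ x, 0 ≤ H x ∧ H x ≤ b' := by
    rw [ae_restrict_iff' hKm] at hvb
    filter_upwards [hvb] with x hx
    by_cases hxK : x ∈ K
    · simp only [hH, Set.indicator_of_mem hxK]
      exact ⟨(hx hxK).1, (hx hxK).2.trans (le_max_left _ _)⟩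
    · simp [hH, hxK, b']
  set Hn : ℕ → Space N → ℝ := fun n =>
    (φ n).normed volume ⋆[ContinuousLinearMap.lsmul ℝ ℝ, volume] H with hHn
  set Wn : ℕ → Space N → Space N := fun n =>
    (φ n).normed volume ⋆[ContinuousLinearMap.lsmul ℝ ℝ, volume] W with hWn
  set Zn : ℕ → Space N → ℝ := fun n =>
    (φ n).normed volume ⋆[ContinuousLinearMap.lsmul ℝ ℝ, volume] Z with hZn
  set Gn : ℕ → Space N → Space N := fun n =>
    (φ n).normed volume ⋆[ContinuousLinearMap.lsmul ℝ ℝ, volume] (∇ Z) with hGn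
  have hHs : ∀ n, ContDiff ℝ (⊤ : ℕ∞) (Hn n) := fun n =>
    (φ n).hasCompactSupport_normed.contDiff_convolution_left _ (φ n).contDiff_normed
      hHi.locallyIntegrable
  have hZs' : ∀ n, ContDiff ℝ (⊤ : ℕ∞) (Zn n) := fun n =>
    (φ n).hasCompactSupport_normed.contDiff_convolution_left _ (φ n).contDiff_normed
      hZ.continuous.locallyIntegrable
  have hWc : ∀ n, Continuous (Wn n) := fun n =>
    ((φ n).hasCompactSupport_normed.contDiff_convolution_left (n := 0) _ (φ n).contDiff_normed
      hWi.locallyIntegrable).continuous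
  have hGc : ∀ n, Continuous (Gn n) := fun n =>
    ((φ n).hasCompactSupport_normed.contDiff_convolution_left (n := 0) _ (φ n).contDiff_normed
      hgZ.locallyIntegrable).continuous
  -- `F` is smooth only on the half-line, so the mollified values must stay nonnegative for the
  -- composition to be smooth.
  have hHn0 : ∀ n x, Hn n x ∈ Set.Icc 0 b' := fun n x => by
    refine ⟨mollify_nonneg volume (φ n) (hH0.mono fun x hx => hx.1) x, ?_⟩
    refine (Real.le_norm_self _).trans (norm_mollify_le volume (φ n) (hH0.mono fun x hx => ?_) x)
    rw [Real.norm_of_nonneg hx.1]; exact hx.2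
  have hZb : ∀ n x, ‖Zn n x‖ ≤ CZ := fun n => norm_mollify_le volume (φ n) (ae_of_all _ hCZ)
  have hGb : ∀ n x, ‖Gn n x‖ ≤ CG := fun n => norm_mollify_le volume (φ n) (ae_of_all _ hCG)
  have hZsupp : ∀ n, tsupport (Zn n) ⊆ Metric.closedBall y (r₁ + d) := fun n => by
    refine closure_minimal ?_ Metric.isClosed_closedBall
    refine (support_convolution_subset _).trans ?_
    rintro _ ⟨a, ha, b, hb, rfl⟩
    rw [(φ n).support_normed_eq, Metric.mem_ball, dist_zero_right] at ha
    have hb' := hZs (subset_tsupport _ hb)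
    rw [Metric.mem_closedBall, dist_eq_norm] at hb' ⊢
    calc ‖a + b - y‖ = ‖(b - y) + a‖ := by congr 1; abel
      _ ≤ ‖b - y‖ + ‖a‖ := norm_add_le _ _
      _ ≤ r₁ + d := add_le_add hb' (ha.le.trans (hφd n))
  have hgrad : ∀ n x, x ∈ Metric.closedBall y (r₁ + d) → HasGradientAt (Hn n) (Wn n x) x := by
    intro n x hx
    refine hasGradientAt_mollify_of_hasWeakGradient hΩ.measurableSet hKm hK hv hvi hgi (φ n) ?_
    refine Metric.closedBall_subset_closedBall' ?_
    have h1 := hφd n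
    rw [Metric.mem_closedBall] at hx
    simp only [hd] at *
    linarith
  have hgradφ : ∀ n x, ∇ (fun x => F (Hn n x) * Zn n x) x
      = (deriv F (Hn n x) * Zn n x) • Wn n x + F (Hn n x) • Gn n x := by
    intro n x
    have hFd := (hF _ (hHn0 n x).1).differentiableAt (by simp)
    have hZg := hasGradientAt_mollify_right (φ n) hZ hZc x
    by_cases hx : x ∈ Metric.closedBall y (r₁ + d)
    · exact (gradient_comp_mul hFd (hgrad n x hx) hZg).gradient
    -- Here the gradient of `Hn` need not be `Wn`, but both occur with the factor `Zn`, which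
    -- vanishes.
    · have h0 : Zn n x = 0 := image_eq_zero_of_notMem_tsupport fun h => hx (hZsupp n h)
      rw [(gradient_comp_mul hFd ((hHs n).differentiable (by simp) x).hasGradientAt hZg).gradient]
      change (deriv F (Hn n x) * Zn n x) • _ + _ = _
      rw [h0]; simp [hGn]
  have hlimH : ∀ᵐ x, Tendsto (fun n => Hn n x) atTop (𝓝 (H x)) :=
    ContDiffBump.ae_convolution_tendsto_right_of_locallyIntegrable hφ0
      (Eventually.of_forall hφ2) hHi.locallyIntegrable
  have hlimW : ∀ᵐ x, Tendsto (fun n => Wn n x) atTop (𝓝 (W x)) :=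
    ContDiffBump.ae_convolution_tendsto_right_of_locallyIntegrable hφ0
      (Eventually.of_forall hφ2) hWi.locallyIntegrable
  have hlimZ : ∀ x, Tendsto (fun n => Zn n x) atTop (𝓝 (Z x)) :=
    ContDiffBump.convolution_tendsto_right_of_continuous hφ0 hZ.continuous
  have hlimG : ∀ x, Tendsto (fun n => Gn n x) atTop (𝓝 (∇ Z x)) :=
    ContDiffBump.convolution_tendsto_right_of_continuous hφ0 hgZ
  have hWW := tendsto_eLpNorm_mollify volume hp hWp hφ0
  have hvH : ∀ᵐ x ∂(volume.restrict K), H x = v x ∧ W x = g x ∧ v x ∈ Set.Icc 0 b' := by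
    filter_upwards [ae_restrict_mem hKm, hvb] with x hx h2
    exact ⟨Set.indicator_of_mem hx _, Set.indicator_of_mem hx _, h2.1, h2.2.trans (le_max_left _ _)⟩
  -- measurability of the continuous pieces
  have hFHc : ∀ n, Continuous fun x => F (Hn n x) := fun n =>
    continuous_iff_continuousAt.2 fun x =>
      ((hF _ (hHn0 n x).1).continuousAt).comp (hHs n).continuous.continuousAt
  have hF'Hc : ∀ n, Continuous fun x => deriv F (Hn n x) := fun n =>
    continuous_iff_continuousAt.2 fun x =>
      ContinuousAt.comp (hF'c _ (hHn0 n x).1) (hHs n).continuous.continuousAt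
  have hlimFH : ∀ᵐ x ∂(volume.restrict K), Tendsto (fun n => F (Hn n x)) atTop (𝓝 (F (v x))) := by
    filter_upwards [ae_restrict_of_ae hlimH, hvH] with x h1 h2
    rw [h2.1] at h1
    exact ((hF _ h2.2.2.1).continuousAt.tendsto).comp h1
  have hlimF'H : ∀ᵐ x ∂(volume.restrict K),
      Tendsto (fun n => deriv F (Hn n x)) atTop (𝓝 (deriv F (v x))) := by
    filter_upwards [ae_restrict_of_ae hlimH, hvH] with x h1 h2
    rw [h2.1] at h1
    exact ((hF'c _ h2.2.2.1).tendsto).comp h1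
  have hFv : AEStronglyMeasurable (fun x => F (v x)) (volume.restrict K) :=
    aestronglyMeasurable_of_tendsto_ae atTop (fun n => (hFHc n).aestronglyMeasurable) hlimFH
  have hF'v : AEStronglyMeasurable (fun x => deriv F (v x)) (volume.restrict K) :=
    aestronglyMeasurable_of_tendsto_ae atTop (fun n => (hF'Hc n).aestronglyMeasurable) hlimF'H
  have hFvb : ∀ᵐ x ∂(volume.restrict K), ‖F (v x)‖ ≤ CF :=
    hvH.mono fun x hx => hCF _ hx.2.2
  have hF'vb : ∀ᵐ x ∂(volume.restrict K), ‖deriv F (v x)‖ ≤ CF' :=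
    hvH.mono fun x hx => hCF' _ hx.2.2
  have hCF0 : 0 ≤ CF := (norm_nonneg _).trans (hCF _ (hHn0 0 y))
  have hCF'0 : 0 ≤ CF' := (norm_nonneg _).trans (hCF' _ (hHn0 0 y))
  have hCZ0 : 0 ≤ CZ := (norm_nonneg _).trans (hCZ y)
  have hCG0 : 0 ≤ CG := (norm_nonneg _).trans (hCG y)
  have hZm : AEStronglyMeasurable Z (volume.restrict K) := hZ.continuous.aestronglyMeasurable
  have hGm : AEStronglyMeasurable (∇ Z) (volume.restrict K) := hgZ.aestronglyMeasurable
  have hFZb : ∀ᵐ x ∂(volume.restrict K), ‖F (v x) * Z x‖ ≤ CF * CZ := by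
    filter_upwards [hFvb] with x hx
    rw [norm_mul]; gcongr; exact hCZ x
  have hF'Zb : ∀ᵐ x ∂(volume.restrict K), ‖deriv F (v x) * Z x‖ ≤ CF' * CZ := by
    filter_upwards [hF'vb] with x hx
    rw [norm_mul]; gcongr; exact hCZ x
  have hFGb : ∀ᵐ x ∂(volume.restrict K), ‖F (v x) • ∇ Z x‖ ≤ CF * CG := by
    filter_upwards [hFvb] with x hx
    rw [norm_smul]; gcongr; exact hCG x
  refine ⟨.of_bound (hFv.mul hZm) _ hFZb, MemLp.add ?_ (.of_bound (hFv.smul hGm) _ hFGb),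
    fun n x => F (Hn n x) * Zn n x, fun n => ⟨?_, ?_, ?_⟩, ?_, ?_⟩
  · refine hg.norm.const_mul (CF' * CZ) |>.mono' ((hF'v.mul hZm).smul hg.1) ?_
    filter_upwards [hF'Zb] with x hx
    rw [norm_smul]; gcongr
  · exact (contDiff_iff_contDiffAt.2 fun x =>
      (hF _ (hHn0 n x).1).comp x (hHs n).contDiffAt).mul (hZs' n)
  · exact HasCompactSupport.mul_left ((isCompact_closedBall _ _).of_isClosed_subset
      (isClosed_tsupport _) (hZsupp n))
  · rw [interior_closedBall _ (by linarith)]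
    refine (tsupport_mul_subset_right.trans (hZsupp n)).trans
      (Metric.closedBall_subset_ball ?_)
    simp only [hd]; linarith
  · refine tendsto_eLpNorm_of_dominated hp0 (g := fun _ => CF * CZ + CF * CZ)
      (fun n => ((hFHc n).mul (hZs' n).continuous).aestronglyMeasurable.sub (hFv.mul hZm))
      (memLp_const _) (fun n => ?_) ?_
    · filter_upwards [hFZb] with x hx
      refine (norm_sub_le _ _).trans (add_le_add ?_ hx)
      rw [norm_mul]; gcongr
      exacts [hCF _ (hHn0 n x), hZb n x]
    · filter_upwards [hlimFH] with x hx
      simpa using (hx.mul (hlimZ x)).sub_const (F (v x) * Z x)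
  · simp_rw [hgradφ]
    -- The gradient error splits in two. The part with Wn - W has bounded coefficients and tends to
    -- zero because mollification converges in L^p; in the rest, W is fixed and dominated
    -- convergence applies.
    have h1 : Tendsto (fun n => eLpNorm (fun x => (deriv F (Hn n x) * Zn n x) • (Wn n x - W x))
        (ENNReal.ofReal p) (volume.restrict K)) atTop (𝓝 0) := by
      have hb : ∀ n, eLpNorm (fun x => (deriv F (Hn n x) * Zn n x) • (Wn n x - W x))
          (ENNReal.ofReal p) (volume.restrict K) ≤ ENNReal.ofReal (CF' * CZ) *
          eLpNorm (fun x => Wn n x - W x) (ENNReal.ofReal p) volume := fun n => by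
        refine (eLpNorm_le_mul_eLpNorm_of_ae_le_mul (c := CF' * CZ)
          (g := fun x => Wn n x - W x) (ae_of_all _ fun x => ?_) _).trans ?_
        · rw [norm_smul, norm_mul]; gcongr
          exacts [hCF' _ (hHn0 n x), hZb n x]
        · gcongr
          exact Measure.restrict_le_self
      refine tendsto_of_tendsto_of_tendsto_of_le_of_le tendsto_const_nhds ?_
        (fun _ => zero_le) hb
      simpa using ENNReal.Tendsto.const_mul hWW (Or.inr ENNReal.ofReal_ne_top)
    have h2 : Tendsto (fun n => eLpNorm (fun x => (deriv F (Hn n x) * Zn n x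
        - deriv F (v x) * Z x) • W x + (F (Hn n x) • Gn n x - F (v x) • ∇ Z x))
        (ENNReal.ofReal p) (volume.restrict K)) atTop (𝓝 0) := by
      refine tendsto_eLpNorm_of_dominated hp0
        (g := fun x => (CF' * CZ + CF' * CZ) * ‖W x‖ + (CF * CG + CF * CG)) (fun n => ?_)
        ((hWp.restrict K).norm.const_mul _ |>.add (memLp_const _)) (fun n => ?_) ?_
      · exact ((((hF'Hc n).mul (hZs' n).continuous).aestronglyMeasurable.sub
          (hF'v.mul hZm)).smul (hWp.restrict K).1).add
          (((hFHc n).smul (hGc n)).aestronglyMeasurable.sub (hFv.smul hGm))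
      · filter_upwards [hF'Zb, hFGb] with x hx hx'
        refine (norm_add_le _ _).trans (add_le_add ?_ ((norm_sub_le _ _).trans (add_le_add ?_ hx')))
        · rw [norm_smul]; gcongr
          refine (norm_sub_le _ _).trans (add_le_add ?_ hx)
          rw [norm_mul]; gcongr
          exacts [hCF' _ (hHn0 n x), hZb n x]
        · rw [norm_smul]; gcongr
          exacts [hCF _ (hHn0 n x), hGb n x]
      · filter_upwards [hlimFH, hlimF'H] with x hx hx'
        simpa using (((hx'.mul (hlimZ x)).sub_const (deriv F (v x) * Z x)).smul_const (W x)).add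
          ((hx.smul (hlimG x)).sub_const (F (v x) • ∇ Z x))
    have h3 := h1.add h2
    rw [add_zero] at h3
    refine tendsto_of_tendsto_of_tendsto_of_le_of_le tendsto_const_nhds h3
      (fun _ => zero_le) fun n => ?_
    refine le_trans (le_of_eq ?_) (eLpNorm_add_le ?_ ?_ hpp)
    · refine eLpNorm_congr_ae ?_
      filter_upwards [hvH] with x hx
      simp only [Pi.add_apply, hx.2.1]
      module
    · exact ((hF'Hc n).mul (hZs' n).continuous).aestronglyMeasurable.smul
        ((hWc n).aestronglyMeasurable.sub (hWp.restrict K).1)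
    · exact ((((hF'Hc n).mul (hZs' n).continuous).aestronglyMeasurable.sub
          (hF'v.mul hZm)).smul (hWp.restrict K).1).add
          (((hFHc n).smul (hGc n)).aestronglyMeasurable.sub (hFv.smul hGm))

end DNL

/-! ### Carathéodory superposition and pairings with translates -/

namespace DNL
open Filter Topology
open scoped ENNReal

/-- Superposition with a Carathéodory function preserves measurability. -/
theorem aestronglyMeasurable_caratheodory {α W E : Type*} [MeasurableSpace α] {μ : Measure α}
    [TopologicalSpace W] [MeasurableSpace W]
    [TopologicalSpace E] [TopologicalSpace.PseudoMetrizableSpace E] [SecondCountableTopology E]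
    [MeasurableSpace E] [BorelSpace E]
    {A : α → W → E} (hm : ∀ w, AEMeasurable (fun z => A z w) μ)
    (hc : ∀ᵐ z ∂μ, Continuous (A z)) {f : α → W} (hf : AEStronglyMeasurable f μ) :
    AEStronglyMeasurable (fun z => A z (f z)) μ := by
  obtain ⟨f', hf', hff'⟩ := hf
  have h1 : AEStronglyMeasurable (fun z => A z (f' z)) μ := by
    refine aestronglyMeasurable_of_tendsto_ae atTop (f := fun n z => A z (hf'.approx n z))
      (fun n => ?_) ?_
    -- A simple function has finitely many values, so only finitely many exceptional null sets have
    -- to be united.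
    · have h2 : Measurable fun z => (hm (hf'.approx n z)).mk _ z :=
        (hf'.approx n).measurable_bind (fun w z => (hm w).mk _ z) fun w => (hm w).measurable_mk
      refine AEMeasurable.aestronglyMeasurable ⟨_, h2, ?_⟩
      have h3 : ∀ᵐ z ∂μ, ∀ w ∈ (hf'.approx n).range, A z w = (hm w).mk _ z := by
        rw [Finset.eventually_all]
        exact fun w _ => (hm w).ae_eq_mk
      filter_upwards [h3] with z hz
      exact hz _ ((hf'.approx n).mem_range_self z)
    · filter_upwards [hc] with z hz
      exact (hz.tendsto _).comp (hf'.tendsto_approx z)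
  refine h1.congr ?_
  filter_upwards [hff'] with z hz
  rw [hz]

theorem integrable_inner_of_memLp {α E : Type*} [MeasurableSpace α] {μ : Measure α}
    [NormedAddCommGroup E] [InnerProductSpace ℝ E] {P Q : ℝ≥0∞} [ENNReal.HolderConjugate P Q]
    {a g : α → E} (ha : MemLp a P μ) (hg : MemLp g Q μ) :
    Integrable (fun z => inner ℝ (a z) (g z)) μ := by
  have : MemLp (fun z => inner ℝ (a z) (g z)) 1 μ :=
    ha.of_bilin (r := 1) (fun x y => inner ℝ x y) 1 hg (ha.1.inner hg.1)
      (ae_of_all _ fun z => by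
        simpa [← NNReal.coe_le_coe] using norm_inner_le_norm (𝕜 := ℝ) (a z) (g z))
  exact memLp_one_iff_integrable.1 this

section Translate

variable {G E : Type*} [NormedAddCommGroup G] [MeasurableSpace G] [BorelSpace G]
  [SecondCountableTopology G]
  [NormedAddCommGroup E] [InnerProductSpace ℝ E] {μ : Measure G}
  [IsLocallyFiniteMeasure μ] [μ.InnerRegularCompactLTTop] [μ.IsAddRightInvariant] [SFinite μ]
  {P Q : ℝ≥0∞} [ENNReal.HolderConjugate P Q] {a g : G → E} {e : ℝ → G}

-- Hölder's inequality reduces this to the continuity of translations in L^P, which is where P < ∞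
-- is needed.
omit [SecondCountableTopology G] [SFinite μ] in
theorem tendsto_integral_inner_translate (he : Continuous e) (he0 : e 0 = 0) (hP : P ≠ ∞)
    (ha : MemLp a P μ) (hg : MemLp g Q μ) :
    Tendsto (fun σ => ∫ z, inner ℝ (a (z - e σ)) (g z) ∂μ) (𝓝 0)
      (𝓝 (∫ z, inner ℝ (a z) (g z) ∂μ)) := by
  have hP1 : 1 ≤ P := ENNReal.HolderConjugate.one_le P Q
  have h1 : Tendsto (fun σ => eLpNorm (fun z => a (z - e σ) - a z) P μ) (𝓝 0) (𝓝 0) := by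
    have := tendsto_eLpNorm_translate μ hP1 hP ha
    exact this.comp (by simpa [he0] using he.tendsto 0)
  have hat : ∀ y, MemLp (fun z => a (z - y)) P μ := fun y =>
    ha.comp_measurePreserving (by
      simpa [sub_eq_add_neg] using measurePreserving_add_right μ (-y))
  refine tendsto_integral_of_L1' _ (integrable_inner_of_memLp ha hg).1
    (Eventually.of_forall fun σ => integrable_inner_of_memLp (hat (e σ)) hg) ?_
  have h2 : Tendsto (fun σ => eLpNorm (fun z => a (z - e σ) - a z) P μ * eLpNorm g Q μ)
      (𝓝 0) (𝓝 0) := by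
    simpa using ENNReal.Tendsto.mul_const h1 (Or.inr hg.2.ne)
  refine tendsto_of_tendsto_of_tendsto_of_le_of_le tendsto_const_nhds h2
    (fun _ => zero_le) fun σ => ?_
  have h3 := eLpNorm_le_eLpNorm_mul_eLpNorm'_of_norm (p := P) (q := Q) (r := 1) ((hat (e σ)).sub ha).1 hg.1
    (fun x y => (inner ℝ x y : ℝ)) 1
      (ae_of_all _ fun z => by simpa using norm_inner_le_norm (𝕜 := ℝ) (a (z - e σ) - a z) (g z))
  simp only [ENNReal.coe_one, one_mul] at h3
  refine le_trans (le_of_eq ?_) h3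
  refine eLpNorm_congr_ae (ae_of_all _ fun z => ?_)
  simp [inner_sub_left]

-- The shear (σ, z) ↦ (σ, z - e σ) preserves the product measure, so the translated factor has the
-- integrability of the untranslated one. This licenses Fubini for averages over shifts.
omit [μ.InnerRegularCompactLTTop] [IsLocallyFiniteMeasure μ] in
theorem integrable_inner_translate_prod (he : Continuous e)
    (ha : MemLp a P μ) (hg : MemLp g Q μ) (ε : ℝ) :
    Integrable (fun w : ℝ × G => inner ℝ (a (w.2 - e w.1)) (g w.2))
      ((volume.restrict (Set.Icc 0 ε)).prod μ) := by
  have hmp : MeasurePreserving (fun w : ℝ × G => (w.1, w.2 - e w.1))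
      ((volume.restrict (Set.Icc 0 ε)).prod μ) ((volume.restrict (Set.Icc 0 ε)).prod μ) := by
    refine (MeasurePreserving.id _).skew_product (g := fun σ z => z - e σ) ?_ ?_
    · exact (measurable_snd.sub (he.measurable.comp measurable_fst))
    · exact ae_of_all _ fun σ => by
        simpa [sub_eq_add_neg] using (measurePreserving_add_right μ (-e σ)).map_eq
  exact integrable_inner_of_memLp
    ((ha.comp_snd (volume.restrict (Set.Icc 0 ε))).comp_measurePreserving hmp) (hg.comp_snd _)

/-- If the unshifted pairing were below -C, then by continuity so would be all pairings with small
shifts, by a fixed margin, and the average over shifts in [0, ε] would violate the hypothesis. -/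
theorem neg_le_integral_inner_of_average (he : Continuous e) (he0 : e 0 = 0) (hP : P ≠ ∞)
    (ha : MemLp a P μ) (hg : MemLp g Q μ) {C : ℝ}
    (h : ∀ᶠ ε in 𝓝[>] (0 : ℝ),
      -(C * ε) ≤ ∫ z, (∫ σ in Set.Icc 0 ε, inner ℝ (a (z - e σ)) (g z)) ∂μ) :
    -C ≤ ∫ z, inner ℝ (a z) (g z) ∂μ := by
  by_contra! hlt
  obtain ⟨m, hm1, hm2⟩ := exists_between hlt
  have hev := (tendsto_order.1 (tendsto_integral_inner_translate he he0 hP ha hg)).2 m hm1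
  obtain ⟨d, hd, hball⟩ := Metric.eventually_nhds_iff.1 hev
  have hev2 : ∀ᶠ ε in 𝓝[>] (0 : ℝ), ε ∈ Set.Ioo 0 d := Ioo_mem_nhdsGT hd
  obtain ⟨ε, hε, hε0, hεd⟩ := (h.and hev2).exists
  have hint := integrable_inner_translate_prod he ha hg ε
  rw [← integral_integral_swap (f := fun σ z => inner ℝ (a (z - e σ)) (g z)) hint] at hε
  have h2 : ∫ σ in Set.Icc 0 ε, (∫ z, inner ℝ (a (z - e σ)) (g z) ∂μ)
      ≤ ∫ σ in Set.Icc 0 ε, m := by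
    refine setIntegral_mono_on hint.integral_prod_left (integrable_const _) measurableSet_Icc ?_
    intro σ hσ
    refine (hball ?_).le
    rw [Real.dist_eq, sub_zero, abs_of_nonneg hσ.1]
    exact hσ.2.trans_lt hεd
  rw [setIntegral_const, Real.volume_real_Icc_of_le hε0.le, smul_eq_mul, sub_zero] at h2
  nlinarith

end Translate

end DNL

/-! ### The signed power -/

namespace DNL
open Filter Topology
open scoped ENNReal

section SignedPower

variable {q : ℝ}

theorem spow_of_nonneg (hq : 0 < q) {a : ℝ} (ha : 0 ≤ a) : spow q a = a ^ q := by
  rcases ha.eq_or_lt with rfl | h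
  · simp [spow, Real.zero_rpow hq.ne']
  · rw [spow, abs_of_pos h, Real.rpow_sub_one h.ne', div_mul_cancel₀ _ h.ne']

theorem spow_neg (q a : ℝ) : spow q (-a) = -spow q a := by
  simp [spow]

theorem spow_monotone (hq : 0 < q) : Monotone (spow q) := by
  have hpos : ∀ a b : ℝ, 0 ≤ a → a ≤ b → spow q a ≤ spow q b := fun a b ha hab => by
    rw [spow_of_nonneg hq ha, spow_of_nonneg hq (ha.trans hab)]
    exact Real.rpow_le_rpow ha hab hq.le
  have h0 : spow q 0 = 0 := by simp [spow]
  intro a b hab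
  rcases le_total 0 a with ha | ha
  · exact hpos a b ha hab
  · rcases le_total 0 b with hb | hb
    · have h1 := hpos 0 b le_rfl hb
      have h2 := hpos 0 (-a) le_rfl (by linarith)
      rw [spow_neg] at h2
      linarith
    · have := hpos (-b) (-a) (by linarith) (by linarith)
      rw [spow_neg, spow_neg] at this
      linarith

theorem spow_one_div_spow (hq : 0 < q) (a : ℝ) : spow (1 / q) (spow q a) = a := by
  have hpos : ∀ a : ℝ, 0 ≤ a → spow (1 / q) (spow q a) = a := fun a ha => by
    rw [spow_of_nonneg hq ha, spow_of_nonneg (by positivity) (by positivity), ← Real.rpow_mul ha,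
      mul_one_div_cancel hq.ne', Real.rpow_one]
  rcases le_total 0 a with ha | ha
  · exact hpos a ha
  · have := hpos (-a) (by linarith)
    rw [spow_neg, spow_neg] at this
    linarith

theorem measurable_spow (q : ℝ) : Measurable (spow q) := by
  unfold spow
  exact (measurable_norm.pow_const _).mul measurable_id

/-- For `0 < q ≤ 1` the signed power expands distances in `[-M, M]` by at least `q M^(q-1)`. -/
theorem mul_sub_le_spow_sub_spow (hq : 0 < q) (hq1 : q ≤ 1) {M a b : ℝ}
    (ha : -M ≤ a) (hab : a ≤ b) (hb : b ≤ M) :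
    q * M ^ (q - 1) * (b - a) ≤ spow q b - spow q a := by
  have hpos : ∀ a b : ℝ, 0 ≤ a → a ≤ b → b ≤ M →
      q * M ^ (q - 1) * (b - a) ≤ spow q b - spow q a := fun a b ha hab hb => by
    rcases hab.eq_or_lt with rfl | hlt
    · simp
    have hb0 : 0 < b := ha.trans_lt hlt
    rw [spow_of_nonneg hq ha, spow_of_nonneg hq hb0.le]
    -- Bernoulli's inequality for exponents at most 1, i.e. the tangent to the concave power at b.
    -- Replacing b by the larger M then only lowers the slope, as q - 1 ≤ 0.
    have h1 : (1 + (a / b - 1)) ^ q ≤ 1 + q * (a / b - 1) :=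
      rpow_one_add_le_one_add_mul_self (by linarith [div_nonneg ha hb0.le]) hq.le hq1
    rw [add_sub_cancel, Real.div_rpow ha hb0.le] at h1
    have h2 : M ^ (q - 1) ≤ b ^ (q - 1) :=
      Real.rpow_le_rpow_of_nonpos hb0 hb (by linarith)
    have hbq : 0 < b ^ q := Real.rpow_pos_of_pos hb0 q
    rw [div_le_iff₀ hbq] at h1
    calc q * M ^ (q - 1) * (b - a) ≤ q * b ^ (q - 1) * (b - a) := by
          have : 0 ≤ b - a := by linarith
          gcongr
      _ = b ^ q * q * (1 - a / b) := by
          rw [Real.rpow_sub_one hb0.ne']; field_simp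
      _ ≤ b ^ q - a ^ q := by linarith
  -- Negative values follow by oddness, and intervals containing 0 by splitting at 0.
  have h0 : spow q 0 = 0 := by simp [spow]
  rcases le_total 0 a with ha' | ha'
  · exact hpos a b ha' hab hb
  · have hneg : ∀ b, a ≤ b → b ≤ 0 → q * M ^ (q - 1) * (b - a) ≤ spow q b - spow q a :=
      fun b hab hb' => by
        have := hpos (-b) (-a) (by linarith) (by linarith) (by linarith)
        rw [spow_neg, spow_neg] at this
        linarith
    rcases le_total 0 b with hb' | hb'
    · have h1 := hpos 0 b le_rfl hb' hb
      have h2 := hneg 0 ha' le_rfl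
      linarith
    · exact hneg b hab hb'

/-- A primitive, in the variable `w = spow q m - spow q a`, of a monotone function of `m - a`. -/
theorem exists_primitive_comp_spow (hq : 0 < q) {f : ℝ → ℝ} {B : ℝ}
    (hf : MonotoneOn f (Set.Ici 0)) (hf0 : ∀ a, 0 ≤ a → 0 ≤ f a) (hfB : ∀ a, 0 ≤ a → f a ≤ B)
    (m : ℝ) :
    ∃ G : ℝ → ℝ, Continuous G ∧ (∀ w, 0 ≤ w → 0 ≤ G w ∧ G w ≤ B * w) ∧
      ∀ a, a ≤ m → ∀ w', G (spow q m - spow q a) - G w' ≤ (spow q m - spow q a - w') * f (m - a) := by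
  -- This is `f` in the variable w = β(m) - β(a), via the inverse of β. The maximum freezes it at
  -- f(0) for w < 0, so F is monotone on the whole line and its primitive is convex; the last claim
  -- is the tangent inequality at w.
  set F : ℝ → ℝ := fun w => f (max 0 (m - spow (1 / q) (spow q m - w))) with hF
  have hFm : Monotone F := fun w w' h => by
    refine hf (Set.mem_Ici.2 (le_max_left _ _)) (Set.mem_Ici.2 (le_max_left _ _))
      (max_le_max_left _ ?_)
    have := spow_monotone (one_div_pos.2 hq) (sub_le_sub_left h (spow q m))
    linarith
  have hFi : ∀ a b, IntervalIntegrable F volume a b := fun a b => hFm.intervalIntegrable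
  have hle : ∀ a b, a ≤ b → (b - a) * F a ≤ ∫ x in a..b, F x ∧ ∫ x in a..b, F x ≤ (b - a) * F b := by
    intro a b hab
    have h1 := intervalIntegral.integral_mono_on hab (intervalIntegrable_const (c := F a)) (hFi a b)
      fun x hx => hFm hx.1
    have h2 := intervalIntegral.integral_mono_on hab (hFi a b) (intervalIntegrable_const (c := F b))
      fun x hx => hFm hx.2
    simp only [intervalIntegral.integral_const, smul_eq_mul] at h1 h2
    exact ⟨h1, h2⟩
  refine ⟨fun w => ∫ x in (0 : ℝ)..w, F x, intervalIntegral.continuous_primitive hFi 0, ?_, ?_⟩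
  · intro w hw
    refine ⟨intervalIntegral.integral_nonneg hw fun x _ => hf0 _ (le_max_left _ _), ?_⟩
    have h1 := (hle 0 w hw).2
    have h2 : F w ≤ B := hfB _ (le_max_left _ _)
    rw [sub_zero] at h1
    nlinarith
  · intro a ha w'
    have hFa : F (spow q m - spow q a) = f (m - a) := by
      simp only [hF, sub_sub_cancel, spow_one_div_spow hq]
      rw [max_eq_right (by linarith)]
    rw [intervalIntegral.integral_interval_sub_left (hFi _ _) (hFi _ _), ← hFa]
    rcases le_total w' (spow q m - spow q a) with h | h
    · exact (hle _ _ h).2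
    · have := (hle _ _ h).1
      rw [intervalIntegral.integral_symm]
      linarith

end SignedPower

end DNL

/-! ### Time slices and stationary test functions -/

namespace DNL
open Filter Topology
open scoped ENNReal

theorem ae_ae_slice_of_ae_prod {α : Type*} [MeasurableSpace α] {μ : Measure α} [SFinite μ]
    {ν : Measure ℝ} [SFinite ν] {K : Set α} {I : Set ℝ} {P : α → ℝ → Prop}
    (h : ∀ᵐ z ∂((μ.prod ν).restrict (K ×ˢ I)), P z.1 z.2) :
    ∀ᵐ τ ∂(ν.restrict I), ∀ᵐ x ∂(μ.restrict K), P x τ := by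
  rw [← Measure.prod_restrict] at h
  have h2 := (Measure.measurePreserving_swap (μ := ν.restrict I)
    (ν := μ.restrict K)).quasiMeasurePreserving.ae h
  exact Measure.ae_ae_of_ae_prod h2

/-- Bounds valid almost everywhere in a cylinder hold on every time slice, up to the boundary. -/
theorem ae_slice_bounds {N : ℕ} {m : ℝ} (hm : 0 < m) {Ω : Set (Space N)} {T : ℝ}
    {u : Space N → ℝ → ℝ} (hu : MemCLocLpLoc m Ω T u) {K : Set (Space N)} (hK : IsCompact K)
    (hKΩ : K ⊆ Ω) {s t : ℝ} (hst : s < t) (hI : Set.Ioo s t ⊆ Set.Ioo 0 T) {μm μp : ℝ}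
    (hb : ∀ᵐ z : Space N × ℝ ∂(volume.restrict (K ×ˢ Set.Ioo s t)),
      μm ≤ u z.1 z.2 ∧ u z.1 z.2 ≤ μp)
    {τ : ℝ} (hτ : τ ∈ Set.Icc s t ∩ Set.Ioo 0 T) :
    ∀ᵐ x ∂(volume.restrict K), μm ≤ u x τ ∧ u x τ ≤ μp := by
  have hgood := ae_ae_slice_of_ae_prod (P := fun x τ => μm ≤ u x τ ∧ u x τ ≤ μp) hb
  rw [ae_restrict_iff' measurableSet_Ioo] at hgood
  set S : Set ℝ := {τ | τ ∈ Set.Ioo s t → ∀ᵐ x ∂(volume.restrict K), μm ≤ u x τ ∧ u x τ ≤ μp}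
  have hS : Dense S := Measure.dense_of_ae (hgood.mono fun x hx => hx)
  -- Almost every time in (s, t) is good, so good times are dense and approach every τ of the closed
  -- interval. Continuity in L^m then provides a subsequence converging almost everywhere, and the
  -- bounds pass to the limit.
  have hcl : τ ∈ closure (Set.Ioo s t ∩ S) := by
    have := closure_minimal (hS.open_subset_closure_inter (isOpen_Ioo (a := s) (b := t)))
      isClosed_closure
    rw [closure_Ioo hst.ne] at this
    exact this hτ.1
  obtain ⟨x, hx, hlim⟩ := mem_closure_iff_seq_limit.1 hcl
  have hp0 : ENNReal.ofReal m ≠ 0 := by simpa using hm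
  have h1 : Tendsto (fun n => eLpNorm ((fun y => u y (x n)) - fun y => u y τ) (ENNReal.ofReal m)
      (volume.restrict K)) atTop (𝓝 0) := (hu K hK hKΩ τ hτ.2).2.comp hlim
  obtain ⟨ns, -, hns⟩ := (tendstoInMeasure_of_tendsto_eLpNorm hp0
    (fun n => (hu K hK hKΩ (x n) (hI (hx n).1)).1.1) (hu K hK hKΩ τ hτ.2).1.1
    h1).exists_seq_tendsto_ae
  have h2 : ∀ᵐ y ∂(volume.restrict K), ∀ n, μm ≤ u y (x n) ∧ u y (x n) ≤ μp :=
    ae_all_iff.2 fun n => (hx n).2 (hx n).1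
  filter_upwards [hns, h2] with y hy hy2
  exact ⟨ge_of_tendsto' hy fun n => (hy2 _).1, le_of_tendsto' hy fun n => (hy2 _).2⟩

theorem IsAdmissibleField.aestronglyMeasurable_comp {N : ℕ} {p K₁ K₂ : ℝ} {Ω : Set (Space N)}
    {T : ℝ} {A : Space N → ℝ → ℝ → Space N → Space N} (hA : IsAdmissibleField p K₁ K₂ Ω T A)
    {u : Space N → ℝ → ℝ} {Du : Space N → ℝ → Space N} (hu : MemLpLocSobolevLoc p Ω T u Du) :
    AEStronglyMeasurable (fun z : Space N × ℝ => A z.1 z.2 (u z.1 z.2) (Du z.1 z.2))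
      (volume.restrict (Ω ×ˢ Set.Ioo 0 T)) :=
  aestronglyMeasurable_caratheodory
    (A := fun (z : Space N × ℝ) (w : ℝ × Space N) => A z.1 z.2 w.1 w.2)
    (f := fun z => (u z.1 z.2, Du z.1 z.2)) (fun w => hA.measurable w.1 w.2) hA.continuous
    (hu.measurable.prodMk hu.measurable_grad)

theorem prod_Icc_subset {N : ℕ} {Ω K : Set (Space N)} (hKΩ : K ⊆ Ω) {T t₁ t₂ : ℝ} (h₁ : 0 < t₁)
    (h₂ : t₂ < T) : K ×ˢ Set.Icc t₁ t₂ ⊆ Ω ×ˢ Set.Ioo 0 T :=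
  Set.prod_mono hKΩ fun _ hx => ⟨h₁.trans_le hx.1, hx.2.trans_lt h₂⟩

theorem IsAdmissibleField.memLp_comp {N : ℕ} {p K₁ K₂ : ℝ} (hp : 1 < p) {Ω : Set (Space N)}
    {T : ℝ} {A : Space N → ℝ → ℝ → Space N → Space N} (hA : IsAdmissibleField p K₁ K₂ Ω T A)
    {u : Space N → ℝ → ℝ} {Du : Space N → ℝ → Space N} (hu : MemLpLocSobolevLoc p Ω T u Du)
    {K : Set (Space N)} (hK : IsCompact K) (hKΩ : K ⊆ Ω) {t₁ t₂ : ℝ} (h₁ : 0 < t₁) (h₁₂ : t₁ < t₂)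
    (h₂ : t₂ < T) :
    MemLp (fun z : Space N × ℝ => A z.1 z.2 (u z.1 z.2) (Du z.1 z.2))
      (ENNReal.ofReal (p / (p - 1))) (volume.restrict (K ×ˢ Set.Icc t₁ t₂)) := by
  have hs := prod_Icc_subset hKΩ h₁ h₂
  have hD := (hu.memLp K hK hKΩ t₁ t₂ h₁ h₁₂ h₂).2.norm_rpow_div (ENNReal.ofReal (p - 1))
  rw [← ENNReal.ofReal_div_of_pos (by linarith), ENNReal.toReal_ofReal (by linarith)] at hD
  refine (hD.const_mul K₂).mono' ((hA.aestronglyMeasurable_comp hu).mono_set hs) ?_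
  filter_upwards [ae_mono (Measure.restrict_mono hs le_rfl) hA.growth] with z hz
  exact hz _ _

/-- The weak formulation for test functions that do not depend on time. -/
theorem weakForm_time_independent {N : ℕ} {p q : ℝ}
    {Ω : Set (Space N)} {T : ℝ} {A : Space N → ℝ → ℝ → Space N → Space N}
    {u : Space N → ℝ → ℝ} {Du : Space N → ℝ → Space N}
    (hsub : IsLocalWeakSubsolution p q Ω T A u Du) (hsup : IsLocalWeakSupersolution p q Ω T A u Du)
    {K : Set (Space N)} (hK : IsCompact K) (hKΩ : K ⊆ Ω) {t₁ t₂ : ℝ} (h₁ : 0 < t₁) (h₁₂ : t₁ < t₂)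
    (h₂ : t₂ < T) {η : Space N → ℝ} {Dη : Space N → Space N} (hη : MemSobolevZero p K η Dη)
    {C : ℝ} (hηC : ∀ᵐ x ∂(volume.restrict K), 0 ≤ η x ∧ η x ≤ C) :
    ∫ z in K ×ˢ Set.Icc t₁ t₂, inner ℝ (A z.1 z.2 (u z.1 z.2) (Du z.1 z.2)) (Dη z.1) =
      (∫ x in K, spow q (u x t₁) * η x) - ∫ x in K, spow q (u x t₂) * η x := by
  have : IsFiniteMeasure (volume.restrict K) := ⟨by simpa using hK.measure_lt_top⟩
  have hηb : ∀ r, MemLp η r (volume.restrict K) := fun r =>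
    (MemLp.of_bound hη.1.1 C (hηC.mono fun x hx => by
      rw [Real.norm_of_nonneg hx.1]; exact hx.2))
  have hprod : ∀ a b : ℝ, (volume : Measure (Space N × ℝ)).restrict (K ×ˢ Set.Icc a b)
      = (volume.restrict K).prod (volume.restrict (Set.Icc a b)) := fun a b => by
    rw [Measure.prod_restrict]; rfl
  have htest : IsTestFunction p q K T (fun x _ => η x) (fun _ _ => 0) (fun x _ => Dη x) := by
    refine ⟨fun τ _ => hηC.mono fun x hx => hx.1, fun τ _ => hηb _, fun a b _ _ _ => ?_,
      fun a b _ _ _ => by simp, ae_of_all _ fun τ => hη⟩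
    rw [hprod]
    exact ⟨(hηb _).comp_fst _, MemLp.zero, (hηb _).comp_fst _, hη.2.1.comp_fst _⟩
  -- With zero time derivative the term in u η_t disappears; the sub- and supersolution inequalities
  -- for this nonnegative test function combine into an equality.
  have h := le_antisymm (hsub.2.2 K hK hKΩ t₁ t₂ h₁ h₁₂ h₂ _ _ _ htest)
    (hsup.2.2 K hK hKΩ t₁ t₂ h₁ h₁₂ h₂ _ _ _ htest)
  simp only [weakForm, mul_zero, neg_zero, zero_add] at h
  linarith

/-- The deficit `β(m) - β(u)`. -/
noncomputable def deficit {N : ℕ} (q m : ℝ) (u : Space N → ℝ → ℝ) (x : Space N) (τ : ℝ) : ℝ :=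
  spow q m - spow q (u x τ)

theorem deficit_bounds {N : ℕ} {q : ℝ} (hq : 0 < q) {u : Space N → ℝ → ℝ} {μm μp : ℝ}
    {x : Space N} {τ : ℝ} (h : μm ≤ u x τ ∧ u x τ ≤ μp) :
    0 ≤ deficit q μp u x τ ∧ deficit q μp u x τ ≤ spow q μp - spow q μm := by
  have h1 := spow_monotone hq h.1
  have h2 := spow_monotone hq h.2
  constructor <;> simp only [deficit] <;> linarith

theorem integrable_deficit_mul {N : ℕ} {q : ℝ} (hq : 0 < q) {u : Space N → ℝ → ℝ} {μm μp : ℝ}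
    {K : Set (Space N)} {τ : ℝ} (hm : AEStronglyMeasurable (fun x => u x τ) (volume.restrict K))
    (hb : ∀ᵐ x ∂(volume.restrict K), μm ≤ u x τ ∧ u x τ ≤ μp) {η : Space N → ℝ}
    (hη : Integrable η (volume.restrict K)) :
    Integrable (fun x => deficit q μp u x τ * η x) (volume.restrict K) := by
  refine hη.bdd_mul (c := spow q μp - spow q μm) ?_ ?_
  · exact ((measurable_spow q).comp_aemeasurable hm.aemeasurable).const_sub _ |>.aestronglyMeasurable
  · filter_upwards [hb] with x hx
    have := deficit_bounds hq hx
    rw [Real.norm_of_nonneg this.1]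
    exact this.2

/-- As η does not depend on time, the constant β(μ⁺) contributes equally at both ends and cancels,
so u may be replaced by the nonnegative deficit with a change of sign. -/
theorem integral_flux_eq {N : ℕ} {p q : ℝ} (hq : 0 < q)
    {Ω : Set (Space N)} {T : ℝ} {A : Space N → ℝ → ℝ → Space N → Space N}
    {u : Space N → ℝ → ℝ} {Du : Space N → ℝ → Space N}
    (hsub : IsLocalWeakSubsolution p q Ω T A u Du) (hsup : IsLocalWeakSupersolution p q Ω T A u Du)
    {K : Set (Space N)} (hK : IsCompact K) (hKΩ : K ⊆ Ω) {t₁ t₂ : ℝ} (h₁ : 0 < t₁) (h₁₂ : t₁ < t₂)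
    (h₂ : t₂ < T) {η : Space N → ℝ} {Dη : Space N → Space N} (hη : MemSobolevZero p K η Dη)
    {C : ℝ} (hηC : ∀ᵐ x ∂(volume.restrict K), 0 ≤ η x ∧ η x ≤ C) {μm μp : ℝ}
    (hb₁ : ∀ᵐ x ∂(volume.restrict K), μm ≤ u x t₁ ∧ u x t₁ ≤ μp)
    (hb₂ : ∀ᵐ x ∂(volume.restrict K), μm ≤ u x t₂ ∧ u x t₂ ≤ μp) :
    ∫ z in K ×ˢ Set.Icc t₁ t₂, inner ℝ (A z.1 z.2 (u z.1 z.2) (Du z.1 z.2)) (Dη z.1) =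
      (∫ x in K, deficit q μp u x t₂ * η x) - ∫ x in K, deficit q μp u x t₁ * η x := by
  have : IsFiniteMeasure (volume.restrict K) := ⟨by simpa using hK.measure_lt_top⟩
  have hηi : Integrable η (volume.restrict K) :=
    Integrable.of_bound hη.1.1 C (hηC.mono fun x hx => by
      rw [Real.norm_of_nonneg hx.1]; exact hx.2)
  have hm : ∀ τ ∈ Set.Ioo 0 T, AEStronglyMeasurable (fun x => u x τ) (volume.restrict K) :=
    fun τ hτ => (hsub.1 K hK hKΩ τ hτ).1.1
  have hi : ∀ τ ∈ Set.Ioo 0 T, (∀ᵐ x ∂(volume.restrict K), μm ≤ u x τ ∧ u x τ ≤ μp) →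
      ∫ x in K, spow q (u x τ) * η x
        = spow q μp * (∫ x in K, η x) - ∫ x in K, deficit q μp u x τ * η x := fun τ hτ hb => by
    rw [← integral_const_mul, ← integral_sub (hηi.const_mul _)
      (integrable_deficit_mul hq (hm τ hτ) hb hηi)]
    refine integral_congr_ae (ae_of_all _ fun x => ?_)
    simp only [deficit]; ring
  rw [weakForm_time_independent hsub hsup hK hKΩ h₁ h₁₂ h₂ hη hηC,
    hi t₁ ⟨h₁, h₁₂.trans h₂⟩ hb₁, hi t₂ ⟨h₁.trans h₁₂, h₂⟩ hb₂]
  ring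

end DNL

/-! ### From frozen slices to space-time integrals -/

namespace DNL
open Filter Topology
open scoped ENNReal

theorem volume_prod_restrict {N : ℕ} (K : Set (Space N)) (I : Set ℝ) :
    (volume : Measure (Space N × ℝ)).restrict (K ×ˢ I)
      = (volume.restrict K).prod (volume.restrict I) := by
  rw [Measure.prod_restrict]; rfl

/-- The final time t₂ = t is allowed because a single time slice is a null set. -/
theorem ae_restrict_prod_Icc_of_Ioo {N : ℕ} {K : Set (Space N)} {s t t₁ t₂ : ℝ} (h₁ : s < t₁)
    (h₂ : t₂ ≤ t) {P : Space N × ℝ → Prop} (h : ∀ᵐ z ∂(volume.restrict (K ×ˢ Set.Ioo s t)), P z) :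
    ∀ᵐ z ∂(volume.restrict (K ×ˢ Set.Icc t₁ t₂)), P z := by
  have hIoc : Set.Icc t₁ t₂ ⊆ Set.Ioc s t := fun τ hτ => ⟨h₁.trans_le hτ.1, hτ.2.trans h₂⟩
  have hae : (K ×ˢ Set.Icc t₁ t₂ : Set (Space N × ℝ)) ≤ᵐ[volume]
      (K ×ˢ Set.Ioc s t : Set (Space N × ℝ)) :=
    LE.le.eventuallyLE (Set.prod_mono le_rfl hIoc)
  have hae2 : (K ×ˢ Set.Ioc s t : Set (Space N × ℝ)) =ᵐ[volume]
      (K ×ˢ Set.Ioo s t : Set (Space N × ℝ)) :=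
    Measure.set_prod_ae_eq (μ := (volume : Measure (Space N))) (ν := (volume : Measure ℝ))
      (ae_eq_refl K) Ioo_ae_eq_Ioc.symm
  exact ae_mono (Measure.restrict_mono_ae (hae.trans hae2.le)) h

theorem nonneg_of_Ioo_subset {s t T : ℝ} (hst : s < t) (hI : Set.Ioo s t ⊆ Set.Ioo 0 T) :
    0 ≤ s := by
  by_contra! hneg
  obtain ⟨v, hv1, hv2⟩ := exists_between (lt_min hneg hst)
  exact absurd (hI ⟨hv1, hv2.trans_le (min_le_right _ _)⟩).1
    (not_lt.2 (hv2.le.trans (min_le_left _ _)))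

theorem memLp_slice_of_memLp_prod {N : ℕ} {E : Type*} [NormedAddCommGroup E] {p : ℝ} (hp : 0 < p)
    {K : Set (Space N)} {I : Set ℝ} {g : Space N → ℝ → E}
    (hg : MemLp (fun z : Space N × ℝ => g z.1 z.2) (ENNReal.ofReal p)
      (volume.restrict (K ×ˢ I))) :
    ∀ᵐ τ ∂(volume.restrict I),
      MemLp (fun x => g x τ) (ENNReal.ofReal p) (volume.restrict K) := by
  rw [volume_prod_restrict] at hg
  have hi := hg.integrable_norm_rpow (by simpa using hp) ENNReal.ofReal_ne_top
  filter_upwards [hg.1.prod_swap.prodMk_left, hi.prod_left_ae] with τ h1 h2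
  exact (integrable_norm_rpow_iff h1 (by simpa using hp) ENNReal.ofReal_ne_top).1 h2

/-- If the averages over backward time intervals of the pairing of `a` with the slices of `g` are
bounded below by the increments of a bounded function, then the pairing of `a` and `g` is bounded
below. -/
theorem neg_le_setIntegral_inner_of_slices {N : ℕ} {E : Type*} [NormedAddCommGroup E]
    [InnerProductSpace ℝ E] {P Q : ℝ≥0∞} [ENNReal.HolderConjugate P Q] (hP : P ≠ ∞)
    {K : Set (Space N)} (hK : IsCompact K) {t₀ t₁ t₂ : ℝ} (h₀₁ : t₀ < t₁) (h₁₂ : t₁ < t₂)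
    {a g : Space N → ℝ → E}
    (ha : MemLp (fun z : Space N × ℝ => a z.1 z.2) P (volume.restrict (K ×ˢ Set.Icc t₀ t₂)))
    (hg : MemLp (fun z : Space N × ℝ => g z.1 z.2) Q (volume.restrict (K ×ˢ Set.Icc t₁ t₂)))
    (hgs : ∀ᵐ τ ∂(volume.restrict (Set.Icc t₁ t₂)), MemLp (fun x => g x τ) Q (volume.restrict K))
    {H : ℝ → ℝ} {C : ℝ} (hHm : AEStronglyMeasurable H (volume.restrict (Set.Icc t₀ t₂)))
    (hH : ∀ τ ∈ Set.Icc t₀ t₂, 0 ≤ H τ ∧ H τ ≤ C)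
    (h : ∀ ε, 0 < ε → ε < t₁ - t₀ → ∀ᵐ τ ∂(volume.restrict (Set.Icc t₁ t₂)),
      H τ - H (τ - ε) ≤ ∫ z in K ×ˢ Set.Icc (τ - ε) τ, inner ℝ (a z.1 z.2) (g z.1 τ)) :
    -C ≤ ∫ z in K ×ˢ Set.Icc t₁ t₂, inner ℝ (a z.1 z.2) (g z.1 z.2) := by
  have : IsFiniteMeasure (volume.restrict K) := ⟨by simpa using hK.measure_lt_top⟩
  have hKm := hK.measurableSet
  have hm₀ : MeasurableSet (K ×ˢ Set.Icc t₀ t₂) := hKm.prod measurableSet_Icc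
  have hm₁ : MeasurableSet (K ×ˢ Set.Icc t₁ t₂) := hKm.prod measurableSet_Icc
  -- Extension by zero makes translations available. The field `a` is kept on the longer interval,
  -- so that backward shifts by ε < t₁ - t₀ of points with τ ≥ t₁ never reach the cut.
  set a' : Space N × ℝ → E := (K ×ˢ Set.Icc t₀ t₂).indicator fun z => a z.1 z.2 with ha'
  set g' : Space N × ℝ → E := (K ×ˢ Set.Icc t₁ t₂).indicator fun z => g z.1 z.2 with hg'
  have ha'p : MemLp a' P volume := (memLp_indicator_iff_restrict hm₀).2 ha
  have hg'p : MemLp g' Q volume := (memLp_indicator_iff_restrict hm₁).2 hg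
  set e : ℝ → Space N × ℝ := fun σ => (0, σ) with he
  have hec : Continuous e := by fun_prop
  have hgoal : ∫ z, inner ℝ (a' z) (g' z)
      = ∫ z in K ×ˢ Set.Icc t₁ t₂, inner ℝ (a z.1 z.2) (g z.1 z.2) := by
    rw [← integral_indicator hm₁]
    refine integral_congr_ae (ae_of_all _ fun z => ?_)
    by_cases hz : z ∈ K ×ˢ Set.Icc t₁ t₂
    · have hz' : z ∈ K ×ˢ Set.Icc t₀ t₂ := ⟨hz.1, h₀₁.le.trans hz.2.1, hz.2.2⟩
      simp [ha', hg', hz, hz']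
    · simp [hg', hz]
  rw [← hgoal]
  have : (volume : Measure (Space N × ℝ)).IsAddHaarMeasure :=
    inferInstanceAs ((volume : Measure (Space N)).prod (volume : Measure ℝ)).IsAddHaarMeasure
  have : (volume : Measure (Space N × ℝ)).IsAddRightInvariant := inferInstance
  refine neg_le_integral_inner_of_average hec rfl hP ha'p hg'p ?_
  have hev : ∀ᶠ ε in 𝓝[>] (0 : ℝ), ε ∈ Set.Ioo 0 (min (t₁ - t₀) (t₂ - t₁)) :=
    Ioo_mem_nhdsGT (lt_min (by linarith) (by linarith))
  filter_upwards [hev] with ε hε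
  have hε0 := hε.1
  have hε1 : ε < t₁ - t₀ := hε.2.trans_le (min_le_left _ _)
  have hε2 : ε < t₂ - t₁ := hε.2.trans_le (min_le_right _ _)
  have hint : Integrable (fun z : Space N × ℝ => ∫ σ in Set.Icc 0 ε, inner ℝ (a' (z - e σ)) (g' z))
      ((volume : Measure (Space N)).prod (volume : Measure ℝ)) :=
    (integrable_inner_translate_prod hec ha'p hg'p ε).integral_prod_right
  have e1 : ∫ z : Space N × ℝ, ∫ σ in Set.Icc 0 ε, inner ℝ (a' (z - e σ)) (g' z)
      = ∫ τ in Set.Icc t₁ t₂, ∫ x in K, ∫ σ in Set.Icc 0 ε,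
          inner ℝ (a' ((x, τ) - e σ)) (g' (x, τ)) := by
    change ∫ z, _ ∂((volume : Measure (Space N)).prod (volume : Measure ℝ)) = _
    rw [integral_prod_symm _ hint, ← integral_indicator measurableSet_Icc]
    refine integral_congr_ae (ae_of_all _ fun τ => ?_)
    by_cases hτ : τ ∈ Set.Icc t₁ t₂
    · simp only [Set.indicator_of_mem hτ]
      rw [← integral_indicator hKm]
      refine integral_congr_ae (ae_of_all _ fun x => ?_)
      by_cases hx : x ∈ K
      · simp [hx]
      · simp [hx, hg']
    · simp [hg', hτ]
  have e2 : Integrable (fun τ => ∫ x in K, ∫ σ in Set.Icc 0 ε,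
          inner ℝ (a' ((x, τ) - e σ)) (g' (x, τ))) (volume.restrict (Set.Icc t₁ t₂)) := by
    have := (hint.mono_measure (Measure.prod_mono (Measure.restrict_le_self (s := K))
      (Measure.restrict_le_self (s := Set.Icc t₁ t₂)))).integral_prod_right
    exact this
  have e3 : ∀ᵐ τ ∂(volume.restrict (Set.Icc t₁ t₂)), H τ - H (τ - ε) ≤
      ∫ x in K, ∫ σ in Set.Icc 0 ε, inner ℝ (a' ((x, τ) - e σ)) (g' (x, τ)) := by
    filter_upwards [h ε hε0 hε1, hgs, ae_restrict_mem measurableSet_Icc] with τ h1 h2 hτ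
    refine h1.trans (le_of_eq ?_)
    have hsub : K ×ˢ Set.Icc (τ - ε) τ ⊆ K ×ˢ Set.Icc t₀ t₂ :=
      Set.prod_mono le_rfl (Set.Icc_subset_Icc (by linarith [hτ.1]) hτ.2)
    have ha2 := ha.mono_measure (Measure.restrict_mono hsub le_rfl)
    have hi : Integrable (fun z : Space N × ℝ => inner ℝ (a z.1 z.2) (g z.1 τ))
        ((volume.restrict K).prod (volume.restrict (Set.Icc (τ - ε) τ))) := by
      rw [volume_prod_restrict] at ha2
      exact integrable_inner_of_memLp ha2 (h2.comp_fst _)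
    rw [volume_prod_restrict, integral_prod _ hi]
    refine setIntegral_congr_fun hKm fun x hx => ?_
    have hgx : g' (x, τ) = g x τ := by
      have hmem : (x, τ) ∈ K ×ˢ Set.Icc t₁ t₂ := ⟨hx, hτ⟩
      simp [hg', Set.indicator_of_mem hmem]
    simp only [hgx]
    rw [integral_Icc_eq_integral_Ioc, integral_Icc_eq_integral_Ioc,
      ← intervalIntegral.integral_of_le (by linarith), ← intervalIntegral.integral_of_le hε0.le]
    -- Averaging over shifts σ in [0, ε] is the same as integrating over times τ' = τ - σ in [τ - ε,
    -- τ].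
    have hsubst := intervalIntegral.integral_comp_sub_left (a := 0) (b := ε)
      (fun τ' => inner ℝ (a x τ') (g x τ)) τ
    rw [sub_zero] at hsubst
    rw [← hsubst]
    refine intervalIntegral.integral_congr fun σ hσ => ?_
    rw [Set.uIcc_of_le hε0.le] at hσ
    have hmem : (x, τ - σ) ∈ K ×ˢ Set.Icc t₀ t₂ :=
      ⟨hx, by linarith [hτ.1, hσ.2], by linarith [hτ.2, hσ.1]⟩
    simp [he, ha', Set.indicator_of_mem hmem]
  have hHi : IntegrableOn H (Set.Icc t₀ t₂) :=
    Integrable.of_bound hHm C <| by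
      filter_upwards [ae_restrict_mem measurableSet_Icc] with τ hτ
      rw [Real.norm_of_nonneg (hH τ hτ).1]; exact (hH τ hτ).2
  have hHii : ∀ a b, a ∈ Set.Icc t₀ t₂ → b ∈ Set.Icc t₀ t₂ → IntervalIntegrable H volume a b :=
    fun a b ha hb => by
      rw [intervalIntegrable_iff]
      refine hHi.mono_set (Set.uIoc_subset_uIcc.trans ?_)
      exact Set.uIcc_subset_Icc ha hb
  have m1 : t₁ ∈ Set.Icc t₀ t₂ := ⟨h₀₁.le, h₁₂.le⟩
  have m2 : t₂ ∈ Set.Icc t₀ t₂ := ⟨by linarith, le_rfl⟩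
  have m3 : t₁ - ε ∈ Set.Icc t₀ t₂ := ⟨by linarith, by linarith⟩
  have m4 : t₂ - ε ∈ Set.Icc t₀ t₂ := ⟨by linarith, by linarith⟩
  have hshift : IntervalIntegrable (fun τ => H (τ - ε)) volume t₁ t₂ := by
    have := (hHii (t₁ - ε) (t₂ - ε) m3 m4).comp_sub_right ε
    simpa using this
  have e4 : ∫ τ in Set.Icc t₁ t₂, (H τ - H (τ - ε)) ≤ ∫ τ in Set.Icc t₁ t₂, ∫ x in K,
      ∫ σ in Set.Icc 0 ε, inner ℝ (a' ((x, τ) - e σ)) (g' (x, τ)) := by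
    refine integral_mono_ae ?_ e2 e3
    have := (hHii t₁ t₂ m1 m2).sub hshift
    rw [intervalIntegrable_iff_integrableOn_Icc_of_le h₁₂.le] at this
    exact this
  rw [e1]
  refine le_trans ?_ e4
  -- The increments telescope: what remains is the integral of H over [t₂ - ε, t₂] minus that over
  -- [t₁ - ε, t₁], which is at least -C ε.
  rw [integral_Icc_eq_integral_Ioc, ← intervalIntegral.integral_of_le h₁₂.le,
    intervalIntegral.integral_sub (hHii t₁ t₂ m1 m2) hshift,
    intervalIntegral.integral_comp_sub_right H,
    intervalIntegral.integral_interval_sub_interval_comm (hHii _ _ m1 m2) (hHii _ _ m3 m4)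
      (hHii _ _ m1 m3), intervalIntegral.integral_symm, intervalIntegral.integral_symm (t₂ - ε)]
  have b1 : ∫ τ in (t₁ - ε)..t₁, H τ ≤ ∫ τ in (t₁ - ε)..t₁, C :=
    intervalIntegral.integral_mono_on (by linarith) (hHii _ _ m3 m1) intervalIntegrable_const
      fun τ hτ => (hH τ ⟨m3.1.trans hτ.1, hτ.2.trans m1.2⟩).2
  have b2 : 0 ≤ ∫ τ in (t₂ - ε)..t₂, H τ :=
    intervalIntegral.integral_nonneg (by linarith)
      fun τ hτ => (hH τ ⟨m4.1.trans hτ.1, hτ.2⟩).1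
  rw [intervalIntegral.integral_const, smul_eq_mul] at b1
  linarith

end DNL

/-! ### The energy inequality -/

namespace DNL
open Filter Topology
open scoped ENNReal Gradient

theorem holderConjugate_div_sub_one {p : ℝ} (hp : 1 < p) :
    ENNReal.HolderConjugate (ENNReal.ofReal (p / (p - 1))) (ENNReal.ofReal p) :=
  (Real.HolderConjugate.conjExponent hp).symm.ennrealOfReal

/-- The energy inequality obtained from the test function `f(m - u) Z`. -/
theorem neg_le_integral_flux_inner {N : ℕ} {p q K₁ K₂ : ℝ} (hp : 1 < p) (hq : 0 < q)
    {Ω : Set (Space N)} (hΩ : IsOpen Ω) {T : ℝ} {A : Space N → ℝ → ℝ → Space N → Space N}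
    (hA : IsAdmissibleField p K₁ K₂ Ω T A)
    {u : Space N → ℝ → ℝ} {Du : Space N → ℝ → Space N}
    (hsub : IsLocalWeakSubsolution p q Ω T A u Du) (hsup : IsLocalWeakSupersolution p q Ω T A u Du)
    {y : Space N} {r₁ r₂ : ℝ} (hr₁ : 0 < r₁) (hr : r₁ < r₂) (hKΩ : Metric.closedBall y r₂ ⊆ Ω)
    {s t : ℝ} (hst : s < t) (hI : Set.Ioo s t ⊆ Set.Ioo 0 T) {μm μp : ℝ}
    (hb : ∀ᵐ z : Space N × ℝ ∂(volume.restrict (Metric.closedBall y r₂ ×ˢ Set.Ioo s t)),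
      μm ≤ u z.1 z.2 ∧ u z.1 z.2 ≤ μp)
    {f : ℝ → ℝ} (hfm : Measurable f) (hfs : ∀ a, 0 ≤ a → ContDiffAt ℝ (⊤ : ℕ∞) f a)
    (hfmono : MonotoneOn f (Set.Ici 0)) (hf0 : ∀ a, 0 ≤ a → 0 ≤ f a) {B : ℝ}
    (hfB : ∀ a, 0 ≤ a → f a ≤ B)
    {Z : Space N → ℝ} (hZ : ContDiff ℝ 1 Z) (hZ0 : ∀ x, 0 ≤ Z x)
    (hZs : tsupport Z ⊆ Metric.closedBall y r₁) {S : ℝ}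
    (hS : ∀ τ ∈ Set.Icc s t ∩ Set.Ioo 0 T,
      ∫ x in Metric.closedBall y r₂, deficit q μp u x τ * Z x ≤ S)
    {t₁ t₂ : ℝ} (h₁ : s < t₁) (h₁₂ : t₁ < t₂) (h₂ : t₂ ≤ t) (h₂T : t₂ < T) :
    IntegrableOn (fun z : Space N × ℝ => inner ℝ (A z.1 z.2 (u z.1 z.2) (Du z.1 z.2))
        ((deriv f (μp - u z.1 z.2) * Z z.1) • (-Du z.1 z.2) + f (μp - u z.1 z.2) • ∇ Z z.1))
      (Metric.closedBall y r₂ ×ˢ Set.Icc t₁ t₂) ∧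
    -(B * S) ≤ ∫ z in Metric.closedBall y r₂ ×ˢ Set.Icc t₁ t₂,
      inner ℝ (A z.1 z.2 (u z.1 z.2) (Du z.1 z.2))
        ((deriv f (μp - u z.1 z.2) * Z z.1) • (-Du z.1 z.2) + f (μp - u z.1 z.2) • ∇ Z z.1) := by
  set K := Metric.closedBall y r₂ with hKdef
  have hK : IsCompact K := isCompact_closedBall _ _
  have : IsFiniteMeasure (volume.restrict K) := ⟨by simpa using hK.measure_lt_top⟩
  have hp0 : 0 < p := by linarith
  have hs0 : 0 ≤ s := nonneg_of_Ioo_subset hst hI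
  have hB0 : 0 ≤ B := (hf0 0 le_rfl).trans (hfB 0 le_rfl)
  -- Room below t₁ for the backward time shifts.
  obtain ⟨t₀, hst₀, ht₀₁⟩ := exists_between h₁
  have ht₀ : 0 < t₀ := hs0.trans_lt hst₀
  have hJ : ∀ τ ∈ Set.Icc t₀ t₂, τ ∈ Set.Icc s t ∩ Set.Ioo 0 T := fun τ hτ =>
    ⟨⟨hst₀.le.trans hτ.1, hτ.2.trans h₂⟩, ht₀.trans_le hτ.1, hτ.2.trans_lt h₂T⟩
  have hslice : ∀ τ ∈ Set.Icc t₀ t₂, ∀ᵐ x ∂(volume.restrict K), μm ≤ u x τ ∧ u x τ ≤ μp :=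
    fun τ hτ => ae_slice_bounds (by linarith) hsub.1 hK hKΩ hst hI hb (hJ τ hτ)
  have hum : ∀ τ ∈ Set.Icc t₀ t₂, AEStronglyMeasurable (fun x => u x τ) (volume.restrict K) :=
    fun τ hτ => (hsub.1 K hK hKΩ τ (hJ τ hτ).2).1.1
  obtain ⟨G, hGc, hGb, hGi⟩ := exists_primitive_comp_spow hq hfmono hf0 hfB μp
  have hZc : HasCompactSupport Z :=
    (isCompact_closedBall _ _).of_isClosed_subset (isClosed_tsupport _) hZs
  have hgZ : Continuous (∇ Z) := continuous_gradient hZ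
  obtain ⟨CZ, hCZ⟩ := hZ.continuous.bounded_above_of_compact_support hZc
  obtain ⟨CG, hCG⟩ := hgZ.bounded_above_of_compact_support (hasCompactSupport_gradient hZc)
  obtain ⟨CF', hCF'⟩ := isCompact_Icc.exists_bound_of_continuousOn (s := Set.Icc 0 (μp - μm))
    (f := deriv f) fun a ha => (((hfs a ha.1).continuousAt_fderiv (by simp)).clm_apply
      continuousAt_const).continuousWithinAt
  have hZi : Integrable Z (volume.restrict K) :=
    (hZ.continuous.integrable_of_hasCompactSupport hZc).integrableOn
  -- space-time measurability
  have hsubs : ∀ a b, t₀ ≤ a → b ≤ t₂ → K ×ˢ Set.Icc a b ⊆ Ω ×ˢ Set.Ioo 0 T :=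
    fun a b ha hb => prod_Icc_subset hKΩ (ht₀.trans_le ha) (hb.trans_lt h₂T)
  have hum₂ : ∀ a b, t₀ ≤ a → b ≤ t₂ → AEStronglyMeasurable
      (fun z : Space N × ℝ => u z.1 z.2) (volume.restrict (K ×ˢ Set.Icc a b)) :=
    fun a b ha hb => hsub.2.1.measurable.mono_set (hsubs a b ha hb)
  have ha := hA.memLp_comp hp hsub.2.1 hK hKΩ ht₀ (ht₀₁.trans h₁₂) h₂T
  have hDu := (hsub.2.1.memLp K hK hKΩ t₁ t₂ (ht₀.trans ht₀₁) h₁₂ h₂T).2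
  set H : ℝ → ℝ := fun τ => ∫ x in K, G (deficit q μp u x τ) * Z x with hHdef
  have hGint : ∀ τ ∈ Set.Icc t₀ t₂,
      Integrable (fun x => G (deficit q μp u x τ) * Z x) (volume.restrict K) := fun τ hτ => by
    refine hZi.bdd_mul (c := B * (spow q μp - spow q μm)) ?_ ?_
    · exact hGc.measurable.comp_aemeasurable
        (((measurable_spow q).comp_aemeasurable (hum τ hτ).aemeasurable).const_sub _)
          |>.aestronglyMeasurable
    · filter_upwards [hslice τ hτ] with x hx
      have h3 := deficit_bounds hq hx
      have h4 := hGb _ h3.1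
      rw [Real.norm_of_nonneg h4.1]
      exact h4.2.trans (mul_le_mul_of_nonneg_left h3.2 hB0)
  have hHb : ∀ τ ∈ Set.Icc t₀ t₂, 0 ≤ H τ ∧ H τ ≤ B * S := fun τ hτ => by
    constructor
    · refine integral_nonneg_of_ae ?_
      filter_upwards [hslice τ hτ] with x hx
      exact mul_nonneg (hGb _ (deficit_bounds hq hx).1).1 (hZ0 x)
    · calc H τ ≤ ∫ x in K, B * (deficit q μp u x τ * Z x) := by
            refine integral_mono_ae (hGint τ hτ)
              ((integrable_deficit_mul hq (hum τ hτ) (hslice τ hτ) hZi).const_mul B) ?_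
            filter_upwards [hslice τ hτ] with x hx
            rw [← mul_assoc]
            exact mul_le_mul_of_nonneg_right (hGb _ (deficit_bounds hq hx).1).2 (hZ0 x)
        _ ≤ B * S := by
            rw [integral_const_mul]
            exact mul_le_mul_of_nonneg_left (hS τ (hJ τ hτ)) hB0
  have hHm : AEStronglyMeasurable H (volume.restrict (Set.Icc t₀ t₂)) := by
    have h3 := hum₂ t₀ t₂ le_rfl le_rfl
    rw [volume_prod_restrict] at h3
    have h4 : AEStronglyMeasurable (fun z : Space N × ℝ => G (deficit q μp u z.1 z.2) * Z z.1)
        ((volume.restrict K).prod (volume.restrict (Set.Icc t₀ t₂))) := by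
      refine AEStronglyMeasurable.mul ?_ (hZ.continuous.comp continuous_fst).aestronglyMeasurable
      exact hGc.measurable.comp_aemeasurable
        (((measurable_spow q).comp_aemeasurable h3.aemeasurable).const_sub _)
          |>.aestronglyMeasurable
    exact h4.prod_swap.integral_prod_right'
  have hg : MemLp (fun z : Space N × ℝ =>
      (deriv f (μp - u z.1 z.2) * Z z.1) • (-Du z.1 z.2) + f (μp - u z.1 z.2) • ∇ Z z.1)
      (ENNReal.ofReal p) (volume.restrict (K ×ˢ Set.Icc t₁ t₂)) := by
    have hfin : IsFiniteMeasure ((volume : Measure (Space N × ℝ)).restrict (K ×ˢ Set.Icc t₁ t₂)) :=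
      ⟨by simpa using (hK.prod isCompact_Icc).measure_lt_top⟩
    have h3 := ((hum₂ t₁ t₂ ht₀₁.le le_rfl).aemeasurable.const_sub μp)
    have hbb : ∀ᵐ z : Space N × ℝ ∂(volume.restrict (K ×ˢ Set.Icc t₁ t₂)),
        0 ≤ μp - u z.1 z.2 ∧ μp - u z.1 z.2 ≤ μp - μm := by
      filter_upwards [ae_restrict_prod_Icc_of_Ioo h₁ h₂ hb] with z hz
      exact ⟨by linarith, by linarith⟩
    have hZm : AEStronglyMeasurable (fun z : Space N × ℝ => Z z.1)
        (volume.restrict (K ×ˢ Set.Icc t₁ t₂)) :=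
      (hZ.continuous.comp continuous_fst).aestronglyMeasurable
    have hf'm : AEStronglyMeasurable (fun z : Space N × ℝ => deriv f (μp - u z.1 z.2))
        (volume.restrict (K ×ˢ Set.Icc t₁ t₂)) :=
      ((measurable_deriv f).comp_aemeasurable h3).aestronglyMeasurable
    have hffm : AEStronglyMeasurable (fun z : Space N × ℝ => f (μp - u z.1 z.2))
        (volume.restrict (K ×ˢ Set.Icc t₁ t₂)) :=
      (hfm.comp_aemeasurable h3).aestronglyMeasurable
    refine MemLp.add ?_ ?_
    · refine (hDu.norm.const_mul (CF' * CZ)).mono' ((hf'm.mul hZm).smul hDu.1.neg) ?_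
      filter_upwards [hbb] with z hz
      have h5 := hCF' _ hz
      rw [norm_smul, norm_mul, norm_neg]
      have : 0 ≤ CF' := (norm_nonneg _).trans h5
      gcongr
      exact hCZ _
    · refine MemLp.of_bound (hffm.smul (hgZ.comp continuous_fst).aestronglyMeasurable) (B * CG) ?_
      filter_upwards [hbb] with z hz
      rw [norm_smul, Real.norm_of_nonneg (hf0 _ hz.1)]
      gcongr
      exacts [hfB _ hz.1, hCG _]
  have hconj := holderConjugate_div_sub_one hp
  refine ⟨integrable_inner_of_memLp (hA.memLp_comp hp hsub.2.1 hK hKΩ (ht₀.trans ht₀₁) h₁₂ h₂T)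
    hg, ?_⟩
  refine neg_le_setIntegral_inner_of_slices (P := ENNReal.ofReal (p / (p - 1)))
    (Q := ENNReal.ofReal p) ENNReal.ofReal_ne_top hK ht₀₁ h₁₂
    (a := fun x τ => A x τ (u x τ) (Du x τ))
    (g := fun x τ => (deriv f (μp - u x τ) * Z x) • (-Du x τ) + f (μp - u x τ) • ∇ Z x)
    ha hg (memLp_slice_of_memLp_prod hp0 hg) hHm hHb ?_
  intro ε hε hε'
  have hIoo : Set.Icc t₁ t₂ ⊆ Set.Ioo 0 T := fun τ hτ =>
    ⟨(ht₀.trans ht₀₁).trans_le hτ.1, hτ.2.trans_lt h₂T⟩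
  have hw : ∀ᵐ τ ∂(volume.restrict (Set.Icc t₁ t₂)),
      HasWeakGradient Ω (fun x => u x τ) (fun x => Du x τ) :=
    ae_mono (Measure.restrict_mono hIoo le_rfl) hsub.2.1.weakGradient
  filter_upwards [hw, memLp_slice_of_memLp_prod hp0 hDu, ae_restrict_mem measurableSet_Icc]
    with τ hτw hτD hτ
  have hτ0 : τ ∈ Set.Icc t₀ t₂ := ⟨ht₀₁.le.trans hτ.1, hτ.2⟩
  have hτε : τ - ε ∈ Set.Icc t₀ t₂ := ⟨by linarith [hτ.1], by linarith [hτ.2]⟩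
  -- The slice at time τ is the stationary test function used on the whole interval [τ - ε, τ].
  have hη := memSobolevZero_comp_mul hp.le hΩ (hτw.const_sub hΩ μp) hr₁ hr hKΩ hτD.neg
    (b := μp - μm) ((hslice τ hτ0).mono fun x hx => ⟨by linarith [hx.2], by linarith [hx.1]⟩)
    hfs hZ hZs
  have hηC : ∀ᵐ x ∂(volume.restrict K),
      0 ≤ f (μp - u x τ) * Z x ∧ f (μp - u x τ) * Z x ≤ B * CZ := by
    filter_upwards [hslice τ hτ0] with x hx
    have h3 : 0 ≤ μp - u x τ := by linarith [hx.2]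
    refine ⟨mul_nonneg (hf0 _ h3) (hZ0 x), mul_le_mul (hfB _ h3) ?_ (hZ0 x) hB0⟩
    exact (Real.le_norm_self _).trans (hCZ x)
  have hflux := integral_flux_eq hq hsub hsup hK hKΩ (ht₀.trans_le hτε.1) (by linarith)
    (hτ.2.trans_lt h₂T) hη hηC (hslice _ hτε) (hslice _ hτ0)
  rw [hflux]
  have hηi : Integrable (fun x => f (μp - u x τ) * Z x) (volume.restrict K) :=
    Integrable.of_bound hη.1.1 (B * CZ) (hηC.mono fun x hx => by
      rw [Real.norm_of_nonneg hx.1]; exact hx.2)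
  have i1 := integrable_deficit_mul hq (hum _ hτ0) (hslice _ hτ0) hηi
  have i2 := integrable_deficit_mul hq (hum _ hτε) (hslice _ hτε) hηi
  rw [hHdef]
  simp only
  rw [← integral_sub (hGint _ hτ0) (hGint _ hτε), ← integral_sub i1 i2]
  refine integral_mono_ae ((hGint _ hτ0).sub (hGint _ hτε)) (i1.sub i2) ?_
  filter_upwards [hslice _ hτ0] with x hx
  -- Convexity of G, with the tangent taken at the later time τ, at which the test function was
  -- frozen.
  have h3 := hGi (u x τ) hx.2 (deficit q μp u x (τ - ε))
  have h4 := mul_le_mul_of_nonneg_right h3 (hZ0 x)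
  simp only [deficit] at *
  linarith

end DNL

/-! ### The profile f, Young's inequality and absorption -/

namespace DNL
open Filter Topology
open scoped ENNReal Gradient

section Truncation

variable {κ ν : ℝ}

theorem powerDeficit_contDiffAt (κ : ℝ) (hν : 0 < ν) {a : ℝ} (ha : 0 ≤ a) :
    ContDiffAt ℝ (⊤ : ℕ∞) (fun h => ν ^ (-κ) - (h + ν) ^ (-κ)) a :=
  contDiffAt_const.sub ((contDiffAt_id.add contDiffAt_const).rpow_const_of_ne
    (by simp only [id]; positivity))

theorem powerDeficit_deriv (κ : ℝ) (hν : 0 < ν) {a : ℝ} (ha : 0 ≤ a) :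
    deriv (fun h => ν ^ (-κ) - (h + ν) ^ (-κ)) a = κ * (a + ν) ^ (-κ - 1) := by
  have h1 : HasDerivAt (fun h : ℝ => h + ν) 1 a := (hasDerivAt_id a).add_const ν
  have h2 := (h1.rpow_const (p := -κ) (Or.inl (by positivity))).const_sub (ν ^ (-κ))
  rw [h2.deriv]; ring

theorem powerDeficit_monotoneOn (hκ : 0 < κ) (hν : 0 < ν) :
    MonotoneOn (fun h => ν ^ (-κ) - (h + ν) ^ (-κ)) (Set.Ici 0) := by
  intro a ha b hb hab
  have ha' : (0 : ℝ) ≤ a := ha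
  have := Real.rpow_le_rpow_of_nonpos (z := -κ) (x := a + ν) (y := b + ν) (by positivity)
    (by linarith) (by linarith)
  simp only
  linarith

theorem powerDeficit_bounds (hκ : 0 < κ) (hν : 0 < ν) {a : ℝ} (ha : 0 ≤ a) :
    0 ≤ ν ^ (-κ) - (a + ν) ^ (-κ) ∧ ν ^ (-κ) - (a + ν) ^ (-κ) ≤ ν ^ (-κ) := by
  have h1 := Real.rpow_le_rpow_of_nonpos (z := -κ) (x := ν) (y := a + ν) hν
    (by linarith) (by linarith)
  have h2 : 0 ≤ (a + ν) ^ (-κ) := by positivity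
  constructor <;> linarith

end Truncation

/-- A form of Young's inequality. -/
theorem rpow_mul_rpow_le_young {p l X ζ m : ℝ} (hp : 1 < p) (hl : p < l) (hX : 0 ≤ X)
    (hζ : 0 ≤ ζ) (hm : 0 < m) :
    X ^ (p - 1) * ζ ^ (l - 1) ≤ m * (X ^ p * ζ ^ l) + m ^ (1 - p) * ζ ^ (l - p) := by
  rcases hζ.eq_or_lt with rfl | hζ0
  · rw [Real.zero_rpow (by linarith), Real.zero_rpow (by linarith), Real.zero_rpow (by linarith)]
    simp
  rcases hX.eq_or_lt with rfl | hX0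
  · rw [Real.zero_rpow (by linarith), Real.zero_rpow (by linarith)]
    simp only [zero_mul, mul_zero, zero_add]
    positivity
  have e1 : m * (X ^ p * ζ ^ l) = (m * X * ζ) * (X ^ (p - 1) * ζ ^ (l - 1)) := by
    rw [Real.rpow_sub_one hX0.ne', Real.rpow_sub_one hζ0.ne']; field_simp
  -- The first term on the right is m X ζ times the left side and dominates it if m X ζ ≥ 1;
  -- otherwise X ζ ≤ 1/m and the second term dominates.
  rcases le_total 1 (m * X * ζ) with h | h
  · rw [e1]
    have : 0 ≤ m ^ (1 - p) * ζ ^ (l - p) := by positivity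
    have h2 : 0 ≤ X ^ (p - 1) * ζ ^ (l - 1) := by positivity
    nlinarith
  · have h3 : X * ζ ≤ m⁻¹ := by
      rw [← one_div, le_div_iff₀ hm]; linarith
    have h4 : X ^ (p - 1) * ζ ^ (l - 1) = (X * ζ) ^ (p - 1) * ζ ^ (l - p) := by
      rw [Real.mul_rpow hX hζ, mul_assoc, ← Real.rpow_add hζ0]
      ring_nf
    have h5 : (X * ζ) ^ (p - 1) ≤ m ^ (1 - p) := by
      calc (X * ζ) ^ (p - 1) ≤ (m⁻¹) ^ (p - 1) :=
            Real.rpow_le_rpow (by positivity) h3 (by linarith)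
        _ = m ^ (1 - p) := by
            rw [Real.inv_rpow hm.le, ← Real.rpow_neg hm.le]; ring_nf
    rw [h4]
    have : (X * ζ) ^ (p - 1) * ζ ^ (l - p) ≤ m ^ (1 - p) * ζ ^ (l - p) := by gcongr
    have h6 : 0 ≤ m * (X ^ p * ζ ^ l) := by positivity
    linarith

/-- Since ζ ≤ 1 and l θ ≤ l - p, the weight can be put inside the power θ. Adding ν keeps the base
at least ν, so lowering the exponent from 1 to θ costs at most ν^(θ-1). This turns the sublinear
remainder of Young's inequality into the mass itself. -/
theorem rpow_mul_rpow_le_linear {θ l p h ν ζ : ℝ} (hθ0 : 0 ≤ θ) (hθ1 : θ ≤ 1)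
    (hl0 : 0 ≤ l) (hl : l * θ ≤ l - p) (hh : 0 ≤ h) (hν : 0 < ν) (hζ0 : 0 ≤ ζ) (hζ1 : ζ ≤ 1) :
    (h + ν) ^ θ * ζ ^ (l - p) ≤ ν ^ (θ - 1) * (h * ζ ^ l + 2 * ν) := by
  have h1 : ζ ^ (l - p) ≤ ζ ^ (l * θ) :=
    Real.rpow_le_rpow_of_exponent_ge' hζ0 hζ1 (mul_nonneg hl0 hθ0) hl
  have hζl : ζ ^ l ≤ 1 := Real.rpow_le_one hζ0 hζ1 hl0
  have hζl0 : 0 ≤ ζ ^ l := by positivity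
  have hy : (h + ν) * ζ ^ l + ν ≤ h * ζ ^ l + 2 * ν := by nlinarith
  have hy0 : 0 ≤ (h + ν) * ζ ^ l := by positivity
  calc (h + ν) ^ θ * ζ ^ (l - p) ≤ (h + ν) ^ θ * ζ ^ (l * θ) := by gcongr
    _ = ((h + ν) * ζ ^ l) ^ θ := by
        rw [Real.mul_rpow (by positivity) hζl0, Real.rpow_mul hζ0]
    _ ≤ ((h + ν) * ζ ^ l + ν) ^ θ := by gcongr; linarith
    _ = ((h + ν) * ζ ^ l + ν) ^ (θ - 1) * ((h + ν) * ζ ^ l + ν) := by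
        rw [Real.rpow_sub_one (by positivity)]; field_simp
    _ ≤ ν ^ (θ - 1) * (h * ζ ^ l + 2 * ν) := by
        refine mul_le_mul ?_ hy (by positivity) (by positivity)
        exact Real.rpow_le_rpow_of_nonpos hν (by linarith) (by linarith)

/-- Absorption: an energy inequality and an interpolation inequality, with the parameters balanced,
bound the flux by a small multiple of the mass. -/
theorem flux_le_of_energy {p q K₁ b₀ δ σ r a k τ D E S V ν : ℝ} (hp : 1 < p) (hp2 : p < 2)
    (hq : 0 < q) (hK₁ : 0 < K₁) (hb₀ : 0 < b₀) (hδ : 0 < δ) (hδ1 : δ ≤ 1) (hσ : 0 < σ) (hr : 0 < r)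
    (ha : 0 < a) (hk : 0 < k) (hD : 0 ≤ D) (hS : 0 ≤ S) (hV : 0 ≤ V) (hν : ν = a * k)
    (hkτ : k ^ (2 - p) = 4 * (b₀ ^ p * (K₁ * ((2 - p) / p) / 4) ^ (1 - p)) * (1 / q + 2)
      * (δ * σ) ^ (-p) * (a ^ (p - 1) * (τ / r ^ p)))
    (h₁ : K₁ * E ≤ ν ^ (-((2 - p) / p)) * (S + b₀ / (σ * r) * D))
    (h₂ : ∀ lam, 0 < lam → D ≤ lam * E + lam ^ (1 - p) * ((2 - p) / p) ^ (1 - p)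
      * ν ^ (2 * (p - 1) / p - 1) * (τ * (a / q * S + 2 * ν * V))) :
    b₀ / (σ * r) * D ≤ δ * (S + k * V) := by
  set κ := (2 - p) / p with hκ
  have hp0 : 0 < p := by linarith
  have hκ0 : 0 < κ := div_pos (by linarith) hp0
  have hν0 : 0 < ν := by rw [hν]; positivity
  set b := b₀ / (σ * r) with hb
  have hb0 : 0 < b := by positivity
  -- Chosen so that the energy inequality makes b λ E at most δ/4 of S + b D.
  set lam := δ * K₁ * ν ^ κ / (4 * b) with hlam
  have hlam0 : 0 < lam := by positivity
  have hD1 := h₂ lam hlam0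
  have t1 : b * (lam * E) ≤ δ / 4 * (S + b * D) := by
    have : b * (lam * E) = δ / 4 * ν ^ κ * (K₁ * E) := by
      rw [hlam]; field_simp
    rw [this]
    calc δ / 4 * ν ^ κ * (K₁ * E) ≤ δ / 4 * ν ^ κ * (ν ^ (-κ) * (S + b * D)) := by gcongr
      _ = δ / 4 * (ν ^ κ * ν ^ (-κ)) * (S + b * D) := by ring
      _ = δ / 4 * (S + b * D) := by
          rw [← Real.rpow_add hν0, add_neg_cancel, Real.rpow_zero, mul_one]
  set C₁ := b₀ ^ p * (K₁ * κ / 4) ^ (1 - p) with hC₁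
  have hC₁0 : 0 < C₁ := by positivity
  have t2 : b * (lam ^ (1 - p) * κ ^ (1 - p) * ν ^ (2 * (p - 1) / p - 1)
      * (τ * (a / q * S + 2 * ν * V))) = δ / (4 * (1 / q + 2)) * (S / q + 2 * k * V) := by
    have e1 : lam ^ (1 - p) = δ ^ (1 - p) * K₁ ^ (1 - p) * ν ^ (κ * (1 - p))
        * (4 ^ (1 - p))⁻¹ * b ^ (p - 1) := by
      rw [hlam, Real.div_rpow (by positivity) (by positivity), Real.mul_rpow (by positivity)
        (by positivity), Real.mul_rpow hδ.le hK₁.le, ← Real.rpow_mul hν0.le,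
        Real.mul_rpow (by positivity) hb0.le, show p - 1 = -(1 - p) by ring, Real.rpow_neg hb0.le]
      field_simp
    -- The two exponents of ν sum to p - 2, so the remainder carries k^(-(2-p)); the choice of
    -- k^(2-p) cancels it against the geometric factors.
    have e2 : ν ^ (κ * (1 - p)) * ν ^ (2 * (p - 1) / p - 1) = a ^ (p - 1) / a * (k ^ (2 - p))⁻¹ := by
      rw [← Real.rpow_add hν0, show κ * (1 - p) + (2 * (p - 1) / p - 1) = p - 1 - 1 by
        rw [hκ]; field_simp; ring, hν, Real.mul_rpow ha.le hk.le, Real.rpow_sub_one ha.ne' (p - 1),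
        ← Real.rpow_neg hk.le]
      ring_nf
    have e3 : b * b ^ (p - 1) = b₀ ^ p * (σ ^ p)⁻¹ * (r ^ p)⁻¹ := by
      rw [Real.rpow_sub_one hb0.ne', mul_div_cancel₀ _ hb0.ne', hb, Real.div_rpow hb₀.le
        (by positivity), Real.mul_rpow hσ.le hr.le]
      field_simp
    have e4 : δ ^ (1 - p) = δ * (δ ^ p)⁻¹ := by
      rw [Real.rpow_sub hδ, Real.rpow_one]; rfl
    have e5 : C₁ = b₀ ^ p * (K₁ ^ (1 - p) * κ ^ (1 - p) * (4 ^ (1 - p))⁻¹) := by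
      rw [hC₁, Real.div_rpow (by positivity) (by norm_num), Real.mul_rpow hK₁.le hκ0.le]; rfl
    have e6 : (δ * σ) ^ (-p) = (δ ^ p)⁻¹ * (σ ^ p)⁻¹ := by
      rw [Real.rpow_neg (by positivity), Real.mul_rpow hδ.le hσ.le, mul_inv]
    have hk2 : 0 < k ^ (2 - p) := by positivity
    have e7 : a / q * S + 2 * ν * V = a * (S / q + 2 * k * V) := by
      rw [hν]; field_simp
    calc b * (lam ^ (1 - p) * κ ^ (1 - p) * ν ^ (2 * (p - 1) / p - 1)
          * (τ * (a / q * S + 2 * ν * V)))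
        = (b * b ^ (p - 1)) * δ ^ (1 - p) * (K₁ ^ (1 - p) * κ ^ (1 - p) * (4 ^ (1 - p))⁻¹)
          * (ν ^ (κ * (1 - p)) * ν ^ (2 * (p - 1) / p - 1)) * τ
          * (a / q * S + 2 * ν * V) := by rw [e1]; ring
      _ = δ * (C₁ * ((δ ^ p)⁻¹ * (σ ^ p)⁻¹) * (a ^ (p - 1) * (τ / r ^ p)))
          * (k ^ (2 - p))⁻¹ * (S / q + 2 * k * V) := by
          rw [e2, e3, e4, e7, e5]; field_simp
      _ = δ * (k ^ (2 - p) / (4 * (1 / q + 2))) * (k ^ (2 - p))⁻¹ * (S / q + 2 * k * V) := by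
          rw [hkτ, e6]; congr 3; field_simp
      _ = _ := by field_simp
  have t3 : δ / (4 * (1 / q + 2)) * (S / q + 2 * k * V) ≤ δ / 4 * (S + k * V) := by
    have h3 : S / q + 2 * k * V ≤ (1 / q + 2) * (S + k * V) := by
      have : 0 ≤ 1 / q * (k * V) := by positivity
      have h4 : S / q = 1 / q * S := by ring
      nlinarith
    calc δ / (4 * (1 / q + 2)) * (S / q + 2 * k * V)
        ≤ δ / (4 * (1 / q + 2)) * ((1 / q + 2) * (S + k * V)) := by gcongr
      _ = _ := by field_simp
  have t4 : b * D ≤ δ / 4 * (S + b * D) + δ / 4 * (S + k * V) := by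
    calc b * D ≤ b * (lam * E + lam ^ (1 - p) * κ ^ (1 - p)
      * ν ^ (2 * (p - 1) / p - 1) * (τ * (a / q * S + 2 * ν * V))) := by gcongr
      _ = b * (lam * E) + b * (lam ^ (1 - p) * κ ^ (1 - p)
      * ν ^ (2 * (p - 1) / p - 1) * (τ * (a / q * S + 2 * ν * V))) := by ring
      _ ≤ _ := by rw [t2]; exact add_le_add t1 t3
  have hbD : 0 ≤ b * D := by positivity
  have hkV : 0 ≤ k * V := by positivity
  -- As δ ≤ 1, the term (δ/4) b D on the right is absorbed on the left, and the factors 1/4 leave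
  -- room for the loss.
  nlinarith [mul_nonneg hδ.le hkV, mul_nonneg hδ.le hS, mul_le_mul_of_nonneg_right hδ1 hbD]

end DNL

/-! ### Energy and interpolation bounds for the flux -/

namespace DNL
open Filter Topology
open scoped ENNReal Gradient

theorem hasGradientAt_rpow {N : ℕ} {ζ : Space N → ℝ} (hζ : ContDiff ℝ 1 ζ) {l : ℝ} (hl : 1 ≤ l)
    (x : Space N) : HasGradientAt (fun x => ζ x ^ l) ((l * ζ x ^ (l - 1)) • ∇ ζ x) x := by
  have h1 := ((hζ.differentiable one_ne_zero x).hasGradientAt)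
  rw [hasGradientAt_iff_hasFDerivAt] at *
  refine (h1.rpow_const (Or.inr hl)).congr_fderiv ?_
  simp

theorem tsupport_rpow_subset {N : ℕ} (ζ : Space N → ℝ) {l : ℝ} (hl : 0 < l) :
    tsupport (fun x => ζ x ^ l) ⊆ tsupport ζ := by
  refine closure_mono fun x hx h0 => hx ?_
  simp only [h0, Real.zero_rpow hl.ne']

theorem integrable_norm_rpow_mul {N : ℕ} {p l : ℝ} (hp : 1 < p) (hl : 1 ≤ l)
    {Q : Set (Space N × ℝ)} [IsFiniteMeasure ((volume : Measure (Space N × ℝ)).restrict Q)]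
    {Du : Space N → ℝ → Space N}
    (hDu : MemLp (fun z : Space N × ℝ => Du z.1 z.2) (ENNReal.ofReal p) (volume.restrict Q))
    {ζ : Space N → ℝ} (hζ : Continuous ζ) (hζ0 : ∀ x, 0 ≤ ζ x) (hζ1 : ∀ x, ζ x ≤ 1) :
    Integrable (fun z : Space N × ℝ => ‖Du z.1 z.2‖ ^ (p - 1) * ζ z.1 ^ (l - 1))
      (volume.restrict Q) := by
  have hp0 : 0 < p := by linarith
  have hDp := hDu.integrable_norm_rpow (by simpa using hp0) ENNReal.ofReal_ne_top
  rw [ENNReal.toReal_ofReal hp0.le] at hDp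
  have hζc : Continuous fun z : Space N × ℝ => ζ z.1 := hζ.comp continuous_fst
  refine (hDp.add (integrable_const 1)).mono' ?_ (ae_of_all _ fun z => ?_)
  · exact (hDu.1.norm.aemeasurable.pow_const _).aestronglyMeasurable.mul
      (hζc.measurable.pow_const _).aestronglyMeasurable
  · have hX : 0 ≤ ‖Du z.1 z.2‖ := norm_nonneg _
    have hζz := hζ0 z.1
    rw [Real.norm_of_nonneg (by positivity)]
    have h3 : ‖Du z.1 z.2‖ ^ (p - 1) ≤ ‖Du z.1 z.2‖ ^ p + 1 := by
      rcases le_total 1 ‖Du z.1 z.2‖ with h | h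
      · have := Real.rpow_le_rpow_of_exponent_le h (show p - 1 ≤ p by linarith)
        linarith
      · have := Real.rpow_le_one hX h (show 0 ≤ p - 1 by linarith)
        have : 0 ≤ ‖Du z.1 z.2‖ ^ p := by positivity
        linarith
    calc _ ≤ ‖Du z.1 z.2‖ ^ (p - 1) * 1 := by
          gcongr; exact Real.rpow_le_one (hζ0 _) (hζ1 _) (by linarith)
      _ ≤ _ := by simpa using h3

/-- The energy inequality and the interpolation inequality for the flux. -/
theorem exists_energy_bounds {N : ℕ} {p q K₁ K₂ l C : ℝ} (hp : 1 < p) (hp2 : p < 2) (hq : 0 < q)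
    (hq1 : q < 1) (hK₂ : 0 < K₂) (hl : 2 * p ^ 2 / (2 - p) ≤ l) (hC : 0 ≤ C)
    {Ω : Set (Space N)} (hΩ : IsOpen Ω) {T : ℝ} {A : Space N → ℝ → ℝ → Space N → Space N}
    (hA : IsAdmissibleField p K₁ K₂ Ω T A)
    {u : Space N → ℝ → ℝ} {Du : Space N → ℝ → Space N}
    (hsub : IsLocalWeakSubsolution p q Ω T A u Du) (hsup : IsLocalWeakSupersolution p q Ω T A u Du)
    {y : Space N} {r₁ r₂ : ℝ} (hr₁ : 0 < r₁) (hr : r₁ < r₂) (hKΩ : Metric.closedBall y r₂ ⊆ Ω)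
    {s t : ℝ} (hst : s < t) (hI : Set.Ioo s t ⊆ Set.Ioo 0 T) {μm μp M : ℝ} (hM : 0 < M)
    (hMm : -M ≤ μm) (hMp : μp ≤ M)
    (hb : ∀ᵐ z : Space N × ℝ ∂(volume.restrict (Metric.closedBall y r₂ ×ˢ Set.Ioo s t)),
      μm ≤ u z.1 z.2 ∧ u z.1 z.2 ≤ μp)
    {ζ : Space N → ℝ} (hζ : ContDiff ℝ 1 ζ) (hζ0 : ∀ x, 0 ≤ ζ x) (hζ1 : ∀ x, ζ x ≤ 1)
    (hζC : ∀ x, ‖∇ ζ x‖ ≤ C) (hζs : tsupport ζ ⊆ Metric.closedBall y r₁) {S : ℝ}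
    (hS : ∀ τ ∈ Set.Icc s t ∩ Set.Ioo 0 T,
      ∫ x in Metric.closedBall y r₂, deficit q μp u x τ * ζ x ^ l ≤ S)
    {t₁ t₂ : ℝ} (h₁ : s < t₁) (h₁₂ : t₁ < t₂) (h₂ : t₂ ≤ t) (h₂T : t₂ < T) {ν : ℝ} (hν : 0 < ν) :
    ∃ E : ℝ,
      K₁ * E ≤ ν ^ (-((2 - p) / p)) * (S + K₂ * (l * C) *
        ∫ z in Metric.closedBall y r₂ ×ˢ Set.Icc t₁ t₂, ‖Du z.1 z.2‖ ^ (p - 1) * ζ z.1 ^ (l - 1)) ∧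
      ∀ lam, 0 < lam →
        ∫ z in Metric.closedBall y r₂ ×ˢ Set.Icc t₁ t₂, ‖Du z.1 z.2‖ ^ (p - 1) * ζ z.1 ^ (l - 1)
          ≤ lam * E + lam ^ (1 - p) * ((2 - p) / p) ^ (1 - p) * ν ^ (2 * (p - 1) / p - 1) *
            ((t₂ - t₁) * (M ^ (1 - q) / q * S
              + 2 * ν * volume.real (Metric.closedBall y r₂))) := by
  set K := Metric.closedBall y r₂ with hKdef
  set κ := (2 - p) / p with hκ
  set θ := 2 * (p - 1) / p with hθ
  have hp0 : 0 < p := by linarith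
  have hκ0 : 0 < κ := div_pos (by linarith) hp0
  have h2p : 0 < 2 - p := by linarith
  -- The only role of the lower bound on l: with θ = 1 - κ it yields p < l and l θ ≤ l - p.
  have hlp : 2 * p ≤ l * κ := by
    rw [div_le_iff₀ h2p] at hl
    rw [hκ, mul_div_assoc', le_div_iff₀ hp0]; nlinarith
  have hκ1 : κ < 1 := by rw [hκ, div_lt_one hp0]; linarith
  have hlp2 : p < l := by
    by_contra! h
    nlinarith
  have hl0 : 0 < l := by linarith
  have hθ0 : 0 ≤ θ := by rw [hθ]; exact div_nonneg (by linarith) hp0.le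
  have hθκ : θ = 1 - κ := by rw [hθ, hκ]; field_simp; ring
  have hθ1 : θ ≤ 1 := by linarith
  have hlθ : l * θ ≤ l - p := by rw [hθκ]; nlinarith
  have hK : IsCompact K := isCompact_closedBall _ _
  have hKm : MeasurableSet K := hK.measurableSet
  have hs0 : 0 ≤ s := nonneg_of_Ioo_subset hst hI
  have ht₁ : 0 < t₁ := hs0.trans_lt h₁
  have hfinK : IsFiniteMeasure (volume.restrict K) := ⟨by simpa using hK.measure_lt_top⟩
  set Q : Set (Space N × ℝ) := K ×ˢ Set.Icc t₁ t₂ with hQ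
  have hQm : MeasurableSet Q := hKm.prod measurableSet_Icc
  have hfin : IsFiniteMeasure ((volume : Measure (Space N × ℝ)).restrict Q) :=
    ⟨by simpa using (hK.prod isCompact_Icc).measure_lt_top⟩
  have hQΩ : Q ⊆ Ω ×ˢ Set.Ioo 0 T := prod_Icc_subset hKΩ ht₁ h₂T
  set Z : Space N → ℝ := fun x => ζ x ^ l with hZdef
  have hZ : ContDiff ℝ 1 Z := hζ.rpow_const_of_le (by norm_num; linarith)
  have hZ0 : ∀ x, 0 ≤ Z x := fun x => Real.rpow_nonneg (hζ0 x) _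
  have hZ1 : ∀ x, Z x ≤ 1 := fun x => Real.rpow_le_one (hζ0 x) (hζ1 x) hl0.le
  have hZs : tsupport Z ⊆ Metric.closedBall y r₁ := (tsupport_rpow_subset ζ hl0).trans hζs
  obtain ⟨hint, hen⟩ := neg_le_integral_flux_inner hp hq hΩ hA hsub hsup hr₁ hr hKΩ hst hI hb
    (f := fun h => ν ^ (-κ) - (h + ν) ^ (-κ))
    (measurable_const.sub ((measurable_id.add_const ν).pow_const _))
    (fun a ha => powerDeficit_contDiffAt κ hν ha) (powerDeficit_monotoneOn hκ0 hν)
    (fun a ha => (powerDeficit_bounds hκ0 hν ha).1) (fun a ha => (powerDeficit_bounds hκ0 hν ha).2)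
    hZ hZ0 hZs hS h₁ h₁₂ h₂ h₂T
  -- pointwise bounds
  have hslice : ∀ᵐ z : Space N × ℝ ∂(volume.restrict Q), μm ≤ u z.1 z.2 ∧ u z.1 z.2 ≤ μp :=
    ae_restrict_prod_Icc_of_Ioo h₁ h₂ hb
  have hDu := (hsub.2.1.memLp K hK hKΩ t₁ t₂ ht₁ h₁₂ h₂T).2
  have hDp : Integrable (fun z : Space N × ℝ => ‖Du z.1 z.2‖ ^ p) (volume.restrict Q) := by
    have := hDu.integrable_norm_rpow (by simpa using hp0) ENNReal.ofReal_ne_top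
    rwa [ENNReal.toReal_ofReal hp0.le] at this
  have hζc : Continuous fun z : Space N × ℝ => ζ z.1 := hζ.continuous.comp continuous_fst
  have hum : AEStronglyMeasurable (fun z : Space N × ℝ => u z.1 z.2) (volume.restrict Q) :=
    hsub.2.1.measurable.mono_set hQΩ
  have hDi := integrable_norm_rpow_mul hp (show 1 ≤ l by linarith) hDu hζ.continuous hζ0 hζ1
  have hEi : Integrable (fun z : Space N × ℝ => (κ * (μp - u z.1 z.2 + ν) ^ (-κ - 1)) *
      (‖Du z.1 z.2‖ ^ p * ζ z.1 ^ l)) (volume.restrict Q) := by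
    have hm1 : AEStronglyMeasurable (fun z : Space N × ℝ => κ * (μp - u z.1 z.2 + ν) ^ (-κ - 1))
        (volume.restrict Q) :=
      ((((hum.aemeasurable.const_sub μp).add_const ν).pow_const _).const_mul κ).aestronglyMeasurable
    have hm2 : Integrable (fun z : Space N × ℝ => ‖Du z.1 z.2‖ ^ p * ζ z.1 ^ l)
        (volume.restrict Q) := by
      refine hDp.mul_bdd (c := 1) (hζc.measurable.pow_const _).aestronglyMeasurable
        (ae_of_all _ fun z => ?_)
      rw [Real.norm_of_nonneg (hZ0 z.1)]; exact hZ1 z.1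
    refine hm2.bdd_mul (c := κ * ν ^ (-κ - 1)) hm1 ?_
    filter_upwards [hslice] with z hz
    have h3 : 0 < μp - u z.1 z.2 + ν := by linarith [hz.2]
    rw [Real.norm_of_nonneg (by positivity)]
    gcongr ?_ * ?_
    exact Real.rpow_le_rpow_of_nonpos hν (by linarith [hz.2]) (by linarith)
  have hmass : Integrable (fun z : Space N × ℝ => deficit q μp u z.1 z.2 * ζ z.1 ^ l)
      (volume.restrict Q) := by
    refine Integrable.of_bound ?_ (spow q μp - spow q μm) ?_
    · exact (((measurable_spow q).comp_aemeasurable hum.aemeasurable).const_sub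
        _).aestronglyMeasurable.mul (hζc.measurable.pow_const _).aestronglyMeasurable
    · filter_upwards [hslice] with z hz
      have h3 := deficit_bounds hq hz
      rw [Real.norm_of_nonneg (mul_nonneg h3.1 (hZ0 z.1))]
      exact (mul_le_of_le_one_right h3.1 (hZ1 z.1)).trans h3.2
  have hmassle : ∫ z in Q, deficit q μp u z.1 z.2 * ζ z.1 ^ l ≤ (t₂ - t₁) * S := by
    have hmass' := hmass
    rw [hQ, volume_prod_restrict] at hmass' ⊢
    rw [integral_prod_symm _ hmass']
    calc _ ≤ ∫ _ in Set.Icc t₁ t₂, S := by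
          refine setIntegral_mono_on hmass'.integral_prod_right (integrable_const _)
            measurableSet_Icc fun τ hτ => ?_
          exact hS τ ⟨⟨h₁.le.trans hτ.1, hτ.2.trans h₂⟩, ht₁.trans_le hτ.1, hτ.2.trans_lt h₂T⟩
      _ = _ := by rw [setIntegral_const, Real.volume_real_Icc_of_le h₁₂.le, smul_eq_mul]
  refine ⟨∫ z in Q, (κ * (μp - u z.1 z.2 + ν) ^ (-κ - 1)) * (‖Du z.1 z.2‖ ^ p * ζ z.1 ^ l), ?_, ?_⟩
  -- Coercivity acts on the term with f', where the gradient is -Du and produces -K₁ E; growth and f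
  -- ≤ ν^(-κ) control the term with the gradient of ζ^l.
  · have h3 : ∫ z in Q, inner ℝ (A z.1 z.2 (u z.1 z.2) (Du z.1 z.2))
        ((deriv (fun h => ν ^ (-κ) - (h + ν) ^ (-κ)) (μp - u z.1 z.2) * Z z.1) • (-Du z.1 z.2) +
          (ν ^ (-κ) - (μp - u z.1 z.2 + ν) ^ (-κ)) • ∇ Z z.1)
        ≤ ∫ z in Q, (-K₁ * ((κ * (μp - u z.1 z.2 + ν) ^ (-κ - 1)) *
            (‖Du z.1 z.2‖ ^ p * ζ z.1 ^ l)) + ν ^ (-κ) * (K₂ * (l * C)) *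
            (‖Du z.1 z.2‖ ^ (p - 1) * ζ z.1 ^ (l - 1))) := by
      refine integral_mono_ae hint ((hEi.const_mul _).add (hDi.const_mul _)) ?_
      filter_upwards [hslice, ae_mono (Measure.restrict_mono hQΩ le_rfl) hA.coercive,
        ae_mono (Measure.restrict_mono hQΩ le_rfl) hA.growth] with z hz hco hgr
      have hh : 0 ≤ μp - u z.1 z.2 := by linarith [hz.2]
      have hfb := powerDeficit_bounds hκ0 hν hh
      rw [powerDeficit_deriv κ hν hh, (hasGradientAt_rpow hζ (by linarith) z.1).gradient,
        inner_add_right, inner_smul_right, inner_neg_right, inner_smul_right]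
      have hco' := hco (u z.1 z.2) (Du z.1 z.2)
      have hgr' := hgr (u z.1 z.2) (Du z.1 z.2)
      set a := A z.1 z.2 (u z.1 z.2) (Du z.1 z.2)
      have hm0 : 0 ≤ κ * (μp - u z.1 z.2 + ν) ^ (-κ - 1) := by positivity
      have hζz := hζ0 z.1
      refine add_le_add ?_ ?_
      · have := mul_le_mul_of_nonneg_left hco' (mul_nonneg hm0 (hZ0 z.1))
        simp only [hZdef] at *
        linarith
      · have h4 : inner ℝ a ((l * ζ z.1 ^ (l - 1)) • ∇ ζ z.1) ≤
            K₂ * (l * C) * (‖Du z.1 z.2‖ ^ (p - 1) * ζ z.1 ^ (l - 1)) := by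
          refine (real_inner_le_norm _ _).trans ?_
          rw [norm_smul, Real.norm_of_nonneg (by positivity)]
          calc ‖a‖ * (l * ζ z.1 ^ (l - 1) * ‖∇ ζ z.1‖)
              ≤ (K₂ * ‖Du z.1 z.2‖ ^ (p - 1)) * (l * ζ z.1 ^ (l - 1) * C) := by
                gcongr; exact hζC _
            _ = _ := by ring
        have h5 : 0 ≤ K₂ * (l * C) * (‖Du z.1 z.2‖ ^ (p - 1) * ζ z.1 ^ (l - 1)) := by positivity
        calc _ ≤ (ν ^ (-κ) - (μp - u z.1 z.2 + ν) ^ (-κ)) *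
              (K₂ * (l * C) * (‖Du z.1 z.2‖ ^ (p - 1) * ζ z.1 ^ (l - 1))) :=
              mul_le_mul_of_nonneg_left h4 hfb.1
          _ ≤ ν ^ (-κ) * (K₂ * (l * C) * (‖Du z.1 z.2‖ ^ (p - 1) * ζ z.1 ^ (l - 1))) :=
              mul_le_mul_of_nonneg_right hfb.2 h5
          _ = _ := by ring
    have h4 := hen.trans h3
    rw [integral_add (hEi.const_mul _) (hDi.const_mul _), integral_const_mul,
      integral_const_mul] at h4
    linarith
  · intro lam hlam
    have h3 : ∫ z in Q, ‖Du z.1 z.2‖ ^ (p - 1) * ζ z.1 ^ (l - 1) ≤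
        ∫ z in Q, (lam * ((κ * (μp - u z.1 z.2 + ν) ^ (-κ - 1)) *
            (‖Du z.1 z.2‖ ^ p * ζ z.1 ^ l)) + lam ^ (1 - p) * κ ^ (1 - p) * ν ^ (θ - 1) *
            (M ^ (1 - q) / q * (deficit q μp u z.1 z.2 * ζ z.1 ^ l) + 2 * ν)) := by
      refine integral_mono_ae hDi ((hEi.const_mul _).add
        (((hmass.const_mul _).add (integrable_const _)).const_mul _)) ?_
      filter_upwards [hslice] with z hz
      have hh : 0 ≤ μp - u z.1 z.2 := by linarith [hz.2]
      have hhν : 0 < μp - u z.1 z.2 + ν := by linarith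
      have hm0 : 0 < κ * (μp - u z.1 z.2 + ν) ^ (-κ - 1) := by positivity
      -- Young's inequality with λ f'(h) as parameter, so that its first term is exactly λ times the
      -- integrand of E.
      have hy := rpow_mul_rpow_le_young hp hlp2 (norm_nonneg (Du z.1 z.2)) (hζ0 z.1)
        (mul_pos hlam hm0)
      have hm1 : (lam * (κ * (μp - u z.1 z.2 + ν) ^ (-κ - 1))) ^ (1 - p)
          = lam ^ (1 - p) * κ ^ (1 - p) * (μp - u z.1 z.2 + ν) ^ θ := by
        rw [Real.mul_rpow hlam.le hm0.le, Real.mul_rpow hκ0.le (by positivity),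
          ← Real.rpow_mul hhν.le, show (-κ - 1) * (1 - p) = θ by rw [hθ, hκ]; field_simp; ring,
          mul_assoc]
      have hlin := rpow_mul_rpow_le_linear hθ0 hθ1 hl0.le hlθ hh hν (hζ0 z.1) (hζ1 z.1)
      -- The source of the factor M^(1-q): on [-M, M] the signed power expands distances by at least
      -- q M^(q-1).
      have hdef : μp - u z.1 z.2 ≤ M ^ (1 - q) / q * deficit q μp u z.1 z.2 := by
        have h5 := mul_sub_le_spow_sub_spow hq hq1.le (hMm.trans hz.1) hz.2 hMp
        have hMq : 0 < M ^ (1 - q) := by positivity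
        rw [div_mul_eq_mul_div, le_div_iff₀ hq]
        have h6 : M ^ (1 - q) * M ^ (q - 1) = 1 := by
          rw [← Real.rpow_add hM]; simp
        calc (μp - u z.1 z.2) * q = M ^ (1 - q) * (q * M ^ (q - 1) * (μp - u z.1 z.2)) := by
              linear_combination (-(μp - u z.1 z.2) * q) * h6
          _ ≤ _ := mul_le_mul_of_nonneg_left h5 hMq.le
      have hZz := hZ0 z.1
      simp only [hZdef] at hZz
      calc _ ≤ _ := hy
        _ ≤ _ := by
          rw [hm1, mul_assoc lam]
          refine add_le_add le_rfl ?_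
          calc lam ^ (1 - p) * κ ^ (1 - p) * (μp - u z.1 z.2 + ν) ^ θ * ζ z.1 ^ (l - p)
              = lam ^ (1 - p) * κ ^ (1 - p) * ((μp - u z.1 z.2 + ν) ^ θ * ζ z.1 ^ (l - p)) := by ring
            _ ≤ lam ^ (1 - p) * κ ^ (1 - p) * (ν ^ (θ - 1) *
                ((μp - u z.1 z.2) * ζ z.1 ^ l + 2 * ν)) := by gcongr
            _ ≤ lam ^ (1 - p) * κ ^ (1 - p) * (ν ^ (θ - 1) *
                ((M ^ (1 - q) / q * deficit q μp u z.1 z.2) * ζ z.1 ^ l + 2 * ν)) := by gcongr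
            _ = _ := by ring
    have i₅ : Integrable (fun z : Space N × ℝ => M ^ (1 - q) / q *
        (deficit q μp u z.1 z.2 * ζ z.1 ^ l) + 2 * ν) (volume.restrict Q) :=
      (hmass.const_mul _).add (integrable_const _)
    refine h3.trans ?_
    rw [integral_add (hEi.const_mul _) (i₅.const_mul _), integral_const_mul, integral_const_mul,
      integral_add (hmass.const_mul _) (integrable_const _), integral_const_mul, setIntegral_const,
      show (volume : Measure (Space N × ℝ)).real Q = volume.real K * (t₂ - t₁) by
        rw [← Real.volume_real_Icc_of_le h₁₂.le]
        exact measureReal_prod_prod K _, smul_eq_mul]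
    have h4 : M ^ (1 - q) / q * ∫ z in Q, deficit q μp u z.1 z.2 * ζ z.1 ^ l
        ≤ M ^ (1 - q) / q * ((t₂ - t₁) * S) := by gcongr
    gcongr
    linarith

end DNL

/-! ### Oscillation of the mass in time -/

namespace DNL
open Filter Topology
open scoped ENNReal Gradient

/-- Integrals over closed time intervals are controlled by those over smaller ones. -/
theorem setIntegral_prod_Icc_le_of_forall {N : ℕ} {K : Set (Space N)} (hK : MeasurableSet K)
    {t₁ t₂ c : ℝ} (h₁₂ : t₁ < t₂) {F : Space N × ℝ → ℝ} (hF : IntegrableOn F (K ×ˢ Set.Icc t₁ t₂))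
    (h : ∀ t', t₁ < t' → t' < t₂ → ∫ z in K ×ˢ Set.Icc t' t₂, F z ≤ c) :
    ∫ z in K ×ˢ Set.Icc t₁ t₂, F z ≤ c := by
  set τ : ℕ → ℝ := fun n => t₁ + (t₂ - t₁) / (n + 2) with hτ
  have hd : 0 < t₂ - t₁ := by linarith
  have hτ1 : ∀ n, t₁ < τ n := fun n => by
    have : 0 < (t₂ - t₁) / ((n : ℝ) + 2) := by positivity
    simp only [hτ]; linarith
  have hτ2 : ∀ n, τ n < t₂ := fun n => by
    have : (t₂ - t₁) / ((n : ℝ) + 2) < t₂ - t₁ :=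
      div_lt_self hd (by linarith [n.cast_nonneg (α := ℝ)])
    simp only [hτ]; linarith
  have hτa : Antitone τ := fun m n hmn => by
    simp only [hτ]; gcongr
  have hτl : Tendsto τ atTop (𝓝 t₁) := by
    have h1 : Tendsto (fun n : ℕ => (t₂ - t₁) / ((n : ℝ) + 2)) atTop (𝓝 0) :=
      Tendsto.div_atTop tendsto_const_nhds
        (tendsto_atTop_add_const_right _ _ tendsto_natCast_atTop_atTop)
    simpa using h1.const_add t₁
  have hU : ⋃ n, K ×ˢ Set.Icc (τ n) t₂ = K ×ˢ Set.Ioc t₁ t₂ := by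
    rw [← Set.prod_iUnion]
    congr 1
    ext v
    simp only [Set.mem_iUnion, Set.mem_Icc, Set.mem_Ioc]
    constructor
    · rintro ⟨n, h1, h2⟩
      exact ⟨(hτ1 n).trans_le h1, h2⟩
    · rintro ⟨h1, h2⟩
      obtain ⟨n, hn⟩ := ((tendsto_order.1 hτl).2 v h1).exists
      exact ⟨n, hn.le, h2⟩
  have hlim := tendsto_setIntegral_of_monotone (μ := volume) (f := F)
    (s := fun n => K ×ˢ Set.Icc (τ n) t₂) (fun n => hK.prod measurableSet_Icc)
    (fun m n hmn => Set.prod_mono le_rfl (Set.Icc_subset_Icc (hτa hmn) le_rfl))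
    (by rw [hU]; exact hF.mono_set (Set.prod_mono le_rfl Set.Ioc_subset_Icc_self))
  have hae : (K ×ˢ Set.Ioc t₁ t₂ : Set (Space N × ℝ)) =ᵐ[volume]
      (K ×ˢ Set.Icc t₁ t₂ : Set (Space N × ℝ)) :=
    Measure.set_prod_ae_eq (μ := (volume : Measure (Space N))) (ν := (volume : Measure ℝ))
      (ae_eq_refl K) Ioc_ae_eq_Icc
  rw [hU, setIntegral_congr_set hae] at hlim
  exact le_of_tendsto' hlim fun n => h _ (hτ1 n) (hτ2 n)

/-- The constant in the bound for the oscillation of the mass. -/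
noncomputable def massConst (p q K₁ b₀ : ℝ) : ℝ :=
  4 * (b₀ ^ p * (K₁ * ((2 - p) / p) / 4) ^ (1 - p)) * (1 / q + 2)

/-- The weighted mass varies in time by at most a small multiple of its supremum. -/
theorem abs_mass_sub_le {N : ℕ} {p q K₁ K₂ l c σ r δ k : ℝ} (hp : 1 < p) (hp2 : p < 2) (hq : 0 < q)
    (hq1 : q < 1) (hK₁ : 0 < K₁) (hK₂ : 0 < K₂) (hl : 2 * p ^ 2 / (2 - p) ≤ l) (hc : 0 < c)
    (hσ : 0 < σ) (hr0 : 0 < r) (hδ : 0 < δ) (hδ1 : δ ≤ 1) (hk : 0 < k)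
    {Ω : Set (Space N)} (hΩ : IsOpen Ω) {T : ℝ} {A : Space N → ℝ → ℝ → Space N → Space N}
    (hA : IsAdmissibleField p K₁ K₂ Ω T A)
    {u : Space N → ℝ → ℝ} {Du : Space N → ℝ → Space N}
    (hsub : IsLocalWeakSubsolution p q Ω T A u Du) (hsup : IsLocalWeakSupersolution p q Ω T A u Du)
    {y : Space N} {r₁ r₂ : ℝ} (hr₁ : 0 < r₁) (hr : r₁ < r₂) (hKΩ : Metric.closedBall y r₂ ⊆ Ω)
    {s t : ℝ} (hst : s < t) (hI : Set.Ioo s t ⊆ Set.Ioo 0 T) {μm μp M : ℝ} (hM : 0 < M)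
    (hMm : -M ≤ μm) (hMp : μp ≤ M)
    (hb : ∀ᵐ z : Space N × ℝ ∂(volume.restrict (Metric.closedBall y r₂ ×ˢ Set.Ioo s t)),
      μm ≤ u z.1 z.2 ∧ u z.1 z.2 ≤ μp)
    {ζ : Space N → ℝ} (hζ : IsCutoff c σ r y ζ) (hζs : tsupport ζ ⊆ Metric.closedBall y r₁) {S : ℝ}
    (hS0 : 0 ≤ S) (hS : ∀ τ ∈ Set.Icc s t ∩ Set.Ioo 0 T,
      ∫ x in Metric.closedBall y r₂, deficit q μp u x τ * ζ x ^ l ≤ S)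
    (hkτ : k ^ (2 - p) = massConst p q K₁ (K₂ * l * c) * (δ * σ) ^ (-p) *
      ((M ^ (1 - q)) ^ (p - 1) * ((t - s) / r ^ p)))
    {t₁ t₂ : ℝ} (ht₁ : t₁ ∈ Set.Icc s t ∩ Set.Ioo 0 T) (ht₂ : t₂ ∈ Set.Icc s t ∩ Set.Ioo 0 T)
    (h₁₂ : t₁ < t₂) :
    |(∫ x in Metric.closedBall y r₂, deficit q μp u x t₂ * ζ x ^ l) -
      ∫ x in Metric.closedBall y r₂, deficit q μp u x t₁ * ζ x ^ l| ≤
      δ * (S + k * volume.real (Metric.closedBall y r₂)) := by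
  set K := Metric.closedBall y r₂ with hKdef
  have hp0 : 0 < p := by linarith
  have h2p : 0 < 2 - p := by linarith
  have hlp : 1 ≤ l := by
    refine le_trans ?_ hl
    rw [le_div_iff₀ h2p]; nlinarith
  have hl0 : 0 < l := by linarith
  have hK : IsCompact K := isCompact_closedBall _ _
  have hKm : MeasurableSet K := hK.measurableSet
  have hfin : ∀ a b, IsFiniteMeasure ((volume : Measure (Space N × ℝ)).restrict
      (K ×ˢ Set.Icc a b)) := fun a b =>
    ⟨by simpa using (hK.prod isCompact_Icc).measure_lt_top⟩
  set C := c / (σ * r) with hC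
  have hC0 : 0 < C := by positivity
  have hDu := (hsub.2.1.memLp K hK hKΩ t₁ t₂ ht₁.2.1 h₁₂ ht₂.2.2).2
  have := hfin t₁ t₂
  have hDi := integrable_norm_rpow_mul hp hlp hDu hζ.contDiff.continuous hζ.nonneg hζ.le_one
  -- The energy inequality needs a starting time strictly after s, whereas t₁ = s is allowed here;
  -- the bound is uniform in t', so t' can tend to t₁.
  have hinner : ∀ t', t₁ < t' → t' < t₂ → ∫ z in K ×ˢ Set.Icc t' t₂,
      K₂ * (l * C) * (‖Du z.1 z.2‖ ^ (p - 1) * ζ z.1 ^ (l - 1)) ≤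
        δ * (S + k * volume.real K) := by
    intro t' h1 h2
    obtain ⟨E, hE1, hE2⟩ := exists_energy_bounds hp hp2 hq hq1 hK₂ hl hC0.le hΩ hA hsub hsup
      hr₁ hr hKΩ hst hI hM hMm hMp hb hζ.contDiff hζ.nonneg hζ.le_one hζ.gradient_le hζs hS
      (ht₁.1.1.trans_lt h1) h2 ht₂.1.2 ht₂.2.2 (ν := M ^ (1 - q) * k) (by positivity)
    have hD0 : 0 ≤ ∫ z in K ×ˢ Set.Icc t' t₂, ‖Du z.1 z.2‖ ^ (p - 1) * ζ z.1 ^ (l - 1) :=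
      integral_nonneg fun z => mul_nonneg (by positivity) (Real.rpow_nonneg (hζ.nonneg _) _)
    have hbC : K₂ * (l * C) = K₂ * l * c / (σ * r) := by rw [hC]; ring
    rw [integral_const_mul, hbC]
    rw [hbC] at hE1
    refine flux_le_of_energy hp hp2 hq hK₁ (by positivity) hδ hδ1 hσ hr0
      (a := M ^ (1 - q)) (τ := t - s) (by positivity) hk hD0 hS0 measureReal_nonneg rfl hkτ hE1 ?_
    intro lam hlam
    refine (hE2 lam hlam).trans ?_
    have hκ0 : 0 < (2 - p) / p := div_pos h2p hp0
    have hV : 0 ≤ volume.real K := measureReal_nonneg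
    have h3 : t₂ - t' ≤ t - s := by linarith [ht₂.1.2, ht₁.1.1]
    gcongr
  have hbound := setIntegral_prod_Icc_le_of_forall hKm h₁₂ (hDi.const_mul (K₂ * (l * C))) hinner
  set Z : Space N → ℝ := fun x => ζ x ^ l with hZdef
  have hZ : ContDiff ℝ 1 Z := hζ.contDiff.rpow_const_of_le (by norm_num; linarith)
  have hZs : tsupport Z ⊆ Metric.closedBall y r₁ := (tsupport_rpow_subset ζ hl0).trans hζs
  have hZb : ∀ x, 0 ≤ Z x ∧ Z x ≤ 1 := fun x =>
    ⟨Real.rpow_nonneg (hζ.nonneg x) _, Real.rpow_le_one (hζ.nonneg x) (hζ.le_one x) hl0.le⟩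
  have hslice : ∀ τ ∈ Set.Icc s t ∩ Set.Ioo 0 T,
      ∀ᵐ x ∂(volume.restrict K), μm ≤ u x τ ∧ u x τ ≤ μp :=
    fun τ hτ => ae_slice_bounds (by linarith) hsub.1 hK hKΩ hst hI hb hτ
  have hη : MemSobolevZero p K Z (∇ Z) := by
    have hw : HasWeakGradient Ω (fun _ => (0 : ℝ)) (fun _ => 0) :=
      ⟨(locallyIntegrable_const 0).locallyIntegrableOn _,
        (locallyIntegrable_const 0).locallyIntegrableOn _, fun _ _ _ _ => by simp⟩
    -- The cutoff alone is the case of the constant profile 1 composed with the zero function.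
    have := memSobolevZero_comp_mul hp.le hΩ hw hr₁ hr hKΩ MemLp.zero (b := 0)
      (ae_of_all _ fun x => by simp) (F := fun _ => 1) (fun a _ => contDiffAt_const) hZ hZs
    simpa using this
  have hflux := integral_flux_eq hq hsub hsup hK hKΩ ht₁.2.1 h₁₂ ht₂.2.2 hη (C := 1)
    (ae_of_all _ hZb) (hslice _ ht₁) (hslice _ ht₂)
  rw [← hflux, ← Real.norm_eq_abs]
  refine (norm_integral_le_of_norm_le (hDi.const_mul (K₂ * (l * C))) ?_).trans hbound
  filter_upwards [ae_mono (Measure.restrict_mono (prod_Icc_subset hKΩ ht₁.2.1 ht₂.2.2) le_rfl)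
    hA.growth] with z hgr
  rw [hZdef, (hasGradientAt_rpow hζ.contDiff hlp z.1).gradient]
  refine (norm_inner_le_norm _ _).trans ?_
  have hζz := hζ.nonneg z.1
  rw [norm_smul, Real.norm_of_nonneg (by positivity)]
  calc _ ≤ (K₂ * ‖Du z.1 z.2‖ ^ (p - 1)) * (l * ζ z.1 ^ (l - 1) * C) := by
        gcongr
        exacts [hgr _ _, hζ.gradient_le _]
    _ = _ := by ring

/-- The oscillation bound gives (1 - δ) sup ≤ inf + δ k; dividing by 1 - δ > 0 finishes. Absorbing
the supremum is legitimate because I is bounded. -/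
theorem supLeInf_of_oscillation {δ R k : ℝ} {J : Set ℝ} {I : ℝ → ℝ} (hJ : J.Nonempty)
    (hδ1 : δ < 1) {C : ℝ} (hI : ∀ τ ∈ J, 0 ≤ I τ ∧ I τ ≤ C)
    (hosc : ∀ τ ∈ J, ∀ τ' ∈ J, I τ - I τ' ≤ δ * (sSup (I '' J) + k))
    (hR : δ * k / (1 - δ) ≤ R) : SupLeInf δ R J I := by
  have hne : (I '' J).Nonempty := hJ.image I
  have hδ' : 0 < 1 - δ := by linarith
  refine ⟨⟨C, ?_⟩, ⟨0, ?_⟩, ?_⟩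
  · rintro _ ⟨τ, hτ, rfl⟩; exact (hI τ hτ).2
  · rintro _ ⟨τ, hτ, rfl⟩; exact (hI τ hτ).1
  · have h1 : sSup (I '' J) - δ * (sSup (I '' J) + k) ≤ sInf (I '' J) := by
      refine le_csInf hne ?_
      rintro _ ⟨τ', hτ', rfl⟩
      have : sSup (I '' J) ≤ I τ' + δ * (sSup (I '' J) + k) := by
        refine csSup_le hne ?_
        rintro _ ⟨τ, hτ, rfl⟩
        linarith [hosc τ hτ τ' hτ']
      linarith
    have h2 : sSup (I '' J) ≤ 1 / (1 - δ) * sInf (I '' J) + δ * k / (1 - δ) := by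
      rw [one_div_mul_eq_div, ← add_div, le_div_iff₀ hδ']
      linarith
    linarith

end DNL

/-! ### The estimate for the mean over the ball -/

namespace DNL
open Filter Topology
open scoped ENNReal Gradient

/-- Since ζ vanishes outside the smaller closed ball, the integral may be taken over a compact set,
on which the local hypotheses on u apply. -/
theorem meanPlus_eq {N : ℕ} {q l m : ℝ} (hl : 0 < l) {u : Space N → ℝ → ℝ} {ζ : Space N → ℝ}
    {y : Space N} {r r₂ : ℝ} (hr : r₂ < r) (hζs : tsupport ζ ⊆ Metric.closedBall y r₂) (τ : ℝ) :
    meanPlus q l m u ζ y r τ = (volume.real (Metric.ball y r))⁻¹ *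
      ∫ x in Metric.closedBall y r₂, deficit q m u x τ * ζ x ^ l := by
  rw [meanPlus, setAverage_eq, smul_eq_mul,
    setIntegral_eq_of_subset_of_forall_sdiff_eq_zero (s := Metric.closedBall y r₂)
      measurableSet_ball (Metric.closedBall_subset_ball hr)]
  · rfl
  · intro x hx
    rw [image_eq_zero_of_notMem_tsupport fun h => hx.2 (hζs h), Real.zero_rpow hl.ne', mul_zero]

/-- The estimate for `meanPlus`. -/
theorem supLeInf_meanPlus {N : ℕ} {p q K₁ K₂ l c γ : ℝ} (hq : 0 < q) (hqp : q < p - 1) (hp2 : p < 2)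
    (hK₁ : 0 < K₁) (hK₂ : 0 < K₂) (hl : 2 * p ^ 2 / (2 - p) ≤ l) (hc : 0 < c)
    (hγ₁ : massConst p q K₁ (K₂ * l * c) ^ (1 / (2 - p)) ≤ γ) (hγ₂ : p / (2 - p) ≤ γ)
    {Ω : Set (Space N)} (hΩ : IsOpen Ω) {T : ℝ} {A : Space N → ℝ → ℝ → Space N → Space N}
    (hA : IsAdmissibleField p K₁ K₂ Ω T A)
    {u : Space N → ℝ → ℝ} {Du : Space N → ℝ → Space N}
    (hsub : IsLocalWeakSubsolution p q Ω T A u Du) (hsup : IsLocalWeakSupersolution p q Ω T A u Du)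
    {y : Space N} {r s t μm μp : ℝ} (hr : 0 < r) (hst : s < t)
    (hcyl : Metric.ball y r ×ˢ Set.Ioo s t ⊆ Ω ×ˢ Set.Ioo 0 T)
    (hb : ∀ᵐ z : Space N × ℝ ∂(volume.restrict (Metric.ball y r ×ˢ Set.Ioo s t)),
      μm ≤ u z.1 z.2 ∧ u z.1 z.2 ≤ μp)
    {δ σ : ℝ} (hδ : δ ∈ Set.Ioo (0 : ℝ) 1) (hσ : σ ∈ Set.Ioo (0 : ℝ) 1)
    {ζ : Space N → ℝ} (hζ : IsCutoff c σ r y ζ) :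
    SupLeInf δ (γ / ((1 - δ) * δ ^ γ * σ ^ γ) * max μp (-μm) ^ ((1 - q) * (p - 1) / (2 - p)) *
        ((t - s) / r ^ p) ^ (1 / (2 - p)))
      (Set.Icc s t ∩ Set.Ioo 0 T) (meanPlus q l μp u ζ y r) := by
  obtain ⟨hδ0, hδ1⟩ := hδ
  obtain ⟨hσ0, hσ1⟩ := hσ
  have hp : 1 < p := by linarith
  have hq1 : q < 1 := by linarith
  have hp0 : 0 < p := by linarith
  have h2p : 0 < 2 - p := by linarith
  have hl0 : 0 < l := lt_of_lt_of_le (by positivity) hl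
  have hball : (Metric.ball y r).Nonempty := Metric.nonempty_ball.2 hr
  obtain ⟨hBΩ, hI⟩ : Metric.ball y r ⊆ Ω ∧ Set.Ioo s t ⊆ Set.Ioo 0 T := by
    rcases Set.prod_subset_prod_iff.1 hcyl with h | h | h
    · exact h
    · exact absurd h hball.ne_empty
    · exact absurd h (Set.nonempty_Ioo.2 hst).ne_empty
  have hJ : (Set.Icc s t ∩ Set.Ioo 0 T).Nonempty := by
    obtain ⟨v, hv⟩ := exists_between hst
    exact ⟨v, ⟨hv.1.le, hv.2.le⟩, hI hv⟩
  -- The closure of the ball may leave Ω, but the compact support of ζ leaves room for two radii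
  -- below r: one containing the support, the other giving the compact set to work on.
  obtain ⟨r₁, ⟨hr₁, hr₁r⟩, hζr₁⟩ := exists_pos_lt_subset_ball hr (isClosed_tsupport ζ)
    hζ.tsupport_subset
  obtain ⟨r₂, hr₁₂, hr₂⟩ := exists_between hr₁r
  have hζs := hζr₁.trans Metric.ball_subset_closedBall
  have hζs₂ := hζs.trans (Metric.closedBall_subset_closedBall hr₁₂.le)
  have hKB : Metric.closedBall y r₂ ⊆ Metric.ball y r := Metric.closedBall_subset_ball hr₂
  have hKΩ := hKB.trans hBΩ
  have hb' := ae_mono (Measure.restrict_mono (Set.prod_mono hKB (le_refl (Set.Ioo s t))) le_rfl) hb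
  set K := Metric.closedBall y r₂ with hKdef
  have hK : IsCompact K := isCompact_closedBall _ _
  have : IsFiniteMeasure (volume.restrict K) := ⟨by simpa using hK.measure_lt_top⟩
  have hslice : ∀ τ ∈ Set.Icc s t ∩ Set.Ioo 0 T,
      ∀ᵐ x ∂(volume.restrict K), μm ≤ u x τ ∧ u x τ ≤ μp :=
    fun τ hτ => ae_slice_bounds (by linarith) hsub.1 hK hKΩ hst hI hb' hτ
  have hμ : μm ≤ μp := by
    have hne : volume.restrict K ≠ 0 := by
      rw [Ne, Measure.restrict_eq_zero]
      refine ne_of_gt (lt_of_lt_of_le (Metric.measure_ball_pos volume y (hr₁.trans hr₁₂)) ?_)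
      exact measure_mono Metric.ball_subset_closedBall
    have := ae_neBot.2 hne
    obtain ⟨τ, hτ⟩ := hJ
    obtain ⟨x, hx⟩ := (hslice τ hτ).exists
    exact hx.1.trans hx.2
  set V := volume.real (Metric.ball y r) with hV
  have hV0 : 0 < V := ENNReal.toReal_pos (Metric.measure_ball_pos volume y hr).ne'
    measure_ball_lt_top.ne
  have hKV : volume.real K ≤ V := measureReal_mono hKB measure_ball_lt_top.ne
  set m : ℝ → ℝ := fun τ => ∫ x in K, deficit q μp u x τ * ζ x ^ l with hm
  have hmean : ∀ τ, meanPlus q l μp u ζ y r τ = V⁻¹ * m τ := meanPlus_eq hl0 hr₂ hζs₂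
  have hZ0 : ∀ x, 0 ≤ ζ x ^ l := fun x => Real.rpow_nonneg (hζ.nonneg x) _
  have hZ1 : ∀ x, ζ x ^ l ≤ 1 := fun x => Real.rpow_le_one (hζ.nonneg x) (hζ.le_one x) hl0.le
  have hm0 : ∀ τ ∈ Set.Icc s t ∩ Set.Ioo 0 T,
      0 ≤ m τ ∧ m τ ≤ (spow q μp - spow q μm) * volume.real K := fun τ hτ => by
    constructor
    · refine integral_nonneg_of_ae ?_
      filter_upwards [hslice τ hτ] with x hx
      exact mul_nonneg (deficit_bounds hq hx).1 (hZ0 x)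
    · refine (Real.le_norm_self _).trans ?_
      have := norm_setIntegral_le_of_norm_le_const_ae (μ := volume) (s := K)
        (f := fun x => deficit q μp u x τ * ζ x ^ l) (C := spow q μp - spow q μm)
        hK.measure_lt_top ?_
      · exact this
      · filter_upwards [hslice τ hτ] with x hx
        have h3 := deficit_bounds hq hx
        rw [Real.norm_of_nonneg (mul_nonneg h3.1 (hZ0 x))]
        exact (mul_le_of_le_one_right h3.1 (hZ1 x)).trans h3.2
  have hbnd : ∀ τ ∈ Set.Icc s t ∩ Set.Ioo 0 T, 0 ≤ meanPlus q l μp u ζ y r τ ∧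
      meanPlus q l μp u ζ y r τ ≤ V⁻¹ * ((spow q μp - spow q μm) * volume.real K) := fun τ hτ => by
    rw [hmean]
    exact ⟨mul_nonneg (by positivity) (hm0 τ hτ).1,
      mul_le_mul_of_nonneg_left (hm0 τ hτ).2 (by positivity)⟩
  set I := meanPlus q l μp u ζ y r with hIdef
  set S := sSup (I '' (Set.Icc s t ∩ Set.Ioo 0 T)) with hS
  have hIS : ∀ τ ∈ Set.Icc s t ∩ Set.Ioo 0 T, I τ ≤ S := fun τ hτ =>
    le_csSup ⟨_, by rintro _ ⟨τ, hτ, rfl⟩; exact (hbnd τ hτ).2⟩ ⟨τ, hτ, rfl⟩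
  have hS0 : 0 ≤ S := by
    obtain ⟨τ, hτ⟩ := hJ
    exact (hbnd τ hτ).1.trans (hIS τ hτ)
  set M := max μp (-μm) with hM
  have hMm : -M ≤ μm := by have := le_max_right μp (-μm); linarith
  have hMp : μp ≤ M := le_max_left _ _
  have hM0 : 0 ≤ M := by linarith
  have hγ0 : 0 < γ := lt_of_lt_of_le (by positivity) hγ₂
  have hts : 0 < t - s := by linarith
  have hδ' : 0 < 1 - δ := by linarith
  -- If M = 0 then ν = M^(1-q) k would vanish, so this case is separate: both bounds are 0 and so is
  -- the mean.
  rcases hM0.eq_or_lt with hM00 | hMpos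
  · have hμm0 : μm = 0 := by linarith
    have hμp0 : μp = 0 := by linarith
    have hzero : ∀ τ ∈ Set.Icc s t ∩ Set.Ioo 0 T, I τ = 0 := fun τ hτ => by
      have h1 := (hbnd τ hτ).1
      have h2 := (hbnd τ hτ).2
      rw [hμm0, hμp0] at h2
      simp only [sub_self, zero_mul, mul_zero] at h2
      exact le_antisymm h2 h1
    refine supLeInf_of_oscillation (k := 0) hJ hδ1 hbnd (fun τ hτ τ' hτ' => ?_) ?_
    · rw [hzero τ hτ, hzero τ' hτ']
      simp only [sub_self, add_zero]
      positivity
    · simp only [mul_zero, zero_div]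
      positivity
  set c₀ := massConst p q K₁ (K₂ * l * c) with hc₀
  have hc₀0 : 0 < c₀ := by
    simp only [hc₀, massConst]
    have : 0 < (2 - p) / p := div_pos h2p hp0
    positivity
  -- The value required of k^(2-p); hence k is its power 1/(2-p).
  set X := c₀ * (δ * σ) ^ (-p) * ((M ^ (1 - q)) ^ (p - 1) * ((t - s) / r ^ p)) with hX
  have hX0 : 0 < X := by positivity
  have hkτ : (X ^ (1 / (2 - p))) ^ (2 - p) = X := by
    rw [← Real.rpow_mul hX0.le, one_div_mul_cancel h2p.ne', Real.rpow_one]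
  refine supLeInf_of_oscillation (k := X ^ (1 / (2 - p))) hJ hδ1 hbnd (fun τ hτ τ' hτ' => ?_) ?_
  · have hk0 : 0 < X ^ (1 / (2 - p)) := by positivity
    have hmS : ∀ τ ∈ Set.Icc s t ∩ Set.Ioo 0 T, m τ ≤ V * S := fun τ hτ => by
      have := hIS τ hτ
      rw [hmean, inv_mul_le_iff₀ hV0] at this
      exact this
    have habs : ∀ a ∈ Set.Icc s t ∩ Set.Ioo 0 T, ∀ b ∈ Set.Icc s t ∩ Set.Ioo 0 T, a < b →
        |m b - m a| ≤ δ * (V * S + X ^ (1 / (2 - p)) * volume.real K) := fun a ha b hb₁ hab =>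
      abs_mass_sub_le hp hp2 hq hq1 hK₁ hK₂ hl hc hσ0 hr hδ0 hδ1.le hk0 hΩ hA hsub hsup hr₁ hr₁₂
        hKΩ hst hI hMpos hMm hMp hb' hζ hζs (by positivity) hmS hkτ ha hb₁ hab
    have hKVk : δ * (V * S + X ^ (1 / (2 - p)) * volume.real K)
        -- Here S is the supremum of the mean, so V S bounds the mass.
        ≤ V * (δ * (S + X ^ (1 / (2 - p)))) := by
      have : X ^ (1 / (2 - p)) * volume.real K ≤ X ^ (1 / (2 - p)) * V := by gcongr
      nlinarith
    rw [hmean, hmean, ← mul_sub, inv_mul_le_iff₀ hV0]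
    rcases lt_trichotomy τ τ' with h | h | h
    · have := habs τ hτ τ' hτ' h
      rw [abs_sub_comm] at this
      exact (le_abs_self _).trans (this.trans hKVk)
    · rw [h, sub_self]; positivity
    · exact (le_abs_self _).trans ((habs τ' hτ' τ hτ h).trans hKVk)
  · have hXe : X ^ (1 / (2 - p)) = c₀ ^ (1 / (2 - p)) * (δ ^ (-(p / (2 - p))) * σ ^ (-(p / (2 - p))))
        * (M ^ ((1 - q) * (p - 1) / (2 - p)) * ((t - s) / r ^ p) ^ (1 / (2 - p))) := by
      have e1 : ((δ * σ) ^ (-p)) ^ (1 / (2 - p)) = δ ^ (-(p / (2 - p))) * σ ^ (-(p / (2 - p))) := by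
        rw [← Real.rpow_mul (by positivity), Real.mul_rpow hδ0.le hσ0.le,
          show -p * (1 / (2 - p)) = -(p / (2 - p)) by ring]
      have e2 : ((M ^ (1 - q)) ^ (p - 1)) ^ (1 / (2 - p)) = M ^ ((1 - q) * (p - 1) / (2 - p)) := by
        rw [← Real.rpow_mul hM0, ← Real.rpow_mul hM0,
          show (1 - q) * (p - 1) * (1 / (2 - p)) = (1 - q) * (p - 1) / (2 - p) by ring]
      rw [hX, Real.mul_rpow (by positivity) (by positivity), Real.mul_rpow hc₀0.le (by positivity),
        e1, Real.mul_rpow (x := (M ^ (1 - q)) ^ (p - 1)) (by positivity) (by positivity), e2]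
    -- For δ and σ below 1 the exponent p/(2-p) may be enlarged to γ, which thus serves both as
    -- factor and as exponent.
    have hneg : ∀ v : ℝ, 0 < v → v < 1 → v ^ (-(p / (2 - p))) ≤ (v ^ γ)⁻¹ := fun v hv hv1 => by
      rw [← Real.rpow_neg hv.le]
      exact Real.rpow_le_rpow_of_exponent_ge hv hv1.le (by linarith)
    have h1 := hneg δ hδ0 hδ1
    have h2 := hneg σ hσ0 hσ1
    set Y := M ^ ((1 - q) * (p - 1) / (2 - p)) * ((t - s) / r ^ p) ^ (1 / (2 - p)) with hY
    have hY0 : 0 ≤ Y := by positivity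
    rw [hXe, mul_assoc (γ / _), ← hY]
    calc δ * (c₀ ^ (1 / (2 - p)) * (δ ^ (-(p / (2 - p))) * σ ^ (-(p / (2 - p)))) * Y) / (1 - δ)
        ≤ 1 * (γ * ((δ ^ γ)⁻¹ * (σ ^ γ)⁻¹) * Y) / (1 - δ) := by gcongr
      _ = γ / ((1 - δ) * δ ^ γ * σ ^ γ) * Y := by field_simp

/-! ### Reflection u ↦ -u -/

section Reflection

variable {N : ℕ} {p q K₁ K₂ T : ℝ} {Ω : Set (Space N)}
  {A : Space N → ℝ → ℝ → Space N → Space N} {u : Space N → ℝ → ℝ} {Du : Space N → ℝ → Space N}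

/-- This is the field of the equation solved by -u. It has the same K₁ and K₂, so the same γ serves
both signs. -/
theorem IsAdmissibleField.reflect (hA : IsAdmissibleField p K₁ K₂ Ω T A) :
    IsAdmissibleField p K₁ K₂ Ω T (fun x τ v ξ => -A x τ (-v) (-ξ)) where
  measurable v ξ := (hA.measurable (-v) (-ξ)).neg
  continuous := hA.continuous.mono fun z hz => by
    have : Continuous fun w : ℝ × Space N => (-w.1, -w.2) := by fun_prop
    exact (hz.comp this).neg
  coercive := hA.coercive.mono fun z hz v ξ => by
    simpa using hz (-v) (-ξ)
  growth := hA.growth.mono fun z hz v ξ => by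
    simpa using hz (-v) (-ξ)

theorem HasWeakGradient.neg {f : Space N → ℝ} {g : Space N → Space N}
    (h : HasWeakGradient Ω f g) : HasWeakGradient Ω (fun x => -f x) (fun x => -g x) := by
  refine ⟨h.1.neg, h.2.1.neg, fun φ h1 h2 h3 => ?_⟩
  simp only [neg_smul, smul_neg, integral_neg, h.2.2 φ h1 h2 h3]

theorem MemCLocLpLoc.neg {m : ℝ} (h : MemCLocLpLoc m Ω T u) :
    MemCLocLpLoc m Ω T (fun x τ => -u x τ) := fun K hK hKΩ τ hτ => by
  refine ⟨(h K hK hKΩ τ hτ).1.neg, (h K hK hKΩ τ hτ).2.congr fun τ' => ?_⟩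
  rw [← eLpNorm_neg]
  congr 1
  ext x
  simp only [Pi.neg_apply]; ring

theorem MemLpLocSobolevLoc.neg (h : MemLpLocSobolevLoc p Ω T u Du) :
    MemLpLocSobolevLoc p Ω T (fun x τ => -u x τ) (fun x τ => -Du x τ) where
  measurable := h.measurable.neg
  measurable_grad := h.measurable_grad.neg
  weakGradient := h.weakGradient.mono fun _ hτ => hτ.neg
  memLp K hK hKΩ t₁ t₂ h₁ h₁₂ h₂ :=
    ⟨(h.memLp K hK hKΩ t₁ t₂ h₁ h₁₂ h₂).1.neg, (h.memLp K hK hKΩ t₁ t₂ h₁ h₁₂ h₂).2.neg⟩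

theorem weakForm_reflect (K : Set (Space N)) (t₁ t₂ : ℝ) (η ηt : Space N → ℝ → ℝ)
    (Dη : Space N → ℝ → Space N) :
    weakForm q (fun x τ v ξ => -A x τ (-v) (-ξ)) (fun x τ => -u x τ) (fun x τ => -Du x τ)
      K t₁ t₂ η ηt Dη = -weakForm q A u Du K t₁ t₂ η ηt Dη := by
  have h : ∀ a : ℝ, ∫ x in K, spow q (-u x a) * η x a = -∫ x in K, spow q (u x a) * η x a :=
    fun a => by simp only [spow_neg, neg_mul, integral_neg]
  have h' : (∫ z in K ×ˢ Set.Icc t₁ t₂, (-(spow q (-u z.1 z.2) * ηt z.1 z.2) +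
      inner ℝ (-A z.1 z.2 (-(-u z.1 z.2)) (-(-Du z.1 z.2))) (Dη z.1 z.2))) =
      -∫ z in K ×ˢ Set.Icc t₁ t₂, (-(spow q (u z.1 z.2) * ηt z.1 z.2) +
        inner ℝ (A z.1 z.2 (u z.1 z.2) (Du z.1 z.2)) (Dη z.1 z.2)) := by
    rw [← integral_neg]
    refine integral_congr_ae (ae_of_all _ fun z => ?_)
    simp only [spow_neg, neg_neg, inner_neg_left]
    ring
  simp only [weakForm]
  rw [h, h, h']
  ring

theorem IsLocalWeakSubsolution.reflect (h : IsLocalWeakSubsolution p q Ω T A u Du) :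
    IsLocalWeakSupersolution p q Ω T (fun x τ v ξ => -A x τ (-v) (-ξ)) (fun x τ => -u x τ)
      (fun x τ => -Du x τ) :=
  ⟨h.1.neg, h.2.1.neg, fun K hK hKΩ t₁ t₂ h₁ h₁₂ h₂ η ηt Dη hη => by
    rw [weakForm_reflect]
    linarith [h.2.2 K hK hKΩ t₁ t₂ h₁ h₁₂ h₂ η ηt Dη hη]⟩

theorem IsLocalWeakSupersolution.reflect (h : IsLocalWeakSupersolution p q Ω T A u Du) :
    IsLocalWeakSubsolution p q Ω T (fun x τ v ξ => -A x τ (-v) (-ξ)) (fun x τ => -u x τ)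
      (fun x τ => -Du x τ) :=
  ⟨h.1.neg, h.2.1.neg, fun K hK hKΩ t₁ t₂ h₁ h₁₂ h₂ η ηt Dη hη => by
    rw [weakForm_reflect]
    linarith [h.2.2 K hK hKΩ t₁ t₂ h₁ h₁₂ h₂ η ηt Dη hη]⟩

theorem meanMinus_eq_meanPlus (q l m : ℝ) (u : Space N → ℝ → ℝ) (ζ : Space N → ℝ) (y : Space N)
    (r : ℝ) : meanMinus q l m u ζ y r = meanPlus q l (-m) (fun x τ => -u x τ) ζ y r := by
  ext τ
  simp only [meanMinus, meanPlus, spow_neg]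
  congr 1
  ext x
  ring

end Reflection

end DNL

/-! ### Both signs -/

theorem theorem1p2 (N : ℕ) (hN : 1 ≤ N) (p q K₁ K₂ l c : ℝ)
    (hq : 0 < q) (hqp : q < p - 1) (hp : p < 2) (hK₁ : 0 < K₁) (hK₂ : 0 < K₂)
    (hl : 2 * p ^ 2 / (2 - p) ≤ l) (hc : 0 < c) :
    ∃ γ : ℝ, 0 < γ ∧
      ∀ (Ω : Set (DNL.Space N)) (T : ℝ) (A : DNL.Space N → ℝ → ℝ → DNL.Space N → DNL.Space N)
        (u : DNL.Space N → ℝ → ℝ),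
        IsOpen Ω → DNL.IsAdmissibleField p K₁ K₂ Ω T A →
        DNL.IsLocallyBounded Ω T u → DNL.IsLocalWeakSolution p q Ω T A u →
      ∀ (y : DNL.Space N) (r s t μm μp : ℝ), 0 < r → s < t →
        Metric.ball y r ×ˢ Set.Ioo s t ⊆ Ω ×ˢ Set.Ioo 0 T →
        (∀ᵐ z : DNL.Space N × ℝ
          ∂(MeasureTheory.volume.restrict (Metric.ball y r ×ˢ Set.Ioo s t)),
            μm ≤ u z.1 z.2 ∧ u z.1 z.2 ≤ μp) →
      ∀ δ ∈ Set.Ioo (0 : ℝ) 1, ∀ σ ∈ Set.Ioo (0 : ℝ) 1,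
      ∀ ζ : DNL.Space N → ℝ, DNL.IsCutoff c σ r y ζ →
        DNL.SupLeInf δ
          (γ / ((1 - δ) * δ ^ γ * σ ^ γ) * max μp (-μm) ^ ((1 - q) * (p - 1) / (2 - p)) *
            ((t - s) / r ^ p) ^ (1 / (2 - p)))
          (Set.Icc s t ∩ Set.Ioo 0 T) (DNL.meanPlus q l μp u ζ y r) ∧
        DNL.SupLeInf δ
          (γ / ((1 - δ) * δ ^ γ * σ ^ γ) * max μp (-μm) ^ ((1 - q) * (p - 1) / (2 - p)) *
            ((t - s) / r ^ p) ^ (1 / (2 - p)))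
          (Set.Icc s t ∩ Set.Ioo 0 T) (DNL.meanMinus q l μm u ζ y r) := by
  have hp0 : 0 < p := by linarith
  have h2p : 0 < 2 - p := by linarith
  refine ⟨max (DNL.massConst p q K₁ (K₂ * l * c) ^ (1 / (2 - p))) (p / (2 - p)),
    lt_of_lt_of_le (by positivity) (le_max_right _ _), ?_⟩
  intro Ω T A u hΩ hA _ hu y r s t μm μp hr hst hcyl hb δ hδ σ hσ ζ hζ
  obtain ⟨Du, hsub, hsup⟩ := hu
  refine ⟨DNL.supLeInf_meanPlus hq hqp hp hK₁ hK₂ hl hc (le_max_left _ _) (le_max_right _ _) hΩ hA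
    hsub hsup hr hst hcyl hb hδ hσ hζ, ?_⟩
  -- Reflection exchanges sub- and supersolution and turns the bounds into -μ⁺ ≤ -u ≤ -μ⁻, which
  -- leaves max(μ⁺, -μ⁻) unchanged.
  have h := DNL.supLeInf_meanPlus hq hqp hp hK₁ hK₂ hl hc (le_max_left _ _) (le_max_right _ _) hΩ
    hA.reflect hsup.reflect hsub.reflect hr hst hcyl (μm := -μp) (μp := -μm)
    (hb.mono fun z hz => ⟨neg_le_neg hz.2, neg_le_neg hz.1⟩) hδ hσ hζ
  rwa [neg_neg, max_comm (-μm) μp, ← DNL.meanMinus_eq_meanPlus] at h
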